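/- Conventions. $\mathbb N=\{1,2,3,\dots\}$; scalars are real; $c_{00}$ is the space of finitely supported real sequences on $\mathbb N$, with unit vectors $e_k$, and $Ex$ is the restriction of $x\in c_{00}$ to $E\subseteq\mathbb N$. The Schreier families are $\mathcal S_0=\{\emptyset\}\cup\{\{n\}:n\in\mathbb N\}$, $\mathcal S_1=\{\emptyset\}\cup\{A\subset\mathbb N \text{ finite nonempty}: |A|\le\min A\}$, and $\mathcal S_{n+1}$ consists of all unions $G_1\cup\dots\cup G_k$ with nonempty $G_i\in\mathcal S_n$, $G_1<\dots<G_k$ and $\{\min G_1,\dots,\min G_k\}\in\mathcal S_1$. Let $(\theta_n)_{n\ge1}$ be a null sequence in $(0,1)$ and let $\sigma_n\in\{U,M\}$ for every $n$, with $\sigma_{p_0}=M$ for at least one $p_0$. A finite family $(E_i)_{i=1}^k$ of nonempty subsets of $\mathbb N$ is $(\mathcal S_n,\sigma_n)$-adapted if $\{\min E_i : 1\le i\le k\}\in\mathcal S_n$ and the $E_i$ are pairwise disjoint (if $\sigma_n=M$), respectively $E_1<E_2<\dots<E_k$ (if $\sigma_n=U$). The partly modified mixed Tsirelson space $X=T[(\mathcal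 S_n,\sigma_n,\theta_n)_{n=1}^\infty]$ is the completion of $c_{00}$ under the norm determined by $$\|x\|=\max\Big\{\|x\|_{c_0},\ \sup_n\theta_n\sup\sum_i\|E_ix\|\Big\},$$ the inner supremum being over all $(\mathcal S_n,\sigma_n)$-adapted families $(E_i)$. A block subspace of $X$ is the closed linear span of a normalized block basis of $(e_k)$, i.e. of a sequence of norm-one vectors $y_1,y_2,\dots\in c_{00}$ with $\operatorname{supp}y_1<\operatorname{supp}y_2<\cdots$. For a Banach space $B$ and $1\le K<\infty$, an $\ell^1$-$K$-tree in $B$ is a set $\mathcal T$ of nonempty finite sequences in $B$, closed under nonempty initial segments, such that every $(x_1,\dots,x_n)\in\mathcal T$ satisfies $\|x_i\|=1$ for all $i$ and $\|\sum a_ix_i\|\ge K^{-1}\sum|a_i|$ for all scalars $a_1,\dots,a_n$. It is well-founded if there is no infinite sequence all of whose nonempty initial segments are in $\mathcal T$. Let $\mathcal D(\mathcal T)$ be the set of $(x_1,\dots,x_n)\in\mathcal T$ with $(x_1,\dots,x_n,x)\in\mathcal T$ for some $x$; iterate $\mathcal D$ transfinitely, taking intersections at limit ordinals, and let the order of a well-founded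 $\mathcal T$ be the least $\alpha$ with $\mathcal D^{(\alpha)}(\mathcal T)=\emptyset$. The Bourgain $\ell^1$-index $I(B)$ is the supremum, over all $K$, of the orders of the well-founded $\ell^1$-$K$-trees in $B$. (If $B$ does not contain $\ell^1$, all $\ell^1$-$K$-trees in $B$ are well-founded.) Two Banach spaces are totally incomparable if they do not have isomorphic infinite-dimensional closed subspaces. A Banach space is quasi-minimal if it does not contain a pair of totally incomparable infinite-dimensional closed subspaces. Corollary. Let $X=T[(\mathcal S_n,\sigma_n,\theta_n)_{n=1}^\infty]$ be a partly modified mixed Tsirelson space. (1) If $I(Y)>\omega^\omega$ for every block subspace $Y$ of $X$, then $X$ is quasi-minimal. (2) If there exists $\varepsilon>0$ such that $\sup\{n/m : n,m\in\mathbb N,\ \theta_n\ge\varepsilon^m\}=\infty$, then $I(Y)>\omega^\omega$ for every block subspace $Y$ of $X$, and $X$ is quasi-minimal. (3) If $\sup_n\theta_n^{1/n}=1$, then the condition of (2) holds for some $\varepsilon>0$; in particular $I(Y)>\omega^\omega$ for every block subspace $Y$ of $X$, and $X$ is quasi-minimal. -/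

import Mathlib

open Filter Topology

/-! ### Schreier families on `ℕ+ = {1, 2, 3, …}` -/

/-- `F[G]`: all unions `G₁ ∪ ⋯ ∪ G_k` with nonempty `G_i ∈ G`, `G₁ < ⋯ < G_k` and
`{min G₁, …, min G_k} ∈ F`. -/
def familyComp (F G : Set (Finset ℕ+)) : Set (Finset ℕ+) :=
  {A | ∃ (k : ℕ) (B : Fin k → Finset ℕ+) (hB : ∀ i, (B i).Nonempty),
    (∀ i, B i ∈ G) ∧
    (∀ i j, i < j → ∀ a ∈ B i, ∀ b ∈ B j, a < b) ∧
    (Finset.univ.image fun i => (B i).min' (hB i)) ∈ F ∧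
    A = Finset.univ.biUnion B}

/-- `S₁`: the finite sets `A` with `|A| ≤ min A`, together with the empty set. -/
def schreierOne : Set (Finset ℕ+) := {A | ∀ a ∈ A, A.card ≤ (a : ℕ)}

/-- The Schreier families of finite order: `S₀` consists of the singletons and the empty set,
and `S_{n+1} = S₁[S_n]`. -/
def schreier : ℕ → Set (Finset ℕ+)
  | 0 => {A | A.card ≤ 1}
  | n + 1 => familyComp schreierOne (schreier n)

/-- Consistency check: the recursion gives the explicit family `S₁`. -/
theorem schreier_one : schreier 1 = schreierOne := by
  ext A
  constructor
  · rintro ⟨k, B, hB, hG, hlt, hF, rfl⟩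
    have hone : ∀ i, B i = {(B i).min' (hB i)} := by
      intro i
      have h1 : (B i).card ≤ 1 := hG i
      rw [Finset.card_le_one] at h1
      ext b
      simp only [Finset.mem_singleton]
      exact ⟨fun hb => h1 _ hb _ ((B i).min'_mem _), fun hb => hb ▸ (B i).min'_mem _⟩
    have he : Finset.univ.biUnion B = Finset.univ.image fun i => (B i).min' (hB i) := by
      ext b
      simp only [Finset.mem_biUnion, Finset.mem_univ, true_and, Finset.mem_image]
      refine exists_congr fun i => ?_
      constructor
      · intro hb
        rw [hone i, Finset.mem_singleton] at hb
        exact hb.symm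
      · rintro rfl
        exact (B i).min'_mem _
    rw [he]
    exact hF
  · intro hA
    refine ⟨A.card, fun i => {A.orderEmbOfFin rfl i}, fun i => Finset.singleton_nonempty _,
      fun i => ?_, ?_, ?_, ?_⟩
    · simp [schreier]
    · intro i j hij a ha b hb
      rw [Finset.mem_singleton] at ha hb
      rw [ha, hb]
      exact (A.orderEmbOfFin rfl).strictMono hij
    · simpa using hA
    · ext b
      have : b ∈ A ↔ b ∈ Set.range (A.orderEmbOfFin rfl) := by
        rw [Finset.range_orderEmbOfFin]; rfl
      rw [this]
      simp only [Finset.mem_biUnion, Finset.mem_univ, true_and, Finset.mem_singleton,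
        Set.mem_range]
      exact exists_congr fun i => eq_comm

/-! ### Adapted families and the implicitly defined norm -/

/-- The two kinds of families: `U` (unmodified, successive sets) and `M` (modified, disjoint
sets). -/
inductive AdaptType where
  | U
  | M

/-- The separation condition on a family of sets prescribed by its kind. -/
def AdaptType.Separated {k : ℕ} (E : Fin k → Finset ℕ+) : AdaptType → Prop
  | .U => ∀ i j, i < j → ∀ a ∈ E i, ∀ b ∈ E j, a < b
  | .M => ∀ i j, i ≠ j → Disjoint (E i) (E j)

/-- An `(S_n, s)`-adapted family `(E_i)_{i=1}^k` of (nonempty, finite) subsets of `ℕ+`. -/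
structure AdaptedFamily (n : ℕ) (s : AdaptType) where
  k : ℕ
  E : Fin k → Finset ℕ+
  nonempty : ∀ i, (E i).Nonempty
  mins_mem : (Finset.univ.image fun i => (E i).min' (nonempty i)) ∈ schreier n
  separated : s.Separated E

/-- The data of a partly modified mixed Tsirelson space: a null sequence `θ` in `(0, 1)` and a
choice of kinds `σ`, at least one of them being `M`. -/
structure TsirelsonData where
  θ : ℕ+ → ℝ
  σ : ℕ+ → AdaptType
  θ_pos : ∀ n, 0 < θ n
  θ_lt_one : ∀ n, θ n < 1
  θ_null : Tendsto θ atTop (𝓝 0)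
  exists_modified : ∃ p, σ p = AdaptType.M

noncomputable section

/-- The sup norm on `c₀₀`. -/
def supNorm (x : ℕ+ →₀ ℝ) : ℝ := ⨆ i, |x i|

/-- The `ℓ¹` norm on `c₀₀`; an upper bound for all the norms below. -/
def ellOneNorm (x : ℕ+ →₀ ℝ) : ℝ := ∑ i ∈ x.support, |x i|

/-- `E x`, the restriction of the vector `x` to the set `E`. -/
def restrictTo (E : Finset ℕ+) (x : ℕ+ →₀ ℝ) : ℕ+ →₀ ℝ := x.filter (· ∈ E)

namespace TsirelsonData

variable (D : TsirelsonData)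

/-- The right-hand side of the implicit equation:
`max {‖x‖_∞, sup_n θ_n sup ∑ f (E_i x)}`, the inner supremum being over all
`(S_n, σ_n)`-adapted families. -/
def step (f : (ℕ+ →₀ ℝ) → ℝ) (x : ℕ+ →₀ ℝ) : ℝ :=
  max (supNorm x)
    (⨆ n : ℕ+, D.θ n * ⨆ F : AdaptedFamily n (D.σ n), ∑ i, f (restrictTo (F.E i) x))

/-- The approximating norms `‖·‖₀ = ‖·‖_∞`, `‖·‖_{m+1} = step ‖·‖_m`. -/
def iterNorm : ℕ → (ℕ+ →₀ ℝ) → ℝ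
  | 0 => supNorm
  | m + 1 => D.step (iterNorm m)

/-- The norm of the partly modified mixed Tsirelson space on `c₀₀`. -/
def tnorm (x : ℕ+ →₀ ℝ) : ℝ := ⨆ m, D.iterNorm m x

end TsirelsonData

/-! Elementary facts needed to know that this is a norm solving the implicit equation. -/

theorem bddAbove_abs (x : ℕ+ →₀ ℝ) : BddAbove (Set.range fun i => |x i|) := by
  refine ⟨ellOneNorm x, ?_⟩
  rintro _ ⟨i, rfl⟩
  by_cases hi : i ∈ x.support
  · exact Finset.single_le_sum (f := fun i => |x i|) (fun j _ => abs_nonneg _) hi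
  · simp only [Finsupp.mem_support_iff, not_not] at hi
    simp only [hi, abs_zero]
    exact Finset.sum_nonneg fun j _ => abs_nonneg _

theorem abs_le_supNorm (x : ℕ+ →₀ ℝ) (i : ℕ+) : |x i| ≤ supNorm x :=
  le_ciSup (bddAbove_abs x) i

theorem supNorm_nonneg (x : ℕ+ →₀ ℝ) : 0 ≤ supNorm x :=
  (abs_nonneg _).trans (abs_le_supNorm x 1)

theorem ellOneNorm_eq_sum (x : ℕ+ →₀ ℝ) {s : Finset ℕ+} (h : x.support ⊆ s) :
    ellOneNorm x = ∑ i ∈ s, |x i| := by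
  refine Finset.sum_subset h fun i _ hi => ?_
  simp only [Finsupp.mem_support_iff, not_not] at hi
  simp [hi]

theorem ellOneNorm_nonneg (x : ℕ+ →₀ ℝ) : 0 ≤ ellOneNorm x :=
  Finset.sum_nonneg fun _ _ => abs_nonneg _

theorem supNorm_le_ellOneNorm (x : ℕ+ →₀ ℝ) : supNorm x ≤ ellOneNorm x := by
  refine ciSup_le fun i => ?_
  by_cases hi : i ∈ x.support
  · exact Finset.single_le_sum (f := fun i => |x i|) (fun j _ => abs_nonneg _) hi
  · simp only [Finsupp.mem_support_iff, not_not] at hi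
    simp only [hi, abs_zero]
    exact ellOneNorm_nonneg x

theorem AdaptedFamily.disjoint {n : ℕ} {s : AdaptType} (F : AdaptedFamily n s) {i j : Fin F.k}
    (h : i ≠ j) : Disjoint (F.E i) (F.E j) := by
  have hs := F.separated
  cases s with
  | M => exact hs i j h
  | U =>
    rw [Finset.disjoint_left]
    intro a ha hb
    rcases lt_or_gt_of_ne h with h | h
    · exact lt_irrefl _ (hs i j h a ha a hb)
    · exact lt_irrefl _ (hs j i h a hb a ha)

/-- The empty family is adapted. -/
def AdaptedFamily.empty (n : ℕ) (s : AdaptType) : AdaptedFamily n s where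
  k := 0
  E := Fin.elim0
  nonempty := fun i => i.elim0
  mins_mem := by
    cases n with
    | zero => simp [schreier]
    | succ n =>
      exact ⟨0, Fin.elim0, fun i => i.elim0, fun i => i.elim0, fun i => i.elim0,
        by simp [schreierOne], by simp⟩
  separated := by
    cases s with
    | U => exact fun i => i.elim0
    | M => exact fun i => i.elim0

instance (n : ℕ) (s : AdaptType) : Nonempty (AdaptedFamily n s) := ⟨AdaptedFamily.empty n s⟩

theorem sum_ellOneNorm_le {n : ℕ} {s : AdaptType} (F : AdaptedFamily n s) (x : ℕ+ →₀ ℝ) :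
    ∑ i, ellOneNorm (restrictTo (F.E i) x) ≤ ellOneNorm x := by
  have h1 : ∀ i, ellOneNorm (restrictTo (F.E i) x) =
      ∑ j ∈ x.support.filter (· ∈ F.E i), |x j| := by
    intro i
    unfold ellOneNorm restrictTo
    rw [Finsupp.support_filter]
    refine Finset.sum_congr rfl fun j hj => ?_
    rw [Finsupp.filter_apply_pos (fun j => j ∈ F.E i) x (Finset.mem_filter.1 hj).2]
  simp_rw [h1]
  rw [← Finset.sum_biUnion]
  · refine Finset.sum_le_sum_of_subset_of_nonneg ?_ fun _ _ _ => abs_nonneg _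
    intro j hj
    simp only [Finset.mem_biUnion, Finset.mem_univ, true_and, Finset.mem_filter] at hj
    obtain ⟨_, h, _⟩ := hj
    exact h
  · intro i _ j _ hij
    refine Finset.disjoint_left.2 fun a ha hb => ?_
    exact Finset.disjoint_left.1 (F.disjoint hij) (Finset.mem_filter.1 ha).2
      (Finset.mem_filter.1 hb).2

namespace TsirelsonData

variable (D : TsirelsonData) {f g : (ℕ+ →₀ ℝ) → ℝ}

theorem le_step (h0 : ∀ x, 0 ≤ f x) (h1 : ∀ x, f x ≤ ellOneNorm x) (x : ℕ+ →₀ ℝ) (n : ℕ+)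
    (F : AdaptedFamily n (D.σ n)) :
    D.θ n * ∑ i, f (restrictTo (F.E i) x) ≤ D.step f x := by
  have hb : ∀ (n : ℕ+) (F : AdaptedFamily n (D.σ n)),
      ∑ i, f (restrictTo (F.E i) x) ≤ ellOneNorm x := fun n F =>
    (Finset.sum_le_sum fun i _ => h1 _).trans (sum_ellOneNorm_le F x)
  have hin : D.θ n * ∑ i, f (restrictTo (F.E i) x) ≤
      D.θ n * ⨆ F : AdaptedFamily n (D.σ n), ∑ i, f (restrictTo (F.E i) x) := by
    refine mul_le_mul_of_nonneg_left ?_ (D.θ_pos n).le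
    exact le_ciSup (f := fun F : AdaptedFamily n (D.σ n) => ∑ i, f (restrictTo (F.E i) x))
      ⟨ellOneNorm x, by rintro _ ⟨F, rfl⟩; exact hb n F⟩ F
  refine hin.trans (le_trans ?_ (le_max_right _ _))
  refine le_ciSup (f := fun n : ℕ+ =>
    D.θ n * ⨆ F : AdaptedFamily n (D.σ n), ∑ i, f (restrictTo (F.E i) x)) ⟨ellOneNorm x, ?_⟩ n
  rintro _ ⟨m, rfl⟩
  have h2 : ⨆ F : AdaptedFamily m (D.σ m), ∑ i, f (restrictTo (F.E i) x) ≤ ellOneNorm x :=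
    ciSup_le fun F => hb m F
  have h3 : 0 ≤ ⨆ F : AdaptedFamily m (D.σ m), ∑ i, f (restrictTo (F.E i) x) :=
    Real.iSup_nonneg fun F => Finset.sum_nonneg fun i _ => h0 _
  exact (mul_le_of_le_one_left h3 (D.θ_lt_one m).le).trans h2

theorem step_le {x : ℕ+ →₀ ℝ} {b : ℝ} (hs : supNorm x ≤ b)
    (h : ∀ (n : ℕ+) (F : AdaptedFamily n (D.σ n)),
      D.θ n * ∑ i, f (restrictTo (F.E i) x) ≤ b) : D.step f x ≤ b := by
  refine max_le hs (ciSup_le fun n => ?_)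
  rw [Real.mul_iSup_of_nonneg (D.θ_pos n).le]
  exact ciSup_le fun F => h n F

theorem iterNorm_bounds (m : ℕ) :
    ∀ x, supNorm x ≤ D.iterNorm m x ∧ D.iterNorm m x ≤ ellOneNorm x := by
  induction m with
  | zero => exact fun x => ⟨le_rfl, supNorm_le_ellOneNorm x⟩
  | succ m ih =>
    intro x
    refine ⟨le_max_left _ _, D.step_le (supNorm_le_ellOneNorm x) fun n F => ?_⟩
    have h0 : 0 ≤ ∑ i, D.iterNorm m (restrictTo (F.E i) x) :=
      Finset.sum_nonneg fun i _ => (supNorm_nonneg _).trans (ih _).1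
    exact (mul_le_of_le_one_left h0 (D.θ_lt_one n).le).trans
      ((Finset.sum_le_sum fun i _ => (ih _).2).trans (sum_ellOneNorm_le F x))

theorem iterNorm_nonneg (m : ℕ) (x : ℕ+ →₀ ℝ) : 0 ≤ D.iterNorm m x :=
  (supNorm_nonneg x).trans (D.iterNorm_bounds m x).1

theorem iterNorm_le_succ (m : ℕ) : ∀ x, D.iterNorm m x ≤ D.iterNorm (m + 1) x := by
  induction m with
  | zero => exact fun x => le_max_left _ _
  | succ m ih =>
    intro x
    refine D.step_le (le_max_left _ _) fun n F => le_trans ?_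
      (D.le_step (D.iterNorm_nonneg (m + 1)) (fun y => (D.iterNorm_bounds (m + 1) y).2) x n F)
    exact mul_le_mul_of_nonneg_left (Finset.sum_le_sum fun i _ => ih _) (D.θ_pos n).le

theorem iterNorm_mono (x : ℕ+ →₀ ℝ) : Monotone fun m => D.iterNorm m x :=
  monotone_nat_of_le_succ fun m => D.iterNorm_le_succ m x

theorem iterNorm_bddAbove (x : ℕ+ →₀ ℝ) : BddAbove (Set.range fun m => D.iterNorm m x) :=
  ⟨ellOneNorm x, by rintro _ ⟨m, rfl⟩; exact (D.iterNorm_bounds m x).2⟩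

theorem iterNorm_le_tnorm (m : ℕ) (x : ℕ+ →₀ ℝ) : D.iterNorm m x ≤ D.tnorm x :=
  le_ciSup (D.iterNorm_bddAbove x) m

theorem tendsto_iterNorm (x : ℕ+ →₀ ℝ) :
    Tendsto (fun m => D.iterNorm m x) atTop (𝓝 (D.tnorm x)) :=
  tendsto_atTop_ciSup (D.iterNorm_mono x) (D.iterNorm_bddAbove x)

theorem tnorm_le_ellOneNorm (x : ℕ+ →₀ ℝ) : D.tnorm x ≤ ellOneNorm x :=
  ciSup_le fun m => (D.iterNorm_bounds m x).2

theorem supNorm_le_tnorm (x : ℕ+ →₀ ℝ) : supNorm x ≤ D.tnorm x :=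
  D.iterNorm_le_tnorm 0 x

theorem tnorm_nonneg (x : ℕ+ →₀ ℝ) : 0 ≤ D.tnorm x :=
  (supNorm_nonneg x).trans (D.supNorm_le_tnorm x)

/-- The norm solves the implicit equation
`‖x‖ = max {‖x‖_∞, sup_n θ_n sup ∑ ‖E_i x‖}`. -/
theorem tnorm_eq_step (x : ℕ+ →₀ ℝ) : D.tnorm x = D.step D.tnorm x := by
  apply le_antisymm
  · refine ciSup_le fun m => ?_
    refine (D.iterNorm_le_succ m x).trans (D.step_le (le_max_left _ _) fun n F => ?_)
    refine le_trans ?_ (D.le_step D.tnorm_nonneg D.tnorm_le_ellOneNorm x n F)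
    exact mul_le_mul_of_nonneg_left
      (Finset.sum_le_sum fun i _ => D.iterNorm_le_tnorm m _) (D.θ_pos n).le
  · refine D.step_le (D.supNorm_le_tnorm x) fun n F => ?_
    have ht : Tendsto (fun m => D.θ n * ∑ i, D.iterNorm m (restrictTo (F.E i) x)) atTop
        (𝓝 (D.θ n * ∑ i, D.tnorm (restrictTo (F.E i) x))) :=
      (tendsto_finsetSum _ fun i _ => D.tendsto_iterNorm _).const_mul _
    refine le_of_tendsto' ht fun m => ?_
    exact (D.le_step (D.iterNorm_nonneg m) (fun y => (D.iterNorm_bounds m y).2) x n F).trans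
      (D.iterNorm_le_tnorm (m + 1) x)

theorem supNorm_add_le (x y : ℕ+ →₀ ℝ) : supNorm (x + y) ≤ supNorm x + supNorm y :=
  ciSup_le fun i => (abs_add_le _ _).trans
    (add_le_add (abs_le_supNorm x i) (abs_le_supNorm y i))

theorem iterNorm_add_le (m : ℕ) :
    ∀ x y, D.iterNorm m (x + y) ≤ D.iterNorm m x + D.iterNorm m y := by
  induction m with
  | zero => exact supNorm_add_le
  | succ m ih =>
    intro x y
    refine D.step_le ((supNorm_add_le x y).trans
      (add_le_add (D.iterNorm_bounds _ x).1 (D.iterNorm_bounds _ y).1)) fun n F => ?_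
    have hx := D.le_step (D.iterNorm_nonneg m) (fun y => (D.iterNorm_bounds m y).2) x n F
    have hy := D.le_step (D.iterNorm_nonneg m) (fun y => (D.iterNorm_bounds m y).2) y n F
    refine le_trans ?_ (add_le_add hx hy)
    rw [← mul_add, ← Finset.sum_add_distrib]
    refine mul_le_mul_of_nonneg_left (Finset.sum_le_sum fun i _ => ?_) (D.θ_pos n).le
    have : restrictTo (F.E i) (x + y) = restrictTo (F.E i) x + restrictTo (F.E i) y :=
      Finsupp.filter_add
    rw [this]
    exact ih _ _

theorem tnorm_add_le (x y : ℕ+ →₀ ℝ) : D.tnorm (x + y) ≤ D.tnorm x + D.tnorm y :=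
  ciSup_le fun m => (D.iterNorm_add_le m x y).trans
    (add_le_add (D.iterNorm_le_tnorm m x) (D.iterNorm_le_tnorm m y))

theorem supNorm_smul (c : ℝ) (x : ℕ+ →₀ ℝ) : supNorm (c • x) = |c| * supNorm x := by
  unfold supNorm
  rw [Real.mul_iSup_of_nonneg (abs_nonneg c)]
  simp [abs_mul]

theorem iterNorm_smul (c : ℝ) (m : ℕ) :
    ∀ x, D.iterNorm m (c • x) = |c| * D.iterNorm m x := by
  induction m with
  | zero => exact supNorm_smul c
  | succ m ih =>
    intro x
    have hr : ∀ (E : Finset ℕ+), restrictTo E (c • x) = c • restrictTo E x := fun E =>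
      Finsupp.filter_smul
    change D.step _ _ = |c| * D.step _ _
    unfold step
    rw [mul_max_of_nonneg _ _ (abs_nonneg c), supNorm_smul,
      Real.mul_iSup_of_nonneg (abs_nonneg c)]
    congr 1
    refine iSup_congr fun n => ?_
    rw [mul_left_comm, Real.mul_iSup_of_nonneg (abs_nonneg c)]
    congr 1
    refine iSup_congr fun F => ?_
    rw [Finset.mul_sum]
    exact Finset.sum_congr rfl fun i _ => by rw [hr, ih]

theorem tnorm_smul (c : ℝ) (x : ℕ+ →₀ ℝ) : D.tnorm (c • x) = |c| * D.tnorm x := by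
  unfold tnorm
  rw [Real.mul_iSup_of_nonneg (abs_nonneg c)]
  exact iSup_congr fun m => D.iterNorm_smul c m x

theorem eq_zero_of_tnorm {x : ℕ+ →₀ ℝ} (h : D.tnorm x = 0) : x = 0 := by
  ext i
  have := (abs_le_supNorm x i).trans ((D.supNorm_le_tnorm x).trans h.le)
  simpa using this

/-! ### The space -/

/-- The space `c₀₀` of finitely supported real sequences, to be normed by `D.tnorm`. -/
def C00 (_ : TsirelsonData) : Type := ℕ+ →₀ ℝ

instance : AddCommGroup D.C00 := inferInstanceAs (AddCommGroup (ℕ+ →₀ ℝ))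

instance : Module ℝ D.C00 := inferInstanceAs (Module ℝ (ℕ+ →₀ ℝ))

instance : Norm D.C00 := ⟨D.tnorm⟩

theorem normCore : NormedSpace.Core ℝ D.C00 where
  norm_nonneg x := D.tnorm_nonneg x
  norm_smul c x := D.tnorm_smul c x
  norm_triangle x y := D.tnorm_add_le x y
  norm_eq_zero_iff x := ⟨fun h => D.eq_zero_of_tnorm h, fun h => by
    subst h
    change D.tnorm 0 = 0
    have := D.tnorm_smul 0 0
    simpa using this⟩

instance : NormedAddCommGroup D.C00 := NormedAddCommGroup.ofCore D.normCore

instance : NormedSpace ℝ D.C00 := NormedSpace.ofCore D.normCore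

/-- The partly modified mixed Tsirelson space `T[(S_n, σ_n, θ_n)_{n ≥ 1}]`: the completion of
`c₀₀` under the implicitly defined norm. -/
abbrev Space : Type := UniformSpace.Completion D.C00

/-- The support of a vector of `c₀₀`. -/
def support (x : D.C00) : Finset ℕ+ := Finsupp.support (M := ℝ) x

/-- `(y_n)` is a normalized block basis of the unit vector basis `(e_k)` of the space:
normalized finitely supported vectors with `supp y₀ < supp y₁ < ⋯`. -/
def IsNormalizedBlockBasis (y : ℕ → D.Space) : Prop :=
  ∃ u : ℕ → D.C00, (∀ n, y n = (u n : D.Space)) ∧ (∀ n, ‖y n‖ = 1) ∧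
    ∀ m n, m < n → ∀ i ∈ D.support (u m), ∀ j ∈ D.support (u n), i < j

/-- `Y` is a block subspace: the closed linear span of a normalized block basis. -/
def IsBlockSubspace (Y : Submodule ℝ D.Space) : Prop :=
  ∃ y : ℕ → D.Space, D.IsNormalizedBlockBasis y ∧
    Y = (Submodule.span ℝ (Set.range y)).topologicalClosure

end TsirelsonData

/-! ### Trees and Bourgain's `ℓ¹`-index -/

section Trees

universe u

/-- A tree in `B`: a set of nonempty finite sequences that is closed under passing to nonempty
initial segments. -/
def IsSeqTree {B : Type u} (T : Set (List B)) : Prop :=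
  [] ∉ T ∧ ∀ (s : List B) (x : B), s ≠ [] → s ++ [x] ∈ T → s ∈ T

/-- Well-foundedness: no infinite sequence has all its (nonempty) initial segments in `T`. -/
def IsWellFoundedTree {B : Type u} (T : Set (List B)) : Prop :=
  ¬ ∃ x : ℕ → B, ∀ m : ℕ, (List.range (m + 1)).map x ∈ T

/-- The nodes of `T` that have a proper extension in `T`. -/
def derivedTree {B : Type u} (T : Set (List B)) : Set (List B) :=
  {s | s ∈ T ∧ ∃ x, s ++ [x] ∈ T}

/-- The iterated derived trees `D^(α)(T)`: one derivation at successors, intersections at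
limits. -/
def iterDerivedTree {B : Type u} (T : Set (List B)) (α : Ordinal.{u}) : Set (List B) :=
  Ordinal.limitRecOn α T (fun _ S => derivedTree S) (fun o _ S => ⋂ (β) (h : β < o), S β h)

/-- The order of a well-founded tree: the least `α` with `D^(α)(T) = ∅`. -/
def treeOrder {B : Type u} (T : Set (List B)) : Ordinal.{u} :=
  sInf {α | iterDerivedTree T α = ∅}

/-- `T` is an `ℓ¹`-`K`-tree in `B`. -/
def IsEllOneTree {B : Type u} [NormedAddCommGroup B] [NormedSpace ℝ B] (K : ℝ)
    (T : Set (List B)) : Prop :=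
  IsSeqTree T ∧ ∀ s ∈ T, (∀ x ∈ s, ‖x‖ = 1) ∧
    ∀ a : Fin s.length → ℝ, K⁻¹ * ∑ i, |a i| ≤ ‖∑ i, a i • s.get i‖

/-- `I(B, K)`: the supremum of the orders of the well-founded `ℓ¹`-`K`-trees in `B`. (If `B` is a
Banach space not containing `ℓ¹`, every `ℓ¹`-`K`-tree in `B` is well-founded.) -/
def bourgainIndexWith (B : Type u) [NormedAddCommGroup B] [NormedSpace ℝ B] (K : ℝ) :
    Ordinal.{u} :=
  ⨆ T : {T : Set (List B) // IsEllOneTree K T ∧ IsWellFoundedTree T}, treeOrder T.1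

/-- Bourgain's `ℓ¹`-index `I(B) = sup_{1 ≤ K < ∞} I(B, K)`. -/
def bourgainIndex (B : Type u) [NormedAddCommGroup B] [NormedSpace ℝ B] : Ordinal.{u} :=
  ⨆ K : {K : ℝ // 1 ≤ K}, bourgainIndexWith B K.1

end Trees

end

/-! ### Quasi-minimality -/

/-- Two spaces are totally incomparable if they have no isomorphic infinite-dimensional closed
subspaces. -/
def TotallyIncomparable (E F : Type*) [NormedAddCommGroup E] [NormedSpace ℝ E]
    [NormedAddCommGroup F] [NormedSpace ℝ F] : Prop :=
  ¬ ∃ (U : Submodule ℝ E) (V : Submodule ℝ F),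
    IsClosed (U : Set E) ∧ IsClosed (V : Set F) ∧
    ¬ FiniteDimensional ℝ U ∧ ¬ FiniteDimensional ℝ V ∧ Nonempty (U ≃L[ℝ] V)

/-- A Banach space is quasi-minimal if it does not contain a pair of totally incomparable
infinite-dimensional closed subspaces. -/
def IsQuasiMinimal (X : Type*) [NormedAddCommGroup X] [NormedSpace ℝ X] : Prop :=
  ¬ ∃ Y Z : Submodule ℝ X,
    IsClosed (Y : Set X) ∧ IsClosed (Z : Set X) ∧
    ¬ FiniteDimensional ℝ Y ∧ ¬ FiniteDimensional ℝ Z ∧ TotallyIncomparable Y Z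

/-! Quasi-minimality is obtained by finding, in any two infinite-dimensional closed subspaces,
sequences equivalent to one and the same sequence of unit vectors $(e_{l_k})$. Take blocks $v_k$ in
the unit ball, with norms bounded below and supports in $[l_k, l_{k+1}/2)$. They dominate
$(e_{l_k})$ automatically, because replacing $e_{l_k}$ by $v_k$ only moves minima to the right
(`mul_tnorm_le_tnorm_sum`).

The reverse estimate (`exists_transfer`, `tnorm_sum_le`) turns a norming functional acting on the
blocks into one acting on the $e_{l_k}$. What has to be controlled is the value at $v_k$ of disjoint
groups of functionals, each group starting before $l_k$ and admissible of order at most some $N_k$.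
Higher orders are pruned away, since $\theta_n \to 0$. The control is available when $v_k$ is an
average of unit-ball vectors such that every Schreier set of order at most $N_k$ meets only members
of tiny total weight (`exists_splits_le`). A member whose hull contains no minimum of a group is
acted on only by functionals of that group that start before the member. Over all such groups these
functionals are disjoint and few, so the one modified index $p$ bounds their sum by $1/\theta_p$;
this is the role of the hypothesis that some index is modified.

Such averages, with norm bounded below, are read off an $\ell^1$-tree of rank $\omega^\omega$. Rank
$\omega$ buys a combination far out, and each further factor $\omega$ raises the order of the
Schreier sets by one (`hasAverages_schreier`). The averages depend only on a parameter $M$, and any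
sufficiently fast sequence of parameters works, so the two subspaces can share it
(`exists_equivalent`).

For the index bound, fix $K > 1/\varepsilon$ and, for each $j$, choose $n \ge mj$ with $\theta_n K^m
> 1$. If no supply of far vectors had all its $\mathcal S_j$-admissible sequences $K$-equivalent to
the $\ell^1$ basis, one could $m$ times pass to a normalized combination, each time multiplying the
coefficient mass by at least $K$. The result is a unit vector that is an $\mathcal S_n$-admissible
combination of mass at least $K^m$, whereas its norm is at least $\theta_n K^m > 1$
(`exists_ellOne`). So trees of rank $\omega^j$ exist for all $j$ with one constant, and they are
joined at a common root (`exists_wellFounded_tree`). -/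

/-! ### Combinatorics of the Schreier families -/

/-- `A` is the union of `c` successive members of `G`. -/
def IsSuccUnion (G : Set (Finset ℕ+)) : ℕ → Finset ℕ+ → Prop
  | 0, A => A = ∅
  | c + 1, A => ∃ B A' : Finset ℕ+, B ∈ G ∧ IsSuccUnion G c A' ∧
      (∀ b ∈ B, ∀ a ∈ A', b < a) ∧ A = B ∪ A'

theorem isSuccUnion_of_fin {G : Set (Finset ℕ+)} : ∀ {k : ℕ} (B : Fin k → Finset ℕ+),
    (∀ i, B i ∈ G) → (∀ i j, i < j → ∀ a ∈ B i, ∀ b ∈ B j, a < b) →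
    IsSuccUnion G k (Finset.univ.biUnion B)
  | 0, B, _, _ => by simp [IsSuccUnion]
  | k + 1, B, hG, hlt => by
    refine ⟨B 0, Finset.univ.biUnion fun i : Fin k => B i.succ, hG 0,
      isSuccUnion_of_fin _ (fun i => hG _) (fun i j hij => hlt _ _ (Fin.succ_lt_succ_iff.2 hij)),
      ?_, ?_⟩
    · intro b hb a ha
      obtain ⟨i, -, hi⟩ := Finset.mem_biUnion.1 ha
      exact hlt 0 i.succ (Fin.succ_pos i) b hb a hi
    · ext a
      simp [Fin.exists_fin_succ]

theorem IsSuccUnion.exists_fin {G : Set (Finset ℕ+)} : ∀ {c : ℕ} {A : Finset ℕ+},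
    IsSuccUnion G c A → ∃ k ≤ c, ∃ B : Fin k → Finset ℕ+, (∀ i, (B i).Nonempty) ∧
      (∀ i, B i ∈ G) ∧ (∀ i j, i < j → ∀ a ∈ B i, ∀ b ∈ B j, a < b) ∧
      A = Finset.univ.biUnion B
  | 0, A, h => ⟨0, le_rfl, Fin.elim0, fun i => i.elim0, fun i => i.elim0, fun i => i.elim0, by
      rw [show A = ∅ from h]; simp⟩
  | c + 1, A, ⟨B₀, A', hB₀, hA', hlt, hA⟩ => by
    obtain ⟨k, hk, B, hne, hG, hs, rfl⟩ := hA'.exists_fin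
    rcases B₀.eq_empty_or_nonempty with h0 | h0
    · exact ⟨k, by omega, B, hne, hG, hs, by rw [hA, h0, Finset.empty_union]⟩
    · refine ⟨k + 1, by omega, Fin.cons B₀ B, ?_, ?_, ?_, ?_⟩
      · intro i; refine Fin.cases ?_ (fun i => ?_) i
        · simpa using h0
        · simpa using hne i
      · intro i; refine Fin.cases ?_ (fun i => ?_) i
        · simpa using hB₀
        · simpa using hG i
      · intro i j hij a ha b hb
        induction j using Fin.cases with
        | zero => exact absurd hij (Fin.not_lt_zero _)
        | succ j =>
          rw [Fin.cons_succ] at hb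
          induction i using Fin.cases with
          | zero =>
            rw [Fin.cons_zero] at ha
            exact hlt a ha b (Finset.mem_biUnion.2 ⟨j, Finset.mem_univ _, hb⟩)
          | succ i =>
            rw [Fin.cons_succ] at ha
            exact hs i j (Fin.succ_lt_succ_iff.1 hij) a ha b hb
      · rw [hA]; ext a
        simp [Fin.exists_fin_succ]

/-- Counting possibly empty pieces by a number `c` below all elements replaces the set of minima of
the definition and opens the way to induction on `c`. -/
theorem mem_schreier_succ {n : ℕ} {A : Finset ℕ+} :
    A ∈ schreier (n + 1) ↔ ∃ c, IsSuccUnion (schreier n) c A ∧ ∀ a ∈ A, c ≤ (a : ℕ) := by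
  constructor
  · rintro ⟨k, B, hB, hG, hlt, hF, rfl⟩
    refine ⟨k, isSuccUnion_of_fin B hG hlt, fun a ha => ?_⟩
    obtain ⟨i, -, hi⟩ := Finset.mem_biUnion.1 ha
    have hinj : Function.Injective fun i => (B i).min' (hB i) := by
      refine StrictMono.injective fun i j hij => ?_
      exact hlt i j hij _ ((B i).min'_mem _) _ ((B j).min'_mem _)
    have h1 := hF _ (Finset.mem_image_of_mem _ (Finset.mem_univ i))
    rw [Finset.card_image_of_injective _ hinj, Finset.card_univ, Fintype.card_fin] at h1
    exact h1.trans (PNat.coe_le_coe _ _ |>.2 ((B i).min'_le a hi))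
  · rintro ⟨c, hc, hle⟩
    obtain ⟨k, hk, B, hne, hG, hlt, rfl⟩ := hc.exists_fin
    refine ⟨k, B, hne, hG, hlt, ?_, rfl⟩
    intro a ha
    obtain ⟨i, -, rfl⟩ := Finset.mem_image.1 ha
    refine (Finset.card_image_le.trans (by simp [hk])).trans (hle _ ?_)
    exact Finset.mem_biUnion.2 ⟨i, Finset.mem_univ _, (B i).min'_mem _⟩

theorem empty_mem_schreier : ∀ n, ∅ ∈ schreier n
  | 0 => by simp [schreier]
  | n + 1 => mem_schreier_succ.2 ⟨0, rfl, by simp⟩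

theorem IsSuccUnion.succ {n c : ℕ} {A : Finset ℕ+} (h : IsSuccUnion (schreier n) c A) :
    IsSuccUnion (schreier n) (c + 1) A :=
  ⟨∅, A, empty_mem_schreier n, h, by simp, by simp⟩

theorem IsSuccUnion.mono {n c d : ℕ} {A : Finset ℕ+} (h : IsSuccUnion (schreier n) c A)
    (hcd : c ≤ d) : IsSuccUnion (schreier n) d A := by
  induction hcd with
  | refl => exact h
  | step _ ih => exact ih.succ

theorem isSuccUnion_one {n : ℕ} {A : Finset ℕ+} (h : A ∈ schreier n) :
    IsSuccUnion (schreier n) 1 A :=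
  ⟨A, ∅, h, rfl, by simp, by simp⟩

theorem schreier_subset_succ (n : ℕ) : schreier n ⊆ schreier (n + 1) := fun _ hA =>
  mem_schreier_succ.2 ⟨1, isSuccUnion_one hA, fun a _ => a.pos⟩

theorem schreier_mono : Monotone schreier := monotone_nat_of_le_succ schreier_subset_succ

/-- Heredity and spreading in one statement: pieces of `G` are pulled back along `ψ`, and the
elements of `F` are at least as large, so the bound on the number of pieces survives. -/
theorem schreier_spread : ∀ {n : ℕ} {F G : Finset ℕ+} (ψ : ℕ+ → ℕ+), G ∈ schreier n →
    StrictMonoOn ψ F → (∀ p ∈ F, ψ p ∈ G ∧ ψ p ≤ p) → F ∈ schreier n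
  | 0, F, G, ψ, hG, hψ, h =>
    (Finset.card_le_card_of_injOn ψ (fun p hp => (h p hp).1) hψ.injOn).trans hG
  | n + 1, F, G, ψ, hG, hψ, h => by
    obtain ⟨c, hc, hle⟩ := mem_schreier_succ.1 hG
    refine mem_schreier_succ.2 ⟨c, ?_, fun a ha =>
      (hle _ (h a ha).1).trans (PNat.coe_le_coe _ _ |>.2 (h a ha).2)⟩
    clear hle hG
    induction c generalizing F G with
    | zero =>
      rw [show G = ∅ from hc] at h
      exact Finset.eq_empty_of_forall_notMem fun p hp => by simpa using (h p hp).1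
    | succ c ih =>
      obtain ⟨B, A', hB, hA', hlt, rfl⟩ := hc
      refine ⟨F.filter (ψ · ∈ B), F.filter (ψ · ∈ A'), ?_, ?_, ?_, ?_⟩
      · refine schreier_spread ψ hB (hψ.mono fun p hp => (Finset.mem_filter.1 hp).1) fun p hp => ?_
        rw [Finset.mem_filter] at hp
        exact ⟨hp.2, (h p hp.1).2⟩
      · refine ih _ _ (hψ.mono fun p hp => (Finset.mem_filter.1 hp).1) (fun p hp => ?_) hA'
        rw [Finset.mem_filter] at hp
        exact ⟨hp.2, (h p hp.1).2⟩
      · intro b hb a ha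
        rw [Finset.mem_filter] at hb ha
        exact (hψ.lt_iff_lt hb.1 ha.1).1 (hlt _ hb.2 _ ha.2)
      · ext p
        simp only [Finset.mem_union, Finset.mem_filter, ← and_or_left]
        exact ⟨fun hp => ⟨hp, Finset.mem_union.1 (h p hp).1⟩, fun hp => hp.1⟩

theorem schreier_subset {n : ℕ} {F G : Finset ℕ+} (hG : G ∈ schreier n) (h : F ⊆ G) :
    F ∈ schreier n :=
  schreier_spread id hG strictMonoOn_id fun _ hp => ⟨h hp, le_rfl⟩

theorem IsSuccUnion.subset {n : ℕ} : ∀ {c : ℕ} {F A : Finset ℕ+},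
    IsSuccUnion (schreier n) c A → F ⊆ A → IsSuccUnion (schreier n) c F
  | 0, F, A, h, hF => by
    rw [show A = ∅ from h] at hF
    exact Finset.subset_empty.1 hF
  | c + 1, F, A, ⟨B, A', hB, hA', hlt, hA⟩, hF => by
    refine ⟨F ∩ B, F ∩ A', schreier_subset hB Finset.inter_subset_right,
      hA'.subset Finset.inter_subset_right, fun b hb a ha => ?_, ?_⟩
    · exact hlt b (Finset.mem_inter.1 hb).2 a (Finset.mem_inter.1 ha).2
    · rw [← Finset.inter_union_distrib_left, ← hA, Finset.inter_eq_left.2 hF]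

/-- Monotonicity of `ψ` is not needed: by counting, the $i$-th element of `G` is at most the $i$-th
element of `F`, so the order-preserving matching serves in its place. -/
theorem schreier_of_injOn {n : ℕ} {F G : Finset ℕ+} (ψ : ℕ+ → ℕ+) (hG : G ∈ schreier n)
    (hψ : Set.InjOn ψ F) (h : ∀ p ∈ F, ψ p ∈ G ∧ ψ p ≤ p) : F ∈ schreier n := by
  have hcard : F.card ≤ G.card := Finset.card_le_card_of_injOn ψ (fun p hp => (h p hp).1) hψ
  have key : ∀ i : Fin F.card, G.orderEmbOfFin rfl (Fin.castLE hcard i) ≤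
      F.orderEmbOfFin rfl i := by
    intro i
    by_contra! hlt
    have h1 : ((Finset.Iic i).image fun j => ψ (F.orderEmbOfFin rfl j)) ⊆
        (Finset.Iio (Fin.castLE hcard i)).image (G.orderEmbOfFin rfl) := by
      intro x hx
      obtain ⟨j, hj, rfl⟩ := Finset.mem_image.1 hx
      have hjF := F.orderEmbOfFin_mem rfl j
      have hm := h _ hjF
      have hr : ψ (F.orderEmbOfFin rfl j) ∈ Set.range (G.orderEmbOfFin rfl) := by
        rw [Finset.range_orderEmbOfFin]; exact hm.1
      obtain ⟨m, hm'⟩ := hr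
      refine Finset.mem_image.2 ⟨m, Finset.mem_Iio.2 ?_, hm'⟩
      rw [← (G.orderEmbOfFin rfl).lt_iff_lt, hm']
      exact (hm.2.trans ((F.orderEmbOfFin rfl).le_iff_le.2 (Finset.mem_Iic.1 hj))).trans_lt hlt
    have h2 := Finset.card_le_card h1
    rw [Finset.card_image_of_injective _ (G.orderEmbOfFin rfl).injective,
      Finset.card_image_of_injOn, Fin.card_Iic, Fin.card_Iio, Fin.val_castLE] at h2
    · omega
    · intro a _ b _ hab
      exact (F.orderEmbOfFin rfl).injective
        (hψ (F.orderEmbOfFin_mem rfl a) (F.orderEmbOfFin_mem rfl b) hab)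
  classical
  let φ : ℕ+ → ℕ+ := fun p => if hp : p ∈ F then
    G.orderEmbOfFin rfl (Fin.castLE hcard ((F.orderIsoOfFin rfl).symm ⟨p, hp⟩)) else 1
  have hφ : ∀ (p) (hp : p ∈ F), φ p =
    G.orderEmbOfFin rfl (Fin.castLE hcard ((F.orderIsoOfFin rfl).symm ⟨p, hp⟩)) :=
    fun p hp => dif_pos hp
  refine schreier_spread φ hG (fun p hp q hq hpq => ?_) fun p hp => ?_
  · rw [hφ p hp, hφ q hq]
    refine (G.orderEmbOfFin rfl).strictMono ?_
    exact (Fin.castLE_lt_castLE_iff hcard).2 ((F.orderIsoOfFin rfl).symm.strictMono hpq)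
  · rw [hφ p hp]
    refine ⟨G.orderEmbOfFin_mem rfl _, (key _).trans_eq ?_⟩
    rw [← Finset.coe_orderIsoOfFin_apply, OrderIso.apply_symm_apply]

/-- Admissibility of a family indexed by an arbitrary type, by comparison of the minima. -/
theorem schreier_image_of_injOn {ι : Type*} {n : ℕ} {s : Finset ι} {G : Finset ℕ+}
    (q ψ : ι → ℕ+) (hG : G ∈ schreier n) (hψ : Set.InjOn ψ s)
    (h : ∀ i ∈ s, ψ i ∈ G ∧ ψ i ≤ q i) : s.image q ∈ schreier n := by
  classical
  rcases s.eq_empty_or_nonempty with rfl | ⟨i₀, -⟩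
  · simpa using empty_mem_schreier n
  have : Nonempty ι := ⟨i₀⟩
  have hsel : ∀ p ∈ s.image q, ∃ i ∈ s, q i = p := fun p hp => Finset.mem_image.1 hp
  choose! e he heq using hsel
  refine schreier_of_injOn (fun p => ψ (e p)) hG (fun p hp p' hp' hpp => ?_) fun p hp => ?_
  · rw [← heq p hp, ← heq p' hp', hψ (he p hp) (he p' hp') hpp]
  · refine ⟨(h _ (he p hp)).1, ?_⟩
    conv_rhs => rw [← heq p hp]
    exact (h _ (he p hp)).2

/-- `2 F ∪ (2 F + 1)`. -/
def doubling (F : Finset ℕ+) : Finset ℕ+ := F.image (2 * ·) ∪ F.image (2 * · + 1)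

theorem doubling_union (A B : Finset ℕ+) : doubling (A ∪ B) = doubling A ∪ doubling B := by
  simp only [doubling, Finset.image_union]
  ext; simp only [Finset.mem_union]; tauto

theorem mem_doubling {F : Finset ℕ+} {p : ℕ+} :
    p ∈ doubling F ↔ ∃ q ∈ F, p = 2 * q ∨ p = 2 * q + 1 := by
  simp only [doubling, Finset.mem_union, Finset.mem_image]
  constructor
  · rintro (⟨q, hq, rfl⟩ | ⟨q, hq, rfl⟩)
    exacts [⟨q, hq, Or.inl rfl⟩, ⟨q, hq, Or.inr rfl⟩]
  · rintro ⟨q, hq, rfl | rfl⟩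
    exacts [Or.inl ⟨q, hq, rfl⟩, Or.inr ⟨q, hq, rfl⟩]

theorem doubling_lt {A B : Finset ℕ+} (h : ∀ a ∈ A, ∀ b ∈ B, a < b) :
    ∀ a ∈ doubling A, ∀ b ∈ doubling B, a < b := by
  intro a ha b hb
  obtain ⟨p, hp, ha⟩ := mem_doubling.1 ha
  obtain ⟨q, hq, hb⟩ := mem_doubling.1 hb
  have h1 : (p : ℕ) < q := h p hp q hq
  have h2 : (a : ℕ) ≤ 2 * p + 1 := by rcases ha with rfl | rfl <;> simp
  have h3 : 2 * (q : ℕ) ≤ b := by rcases hb with rfl | rfl <;> simp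
  rw [← PNat.coe_lt_coe]; omega

theorem doubling_isSuccUnion_aux {n : ℕ}
    (H : ∀ F ∈ schreier n, IsSuccUnion (schreier n) 2 (doubling F)) :
    ∀ {c : ℕ} {F : Finset ℕ+}, IsSuccUnion (schreier n) c F →
      IsSuccUnion (schreier n) (2 * c) (doubling F)
  | 0, F, h => by
    rw [show F = ∅ from h]; rfl
  | c + 1, F, ⟨B, A', hB, hA', hlt, hA⟩ => by
    obtain ⟨B₁, B', hB₁, ⟨B₂, B₃, hB₂, hB₃, -, rfl⟩, hlt₁, hB12⟩ := H B hB
    obtain rfl : B₃ = ∅ := hB₃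
    rw [Finset.union_empty] at hlt₁ hB12
    have hd := doubling_lt hlt
    rw [hB12] at hd
    refine ⟨B₁, B₂ ∪ doubling A', hB₁, ⟨B₂, doubling A', hB₂,
      doubling_isSuccUnion_aux H hA', ?_, rfl⟩, ?_, ?_⟩
    · exact fun b hb a ha => hd b (Finset.mem_union_right _ hb) a ha
    · intro b hb a ha
      rcases Finset.mem_union.1 ha with ha | ha
      · exact hlt₁ b hb a ha
      · exact hd b (Finset.mem_union_left _ hb) a ha
    · rw [hA, doubling_union, hB12, Finset.union_assoc]

/-- The number of pieces doubles, but so does the lower bound for the elements. The hypothesis `H`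
at order `n` is isolated so that it can be supplied recursively. -/
theorem doubling_mem_of_isSuccUnion {n : ℕ}
    (H : ∀ F ∈ schreier n, IsSuccUnion (schreier n) 2 (doubling F)) {F : Finset ℕ+}
    (hF : F ∈ schreier (n + 1)) : doubling F ∈ schreier (n + 1) := by
  obtain ⟨c, hc, hle⟩ := mem_schreier_succ.1 hF
  refine mem_schreier_succ.2 ⟨2 * c, doubling_isSuccUnion_aux H hc, fun a ha => ?_⟩
  obtain ⟨q, hq, ha⟩ := mem_doubling.1 ha
  have := hle q hq
  rcases ha with rfl | rfl <;> simp <;> omega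

/-- Two pieces are really needed only at order zero, where a singleton becomes a pair. -/
theorem doubling_isSuccUnion : ∀ {n : ℕ}, ∀ F ∈ schreier n,
    IsSuccUnion (schreier n) 2 (doubling F)
  | 0, F, hF => by
    refine ⟨F.image (2 * ·), F.image (2 * · + 1), Finset.card_image_le.trans hF,
      isSuccUnion_one (Finset.card_image_le.trans hF), ?_, rfl⟩
    intro b hb a ha
    obtain ⟨p, hp, rfl⟩ := Finset.mem_image.1 hb
    obtain ⟨q, hq, rfl⟩ := Finset.mem_image.1 ha
    rw [Finset.card_le_one.1 hF p hp q hq]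
    exact PNat.lt_add_right _ _
  | n + 1, _, hF => (isSuccUnion_one (doubling_mem_of_isSuccUnion doubling_isSuccUnion hF)).succ

theorem doubling_mem_schreier {n : ℕ} (hn : 1 ≤ n) {F : Finset ℕ+} (hF : F ∈ schreier n) :
    doubling F ∈ schreier n := by
  obtain ⟨n, rfl⟩ := Nat.exists_eq_add_of_le' hn
  exact doubling_mem_of_isSuccUnion doubling_isSuccUnion hF

theorem schreierOne_subset {n : ℕ} (hn : 1 ≤ n) : schreierOne ⊆ schreier n :=
  schreier_one ▸ schreier_mono hn

/-- The convolution property $\mathcal S_j[\mathcal S_n] \subseteq \mathcal S_{n+j}$, by induction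
on `j`: a decomposition of the index set `H` induces one of the union. -/
theorem biUnion_mem_schreier {n : ℕ} (Φ : ℕ+ → Finset ℕ+) : ∀ {j : ℕ} {H : Finset ℕ+},
    H ∈ schreier j → (∀ p ∈ H, Φ p ∈ schreier n) → (∀ p ∈ H, ∀ a ∈ Φ p, p ≤ a) →
    (∀ p ∈ H, ∀ q ∈ H, p < q → ∀ a ∈ Φ p, ∀ b ∈ Φ q, a < b) → H.biUnion Φ ∈ schreier (n + j)
  | 0, H, hH, h1, _, _ => by
    rcases Finset.card_le_one_iff_subset_singleton.1 hH with ⟨p, hp⟩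
    rcases Finset.subset_singleton_iff.1 hp with rfl | rfl
    · simpa using empty_mem_schreier n
    · simpa using h1 p (by simp)
  | j + 1, H, hH, h1, h2, h3 => by
    obtain ⟨c, hc, hle⟩ := mem_schreier_succ.1 hH
    refine mem_schreier_succ.2 ⟨c, ?_, fun a ha => ?_⟩
    · clear hle hH
      induction c generalizing H with
      | zero => rw [show H = ∅ from hc]; rfl
      | succ c ih =>
        obtain ⟨B, A', hB, hA', hlt, rfl⟩ := hc
        have hl : ∀ p ∈ B, p ∈ B ∪ A' := fun p => Finset.mem_union_left _
        have hr : ∀ p ∈ A', p ∈ B ∪ A' := fun p => Finset.mem_union_right _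
        refine ⟨B.biUnion Φ, A'.biUnion Φ, ?_, ?_, ?_, ?_⟩
        · exact biUnion_mem_schreier Φ hB (fun p hp => h1 p (hl p hp))
            (fun p hp => h2 p (hl p hp)) fun p hp q hq => h3 p (hl p hp) q (hl q hq)
        · exact ih _ (fun p hp => h1 p (hr p hp))
            (fun p hp => h2 p (hr p hp)) (fun p hp q hq => h3 p (hr p hp) q (hr q hq)) hA'
        · intro b hb a ha
          obtain ⟨p, hp, hb⟩ := Finset.mem_biUnion.1 hb
          obtain ⟨q, hq, ha⟩ := Finset.mem_biUnion.1 ha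
          exact h3 p (hl p hp) q (hr q hq) (hlt p hp q hq) b hb a ha
        · ext a; simp [or_and_right, exists_or]
    · obtain ⟨p, hp, ha⟩ := Finset.mem_biUnion.1 ha
      exact (hle p hp).trans (h2 p hp a ha)

/-- A segment outside $\mathcal S_n$ does not fit into the first piece, so everything after it falls
to the remaining `c` pieces; the induction is applied to the tail. -/
theorem exists_not_isSuccUnion {n : ℕ}
    (H : ∀ p : ℕ → ℕ+, StrictMono p → ∃ m, (Finset.range m).image p ∉ schreier n) :
    ∀ (c : ℕ) (p : ℕ → ℕ+), StrictMono p →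
      ∃ m, ¬ IsSuccUnion (schreier n) c ((Finset.range m).image p)
  | 0, p, _ => ⟨1, by simp [IsSuccUnion]⟩
  | c + 1, p, hp => by
    obtain ⟨m₁, hm₁⟩ := H p hp
    obtain ⟨m₂, hm₂⟩ := exists_not_isSuccUnion H c (fun i => p (m₁ + i))
      fun i j hij => hp (by omega)
    refine ⟨m₁ + m₂, ?_⟩
    rintro ⟨B, A', hB, hA', hlt, hA⟩
    have hmem : ∀ i < m₁ + m₂, p i ∈ B ∪ A' := fun i hi =>
      hA ▸ Finset.mem_image_of_mem p (Finset.mem_range.2 hi)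
    obtain ⟨i, hi, hiA⟩ : ∃ i < m₁, p i ∉ B := by
      by_contra! hcon
      refine hm₁ (schreier_subset hB fun x hx => ?_)
      obtain ⟨i, hi, rfl⟩ := Finset.mem_image.1 hx
      exact hcon i (Finset.mem_range.1 hi)
    have hiA' : p i ∈ A' := (Finset.mem_union.1 (hmem i (by omega))).resolve_left hiA
    refine hm₂ (hA'.subset fun x hx => ?_)
    obtain ⟨j, hj, rfl⟩ := Finset.mem_image.1 hx
    rw [Finset.mem_range] at hj
    refine (Finset.mem_union.1 (hmem (m₁ + j) (by omega))).resolve_left fun hb => ?_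
    exact absurd (hlt _ hb _ hiA') (not_lt.2 (hp.monotone (by omega)))

/-- No infinite set has all its finite initial segments in a Schreier family. -/
theorem exists_notMem_schreier : ∀ (n : ℕ) (p : ℕ → ℕ+), StrictMono p →
    ∃ m, (Finset.range m).image p ∉ schreier n
  | 0, p, hp => ⟨2, by
      simp only [schreier, Set.mem_ofPred_eq, not_le]
      rw [Finset.card_image_of_injective _ hp.injective]; simp⟩
  | n + 1, p, hp => by
    -- A member of $\mathcal S_{n+1}$ containing `p 0` has at most `p 0` pieces, whatever its
    -- length.
    obtain ⟨m, hm⟩ := exists_not_isSuccUnion (exists_notMem_schreier n) (p 0) p hp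
    refine ⟨m, fun h => ?_⟩
    obtain ⟨c, hc, hle⟩ := mem_schreier_succ.1 h
    rcases Nat.eq_zero_or_pos m with rfl | hpos
    · exact hm (IsSuccUnion.mono (c := 0) (by simp [IsSuccUnion]) (Nat.zero_le _))
    · exact hm (hc.mono (hle _ (Finset.mem_image_of_mem p (Finset.mem_range.2 hpos))))

/-! ### Norming functionals -/

/-- The minimum of a finite set, with value `1` for the empty set. -/
def minElt (A : Finset ℕ+) : ℕ+ := if h : A.Nonempty then A.min' h else 1

theorem minElt_eq {A : Finset ℕ+} (h : A.Nonempty) : minElt A = A.min' h := dif_pos h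

theorem minElt_mem {A : Finset ℕ+} (h : A.Nonempty) : minElt A ∈ A :=
  minElt_eq h ▸ A.min'_mem h

theorem minElt_le {A : Finset ℕ+} {a : ℕ+} (h : a ∈ A) : minElt A ≤ a :=
  minElt_eq ⟨a, h⟩ ▸ A.min'_le a h

theorem minElt_anti {A B : Finset ℕ+} (h : A ⊆ B) (hA : A.Nonempty) : minElt B ≤ minElt A :=
  minElt_le (h (minElt_mem hA))

/-- Two sets are separated in the sense of the given kind, regardless of their order. -/
def AdaptType.Sep : AdaptType → Finset ℕ+ → Finset ℕ+ → Prop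
  | .U, A, B => (∀ a ∈ A, ∀ b ∈ B, a < b) ∨ (∀ a ∈ A, ∀ b ∈ B, b < a)
  | .M, A, B => Disjoint A B

theorem AdaptType.Sep.mono {s : AdaptType} {A B A' B' : Finset ℕ+} (h : s.Sep A B)
    (hA : A' ⊆ A) (hB : B' ⊆ B) : s.Sep A' B' := by
  cases s with
  | U =>
    exact h.imp (fun h a ha b hb => h a (hA ha) b (hB hb))
      (fun h a ha b hb => h a (hA ha) b (hB hb))
  | M => exact Finset.disjoint_of_subset_left hA (Finset.disjoint_of_subset_right hB h)

theorem AdaptType.Sep.disjoint {s : AdaptType} {A B : Finset ℕ+} (h : s.Sep A B) :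
    Disjoint A B := by
  cases s with
  | U =>
    rw [Finset.disjoint_left]
    rcases h with h | h
    · exact fun a ha hb => lt_irrefl _ (h a ha a hb)
    · exact fun a ha hb => lt_irrefl _ (h a ha a hb)
  | M => exact h

theorem AdaptType.sep_of_lt (s : AdaptType) {A B : Finset ℕ+}
    (h : ∀ a ∈ A, ∀ b ∈ B, a < b) : s.Sep A B := by
  cases s with
  | U => exact Or.inl h
  | M => exact AdaptType.Sep.disjoint (s := .U) (Or.inl h)

theorem AdaptType.sep_of_gt (s : AdaptType) {A B : Finset ℕ+}
    (h : ∀ a ∈ A, ∀ b ∈ B, b < a) : s.Sep A B := by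
  cases s with
  | U => exact Or.inr h
  | M => exact AdaptType.Sep.disjoint (s := .U) (Or.inr h)

theorem AdaptedFamily.sep {n : ℕ} {s : AdaptType} (F : AdaptedFamily n s) {i j : Fin F.k}
    (hij : i ≠ j) : s.Sep (F.E i) (F.E j) := by
  have hS := F.separated
  cases s with
  | M => exact hS i j hij
  | U =>
    rcases lt_or_gt_of_ne hij with h | h
    · exact Or.inl (hS i j h)
    · exact Or.inr fun a ha b hb => hS j i h b hb a ha

noncomputable section

/-- The pairing `f ↦ ∑ f i |x i|`. -/
def absPairing (x : ℕ+ →₀ ℝ) : (ℕ+ →₀ ℝ) →ₗ[ℝ] ℝ :=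
  Finsupp.linearCombination ℝ fun i => |x i|

theorem absPairing_eq_sum (x f : ℕ+ →₀ ℝ) {s : Finset ℕ+} (hs : f.support ⊆ s) :
    absPairing x f = ∑ i ∈ s, f i * |x i| := by
  rw [absPairing, Finsupp.linearCombination_apply, Finsupp.sum_of_support_subset _ hs _ (by simp)]
  simp

theorem absPairing_single (x : ℕ+ →₀ ℝ) (p : ℕ+) :
    absPairing x (Finsupp.single p 1) = |x p| := by
  simp [absPairing]

theorem absPairing_nonneg (x : ℕ+ →₀ ℝ) {f : ℕ+ →₀ ℝ} (hf : ∀ p, 0 ≤ f p) :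
    0 ≤ absPairing x f := by
  rw [absPairing_eq_sum x f subset_rfl]
  exact Finset.sum_nonneg fun i _ => mul_nonneg (hf i) (abs_nonneg _)

theorem absPairing_mono {x y f : ℕ+ →₀ ℝ} (hf : ∀ p, 0 ≤ f p)
    (h : ∀ p ∈ f.support, |x p| ≤ |y p|) : absPairing x f ≤ absPairing y f := by
  rw [absPairing_eq_sum x f subset_rfl, absPairing_eq_sum y f subset_rfl]
  exact Finset.sum_le_sum fun i hi => mul_le_mul_of_nonneg_left (h i hi) (hf i)

theorem absPairing_congr {x y f : ℕ+ →₀ ℝ} (h : ∀ p ∈ f.support, |x p| = |y p|) :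
    absPairing x f = absPairing y f := by
  rw [absPairing_eq_sum x f subset_rfl, absPairing_eq_sum y f subset_rfl]
  exact Finset.sum_congr rfl fun i hi => by rw [h i hi]

theorem absPairing_eq_zero {x f : ℕ+ →₀ ℝ} (h : Disjoint f.support x.support) :
    absPairing x f = 0 := by
  rw [absPairing_eq_sum x f subset_rfl]
  refine Finset.sum_eq_zero fun i hi => ?_
  have := Finset.disjoint_left.1 h hi
  rw [Finsupp.notMem_support_iff] at this
  simp [this]

theorem absPairing_add_le (x y : ℕ+ →₀ ℝ) {f : ℕ+ →₀ ℝ} (hf : ∀ p, 0 ≤ f p) :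
    absPairing (x + y) f ≤ absPairing x f + absPairing y f := by
  simp only [absPairing_eq_sum _ f subset_rfl, ← Finset.sum_add_distrib, ← mul_add]
  exact Finset.sum_le_sum fun i _ => mul_le_mul_of_nonneg_left (abs_add_le _ _) (hf i)

theorem absPairing_smul (c : ℝ) (x f : ℕ+ →₀ ℝ) :
    absPairing (c • x) f = |c| * absPairing x f := by
  simp only [absPairing_eq_sum _ f subset_rfl, Finset.mul_sum, Finsupp.smul_apply, smul_eq_mul,
    abs_mul]
  exact Finset.sum_congr rfl fun i _ => by ring

theorem absPairing_zero (f : ℕ+ →₀ ℝ) : absPairing 0 f = 0 := by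
  simp [absPairing_eq_sum _ f subset_rfl]

theorem absPairing_sum_le {ι : Type*} (s : Finset ι) (x : ι → ℕ+ →₀ ℝ) {f : ℕ+ →₀ ℝ}
    (hf : ∀ p, 0 ≤ f p) : absPairing (∑ i ∈ s, x i) f ≤ ∑ i ∈ s, absPairing (x i) f := by
  classical
  induction s using Finset.induction_on with
  | empty => simp [absPairing_zero]
  | insert i s hi ih =>
    rw [Finset.sum_insert hi, Finset.sum_insert hi]
    exact (absPairing_add_le _ _ hf).trans (by gcongr)

theorem restrictTo_apply_of_mem {E : Finset ℕ+} (x : ℕ+ →₀ ℝ) {p : ℕ+} (h : p ∈ E) :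
    restrictTo E x p = x p := Finsupp.filter_apply_pos (fun j => j ∈ E) x h

theorem restrictTo_apply_of_notMem {E : Finset ℕ+} (x : ℕ+ →₀ ℝ) {p : ℕ+} (h : p ∉ E) :
    restrictTo E x p = 0 := Finsupp.filter_apply_neg (fun j => j ∈ E) x h

theorem support_restrictTo (E : Finset ℕ+) (x : ℕ+ →₀ ℝ) :
    (restrictTo E x).support = x.support.filter (· ∈ E) := Finsupp.support_filter _ _

theorem absPairing_restrictTo {E : Finset ℕ+} (x : ℕ+ →₀ ℝ) {f : ℕ+ →₀ ℝ} (h : f.support ⊆ E) :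
    absPairing (restrictTo E x) f = absPairing x f :=
  absPairing_congr fun p hp => by rw [restrictTo_apply_of_mem x (h hp)]

namespace TsirelsonData

variable (D : TsirelsonData)

/-- The (positive) norming functionals of the space all of whose nodes `θ_n ∑ g_i` satisfy the
constraint `ok n (min supp g_i)`. -/
inductive IsNorming (ok : ℕ+ → ℕ+ → Prop) : (ℕ+ →₀ ℝ) → Prop
  | single (p : ℕ+) : IsNorming ok (Finsupp.single p 1)
  | node {ι : Type} [Fintype ι] [Nonempty ι] (n : ℕ+) (g : ι → ℕ+ →₀ ℝ)
      (hg : ∀ i, IsNorming ok (g i)) (hok : ∀ i, ok n (minElt (g i).support))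
      (hsep : Pairwise fun i j => (D.σ n).Sep (g i).support (g j).support)
      (hmin : (Finset.univ.image fun i => minElt (g i).support) ∈ schreier n) :
      IsNorming ok (D.θ n • ∑ i, g i)

variable {D} {ok : ℕ+ → ℕ+ → Prop}

theorem IsNorming.nonneg {f : ℕ+ →₀ ℝ} (hf : D.IsNorming ok f) (p : ℕ+) : 0 ≤ f p := by
  induction hf with
  | single q => rw [Finsupp.single_apply]; split_ifs <;> norm_num
  | node n g hg hok hsep hmin ih =>
    rw [Finsupp.smul_apply, Finsupp.finsetSum_apply]
    exact mul_nonneg (D.θ_pos n).le (Finset.sum_nonneg fun i _ => ih i)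

theorem node_apply {ι : Type} [Fintype ι] {n : ℕ+} {g : ι → ℕ+ →₀ ℝ}
    (hsep : Pairwise fun i j => (D.σ n).Sep (g i).support (g j).support) {i : ι} {p : ℕ+}
    (hp : p ∈ (g i).support) : (D.θ n • ∑ i, g i) p = D.θ n * g i p := by
  rw [Finsupp.smul_apply, Finsupp.finsetSum_apply, smul_eq_mul, Finset.sum_eq_single i]
  · intro j _ hj
    exact Finsupp.notMem_support_iff.1 (Finset.disjoint_left.1 (hsep hj.symm).disjoint hp)
  · simp

theorem mem_support_node {ι : Type} [Fintype ι] {n : ℕ+} {g : ι → ℕ+ →₀ ℝ}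
    (hsep : Pairwise fun i j => (D.σ n).Sep (g i).support (g j).support) {p : ℕ+} :
    p ∈ (D.θ n • ∑ i, g i).support ↔ ∃ i, p ∈ (g i).support := by
  constructor
  · intro hp
    by_contra! hcon
    refine Finsupp.mem_support_iff.1 hp ?_
    rw [Finsupp.smul_apply, Finsupp.finsetSum_apply, Finset.sum_eq_zero, smul_zero]
    exact fun i _ => Finsupp.notMem_support_iff.1 (hcon i)
  · rintro ⟨i, hi⟩
    rw [Finsupp.mem_support_iff, node_apply hsep hi]
    exact mul_ne_zero (D.θ_pos n).ne' (Finsupp.mem_support_iff.1 hi)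

theorem IsNorming.support_nonempty {f : ℕ+ →₀ ℝ} (hf : D.IsNorming ok f) :
    f.support.Nonempty := by
  induction hf with
  | single q => exact ⟨q, by simp⟩
  | @node ι _ _ n g hg hok hsep hmin ih =>
    obtain ⟨i⟩ := ‹Nonempty ι›
    obtain ⟨p, hp⟩ := ih i
    exact ⟨p, (mem_support_node hsep).2 ⟨i, hp⟩⟩

theorem IsNorming.le_one {f : ℕ+ →₀ ℝ} (hf : D.IsNorming ok f) (p : ℕ+) : f p ≤ 1 := by
  induction hf with
  | single q => rw [Finsupp.single_apply]; split_ifs <;> norm_num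
  | node n g hg hok hsep hmin ih =>
    by_cases hp : p ∈ (D.θ n • ∑ i, g i).support
    · obtain ⟨i, hi⟩ := (mem_support_node hsep).1 hp
      rw [node_apply hsep hi]
      exact mul_le_one₀ (D.θ_lt_one n).le ((hg i).nonneg p) (ih i)
    · rw [Finsupp.notMem_support_iff.1 hp]; norm_num

theorem IsNorming.node_le {ι : Type} [Fintype ι] {n : ℕ+} {g : ι → ℕ+ →₀ ℝ}
    (hg : ∀ i, D.IsNorming ok (g i))
    (hsep : Pairwise fun i j => (D.σ n).Sep (g i).support (g j).support) (p : ℕ+) :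
    (D.θ n • ∑ i, g i) p ≤ D.θ n := by
  by_cases hp : p ∈ (D.θ n • ∑ i, g i).support
  · obtain ⟨i, hi⟩ := (mem_support_node hsep).1 hp
    rw [node_apply hsep hi]
    exact mul_le_of_le_one_right (D.θ_pos n).le ((hg i).le_one p)
  · rw [Finsupp.notMem_support_iff.1 hp]; exact (D.θ_pos n).le

theorem IsNorming.weaken {ok' : ℕ+ → ℕ+ → Prop} (h : ∀ n p, ok n p → ok' n p) {f : ℕ+ →₀ ℝ}
    (hf : D.IsNorming ok f) : D.IsNorming ok' f := by
  induction hf with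
  | single q => exact .single q
  | node n g hg hok hsep hmin ih => exact .node n g ih (fun i => h _ _ (hok i)) hsep hmin

/-- Construction of a node from a family some of whose members may vanish; admissibility is
checked by comparison with an admissible set. -/
theorem IsNorming.node_of_injOn {ι : Type} [Fintype ι] (n : ℕ+) (g : ι → ℕ+ →₀ ℝ)
    (hg : ∀ i, g i = 0 ∨ D.IsNorming ok (g i)) (hok : ∀ i, g i ≠ 0 → ok n (minElt (g i).support))
    (hsep : ∀ i j, i ≠ j → (D.σ n).Sep (g i).support (g j).support) {F : Finset ℕ+}
    (hF : F ∈ schreier n) (ψ : ι → ℕ+) (hψ : ∀ i j, g i ≠ 0 → g j ≠ 0 → ψ i = ψ j → i = j)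
    (hmin : ∀ i, g i ≠ 0 → ψ i ∈ F ∧ ψ i ≤ minElt (g i).support) :
    D.θ n • ∑ i, g i = 0 ∨ D.IsNorming ok (D.θ n • ∑ i, g i) := by
  classical
  have hsum : ∑ i, g i = ∑ i : {i // g i ≠ 0}, g i := by
    rw [← Finset.sum_filter_ne_zero, ← Finset.sum_subtype_eq_sum_filter]
    simp
  rcases isEmpty_or_nonempty {i // g i ≠ 0} with he | hne
  · left
    rw [hsum]; simp
  · right
    rw [hsum]
    refine .node n (fun i : {i // g i ≠ 0} => g i) (fun i => (hg i).resolve_left i.2)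
      (fun i => hok i i.2) (fun i j hij => hsep i j fun h => hij (Subtype.ext h)) ?_
    refine schreier_image_of_injOn _ (fun i : {i // g i ≠ 0} => ψ i) hF
      (fun i _ j _ hij => Subtype.ext (hψ i j i.2 j.2 hij)) fun i _ => hmin i i.2

/-- Restrictions of norming functionals are norming. -/
theorem IsNorming.filter (hmono : ∀ n p q, p ≤ q → ok n p → ok n q) {f : ℕ+ →₀ ℝ}
    (hf : D.IsNorming ok f) (P : ℕ+ → Prop) [DecidablePred P] :
    f.filter P = 0 ∨ D.IsNorming ok (f.filter P) := by
  induction hf with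
  | single q =>
    by_cases hq : P q
    · right; rw [Finsupp.filter_single_of_pos _ hq]; exact .single q
    · left; rw [Finsupp.filter_single_of_neg _ hq]
  | @node ι _ _ n g hg hok hsep hmin ih =>
    have hsum : (D.θ n • ∑ i, g i).filter P = D.θ n • ∑ i, (g i).filter P := by
      rw [Finsupp.filter_smul, Finsupp.filter_sum]
    have hsub : ∀ i, ((g i).filter P).support ⊆ (g i).support := fun i => by
      rw [Finsupp.support_filter]; exact Finset.filter_subset _ _
    have hle : ∀ i, (g i).filter P ≠ 0 →
        minElt (g i).support ≤ minElt ((g i).filter P).support := fun i hi =>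
      minElt_anti (hsub i) (Finsupp.support_nonempty_iff.2 hi)
    rw [hsum]
    refine IsNorming.node_of_injOn n _ ih (fun i hi => hmono n _ _ (hle i hi) (hok i))
      (fun i j hij => (hsep hij).mono (hsub i) (hsub j)) hmin (fun i => minElt (g i).support)
      (fun i j _ _ hij => ?_) (fun i hi => ⟨Finset.mem_image_of_mem _ (Finset.mem_univ i), hle i hi⟩)
    by_contra hne
    refine Finset.disjoint_left.1 (hsep hne).disjoint (minElt_mem (hg i).support_nonempty) ?_
    rw [hij]; exact minElt_mem (hg j).support_nonempty

theorem minElt_injective {ι : Type*} {s : AdaptType} {E : ι → Finset ℕ+}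
    (hne : ∀ i, (E i).Nonempty) (hsep : Pairwise fun i j => s.Sep (E i) (E j)) :
    Function.Injective fun i => minElt (E i) := by
  intro i j hij
  by_contra h
  refine Finset.disjoint_left.1 (hsep h).disjoint (minElt_mem (hne i)) ?_
  rw [show minElt (E i) = minElt (E j) from hij]
  exact minElt_mem (hne j)

/-- A form of the implicit inequality for families indexed by arbitrary finite types. -/
theorem theta_mul_sum_le_tnorm {ι : Type*} [Fintype ι] (n : ℕ+) (E : ι → Finset ℕ+)
    (hne : ∀ i, (E i).Nonempty) (hsep : Pairwise fun i j => (D.σ n).Sep (E i) (E j))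
    (hmin : (Finset.univ.image fun i => minElt (E i)) ∈ schreier n) (x : ℕ+ →₀ ℝ) :
    D.θ n * ∑ i, D.tnorm (restrictTo (E i) x) ≤ D.tnorm x := by
  classical
  have hinj := minElt_injective hne hsep
  obtain ⟨k, hk⟩ : ∃ k, (Finset.univ.image fun i => minElt (E i)).card = k := ⟨_, rfl⟩
  let e₁ := (Finset.univ.image fun i => minElt (E i)).orderIsoOfFin hk
  let e₂ : ι ≃ (Finset.univ.image fun i => minElt (E i)) :=
    Equiv.ofBijective (fun i => ⟨minElt (E i), Finset.mem_image_of_mem _ (Finset.mem_univ i)⟩)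
      ⟨fun i j hij => hinj (congrArg Subtype.val hij), fun y => by
        obtain ⟨i, -, hi⟩ := Finset.mem_image.1 y.2
        exact ⟨i, Subtype.ext hi⟩⟩
  let e : Fin k ≃ ι := e₁.toEquiv.trans e₂.symm
  have he : ∀ i, minElt (E (e i)) = e₁ i := fun i =>
    congrArg Subtype.val (e₂.apply_symm_apply (e₁ i))
  let F : AdaptedFamily n (D.σ n) :=
    { k := k
      E := fun i => E (e i)
      nonempty := fun i => hne _
      mins_mem := by
        convert hmin using 1
        ext a
        simp only [Finset.mem_image, Finset.mem_univ, true_and, ← minElt_eq (hne _)]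
        exact e.exists_congr_left.trans (by simp)
      separated := by
        have hs : ∀ i j, i ≠ j → (D.σ n).Sep (E (e i)) (E (e j)) := fun i j hij =>
          hsep fun h => hij (e.injective h)
        generalize D.σ n = s at hs
        cases s with
        | M => exact hs
        | U =>
          intro i j hij
          refine (hs i j hij.ne).resolve_right fun h => ?_
          have h1 := h _ (minElt_mem (hne (e i))) _ (minElt_mem (hne (e j)))
          rw [he, he] at h1
          exact absurd (e₁.strictMono hij) (not_lt.2 (le_of_lt h1)) }
  have h := D.le_step D.tnorm_nonneg D.tnorm_le_ellOneNorm x n F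
  rw [← D.tnorm_eq_step] at h
  refine le_trans (le_of_eq ?_) h
  congr 1
  exact (e.sum_comp fun i => D.tnorm (restrictTo (E i) x)).symm

theorem abs_apply_le_tnorm (x : ℕ+ →₀ ℝ) (p : ℕ+) : |x p| ≤ D.tnorm x :=
  (abs_le_supNorm x p).trans (D.supNorm_le_tnorm x)

theorem IsNorming.pairing_le {f : ℕ+ →₀ ℝ} (hf : D.IsNorming ok f) :
    ∀ x, absPairing x f ≤ D.tnorm x := by
  induction hf with
  | single q => exact fun x => absPairing_single x q ▸ abs_apply_le_tnorm x q
  | node n g hg hok hsep hmin ih =>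
    intro x
    refine le_trans ?_ (theta_mul_sum_le_tnorm n (fun i => (g i).support)
      (fun i => (hg i).support_nonempty) hsep hmin x)
    rw [map_smul, map_sum, smul_eq_mul]
    refine mul_le_mul_of_nonneg_left (Finset.sum_le_sum fun i _ => ?_) (D.θ_pos n).le
    rw [← absPairing_restrictTo x subset_rfl]
    exact ih i _

/-- With `IsNorming.pairing_le` this shows that the unconstrained functionals norm the space, so
that norm estimates become inductions over trees of functionals. -/
theorem exists_isNorming_of_lt_iterNorm (m : ℕ) : ∀ {x : ℕ+ →₀ ℝ} {β : ℝ}, 0 ≤ β →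
    β < D.iterNorm m x → ∃ f, D.IsNorming (fun _ _ => True) f ∧ f.support ⊆ x.support ∧
      β < absPairing x f := by
  have hbase : ∀ {x : ℕ+ →₀ ℝ} {β : ℝ}, 0 ≤ β → β < supNorm x →
      ∃ f, D.IsNorming (fun _ _ => True) f ∧ f.support ⊆ x.support ∧ β < absPairing x f := by
    intro x β h0 h
    obtain ⟨i, hi⟩ := exists_lt_of_lt_ciSup h
    refine ⟨Finsupp.single i 1, .single i, ?_, by rwa [absPairing_single]⟩
    refine Finsupp.support_single_subset.trans (Finset.singleton_subset_iff.2 ?_)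
    rw [Finsupp.mem_support_iff]
    exact abs_pos.1 (h0.trans_lt hi)
  induction m with
  | zero => exact hbase
  | succ m ih =>
    intro x β h0 h
    rcases lt_max_iff.1 h with h | h
    · exact hbase h0 h
    obtain ⟨n, hn⟩ := exists_lt_of_lt_ciSup h
    rw [Real.mul_iSup_of_nonneg (D.θ_pos n).le] at hn
    obtain ⟨F, hF⟩ := exists_lt_of_lt_ciSup hn
    set a : Fin F.k → ℝ := fun i => D.iterNorm m (restrictTo (F.E i) x) with ha
    have ha0 : ∀ i, 0 ≤ a i := fun i => D.iterNorm_nonneg m _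
    -- The induction hypothesis only reaches values strictly below each child's norm; the factor `s`
    -- distributes the available slack among the children.
    obtain ⟨s, hs0, hs1, hs⟩ : ∃ s : ℝ, 0 ≤ s ∧ s < 1 ∧ β < s * (D.θ n * ∑ i, a i) := by
      have hX : 0 < D.θ n * ∑ i, a i := h0.trans_lt hF
      obtain ⟨s, hs1, hs2⟩ := exists_between ((div_lt_one hX).2 hF)
      exact ⟨s, (div_nonneg h0 hX.le).trans hs1.le, hs2, (div_lt_iff₀ hX).1 hs1⟩
    have hex : ∀ i, ∃ g : ℕ+ →₀ ℝ, (g = 0 ∨ D.IsNorming (fun _ _ => True) g) ∧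
        g.support ⊆ x.support ∩ F.E i ∧ s * a i ≤ absPairing x g := by
      intro i
      rcases (ha0 i).eq_or_lt with h | h
      · exact ⟨0, Or.inl rfl, by simp, by simp [← h]⟩
      · obtain ⟨g, hg, hgs, hgl⟩ := ih (x := restrictTo (F.E i) x) (β := s * a i)
          (mul_nonneg hs0 h.le) (mul_lt_of_lt_one_left h hs1)
        rw [support_restrictTo, Finset.filter_mem_eq_inter] at hgs
        refine ⟨g, Or.inr hg, hgs, hgl.le.trans_eq ?_⟩
        exact absPairing_restrictTo x (hgs.trans Finset.inter_subset_right)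
    choose g hg hgs hgl using hex
    have hval : β < absPairing x (D.θ n • ∑ i, g i) := by
      rw [map_smul, map_sum, smul_eq_mul]
      refine hs.trans_le ?_
      rw [mul_left_comm, Finset.mul_sum]
      exact mul_le_mul_of_nonneg_left (Finset.sum_le_sum fun i _ => hgl i) (D.θ_pos n).le
    have hsep : ∀ i j, i ≠ j → (D.σ n).Sep (F.E i) (F.E j) :=
      fun i j hij => F.sep hij
    have hsub : ∀ i, (g i).support ⊆ F.E i := fun i => (hgs i).trans Finset.inter_subset_right
    refine ⟨D.θ n • ∑ i, g i, ?_, ?_, hval⟩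
    · refine (IsNorming.node_of_injOn n g hg (fun _ _ => trivial)
        (fun i j hij => (hsep i j hij).mono (hsub i) (hsub j)) F.mins_mem
        (fun i => minElt (F.E i)) (fun i j _ _ hij => ?_) fun i hi => ⟨?_, ?_⟩).resolve_left ?_
      · exact minElt_injective F.nonempty hsep hij
      · exact Finset.mem_image.2 ⟨i, Finset.mem_univ _, (minElt_eq _).symm⟩
      · exact minElt_anti (hsub i) (Finsupp.support_nonempty_iff.2 hi)
      · intro h
        rw [h, map_zero] at hval
        exact absurd hval (not_lt.2 h0)
    · refine Finsupp.support_smul.trans (Finsupp.support_finsetSum.trans ?_)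
      exact Finset.biUnion_subset.2 fun i _ => (hgs i).trans Finset.inter_subset_left

theorem exists_isNorming_of_lt_tnorm {x : ℕ+ →₀ ℝ} {β : ℝ} (h0 : 0 ≤ β) (h : β < D.tnorm x) :
    ∃ f, D.IsNorming (fun _ _ => True) f ∧ f.support ⊆ x.support ∧ β < absPairing x f := by
  obtain ⟨m, hm⟩ := exists_lt_of_lt_ciSup h
  exact exists_isNorming_of_lt_iterNorm m h0 hm

theorem tnorm_le_of_forall_isNorming {x : ℕ+ →₀ ℝ} {b : ℝ} (hb : 0 ≤ b)
    (h : ∀ f, D.IsNorming (fun _ _ => True) f → f.support ⊆ x.support → absPairing x f ≤ b) :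
    D.tnorm x ≤ b := by
  by_contra! hlt
  obtain ⟨f, hf, hs, hlt⟩ := exists_isNorming_of_lt_tnorm hb hlt
  exact absurd (h f hf hs) (not_le.2 hlt)

/-- The unit vector basis is 1-unconditional, since the norming functionals are positive and pair
with $|x|$. -/
theorem tnorm_mono {x y : ℕ+ →₀ ℝ} (h : ∀ p, |x p| ≤ |y p|) : D.tnorm x ≤ D.tnorm y :=
  tnorm_le_of_forall_isNorming (D.tnorm_nonneg y) fun _ hf _ =>
    (absPairing_mono hf.nonneg fun p _ => h p).trans (hf.pairing_le y)

/-- Where a modified index is available, few disjoint functionals far out sum up nicely. -/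
theorem exists_modified_sum_le : ∃ p : ℕ+, ∀ {ι : Type} [Fintype ι] (s : Finset ι)
    (g : ι → ℕ+ →₀ ℝ) (x : ℕ+ →₀ ℝ), (∀ i ∈ s, D.IsNorming (fun _ _ => True) (g i)) →
    (∀ i ∈ s, ∀ j ∈ s, i ≠ j → Disjoint (g i).support (g j).support) →
    (∀ q ∈ x.support, s.card ≤ (q : ℕ)) → D.θ p * ∑ i ∈ s, absPairing x (g i) ≤ D.tnorm x := by
  classical
  obtain ⟨p, hp⟩ := D.exists_modified
  refine ⟨p, fun s g x hg hd hx => ?_⟩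
  have hfil := fun i (hi : i ∈ s) =>
    (hg i hi).filter (fun _ _ _ _ _ => trivial) (· ∈ x.support)
  set g' : s → ℕ+ →₀ ℝ := fun i => (g i).filter (· ∈ x.support) with hg'
  have hsub : ∀ i : s, (g' i).support = (g i).support ∩ x.support := fun i => by
    rw [hg', ← Finset.filter_mem_eq_inter]; exact Finsupp.support_filter _ _
  have hpair : ∀ i : s, absPairing x (g' i) = absPairing x (g i) := by
    intro i
    rw [absPairing_eq_sum x (g i) subset_rfl, absPairing_eq_sum x (g' i)
      ((hsub i).trans_subset Finset.inter_subset_left)]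
    refine Finset.sum_congr rfl fun q _ => ?_
    by_cases hq : q ∈ x.support
    · rw [hg', Finsupp.filter_apply_pos _ _ hq]
    · rw [Finsupp.notMem_support_iff.1 hq]; simp
  have hdis : ∀ i j : s, i ≠ j → Disjoint (g' i).support (g' j).support := fun i j hij => by
    rw [hsub, hsub]
    exact Finset.disjoint_of_subset_left Finset.inter_subset_left
      (Finset.disjoint_of_subset_right Finset.inter_subset_left
        (hd i i.2 j j.2 fun h => hij (Subtype.ext h)))
  have hmem : ∀ i : s, g' i ≠ 0 → minElt (g' i).support ∈ (g' i).support := fun i hi =>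
    minElt_mem (Finsupp.support_nonempty_iff.2 hi)
  -- After restriction to the support of `x`, all minima are at least the number of functionals, so
  -- they form an $\mathcal S_1$-set; as `p` is modified, disjointness is separation enough.
  have key := IsNorming.node_of_injOn (D := D) (ok := fun _ _ => True) p g'
    (fun i => hfil i i.2) (fun _ _ => trivial) (fun i j hij => hp ▸ hdis i j hij)
    (F := (Finset.univ.filter fun i => g' i ≠ 0).image fun i => minElt (g' i).support)
    (schreierOne_subset p.pos ?_) (fun i => minElt (g' i).support) ?_ ?_
  · have hle : absPairing x (D.θ p • ∑ i, g' i) ≤ D.tnorm x := by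
      rcases key with h | h
      · rw [h, map_zero]; exact D.tnorm_nonneg x
      · exact h.pairing_le x
    rw [map_smul, map_sum, smul_eq_mul, Finset.sum_congr rfl fun i _ => hpair i] at hle
    rwa [← Finset.sum_coe_sort s fun i => absPairing x (g i)]
  · intro q hq
    obtain ⟨i, hi, rfl⟩ := Finset.mem_image.1 hq
    have h1 := hmem i (Finset.mem_filter.1 hi).2
    rw [hsub] at h1
    refine Finset.card_image_le.trans ((Finset.card_le_univ _).trans ?_)
    rw [Fintype.card_coe]
    exact hx _ (Finset.mem_inter.1 h1).2
  · intro i j hi hj hij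
    by_contra hne
    refine Finset.disjoint_left.1 (hdis i j hne) (hmem i hi) ?_
    rw [hij]; exact hmem j hj
  · intro i hi
    exact ⟨Finset.mem_image_of_mem _ (Finset.mem_filter.2 ⟨Finset.mem_univ _, hi⟩), le_rfl⟩

end TsirelsonData

namespace TsirelsonData

variable {D : TsirelsonData}

/-! ### Upper estimates for block sequences -/

variable (D) in
/-- `t` is the value at `v` of disjoint groups of norming functionals supported in `E`, each group
admissible of order at most `N` and starting before `l`. -/
def Splits (N : ℕ) (l : ℕ+) (v : ℕ+ →₀ ℝ) (E : Finset ℕ+) (t : ℝ) : Prop :=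
  ∃ (κ : Type) (_ : Fintype κ) (ι : κ → Type) (_ : ∀ j, Fintype (ι j)) (n : κ → ℕ+)
    (g : ∀ j, ι j → ℕ+ →₀ ℝ),
    (∀ j, (n j : ℕ) ≤ N) ∧ (∀ j i, D.IsNorming (fun _ _ => True) (g j i)) ∧
    (∀ j i, (g j i).support ⊆ E) ∧
    (∀ j, Pairwise fun i i' => (D.σ (n j)).Sep (g j i).support (g j i').support) ∧
    (∀ j, (Finset.univ.image fun i => minElt (g j i).support) ∈ schreier (n j)) ∧
    (∀ j, ∃ i, minElt (g j i).support < l) ∧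
    (∀ j j' i i', j ≠ j' → Disjoint (g j i).support (g j' i').support) ∧
    t = ∑ j, ∑ i, absPairing v (g j i)

theorem splits_zero (N : ℕ) (l : ℕ+) (v : ℕ+ →₀ ℝ) (E : Finset ℕ+) : D.Splits N l v E 0 :=
  ⟨Empty, inferInstance, fun _ => Empty, fun _ => inferInstance, Empty.elim, fun j => j.elim,
    fun j => j.elim, fun j => j.elim, fun j => j.elim, fun j => j.elim, fun j => j.elim,
    fun j => j.elim, fun j => j.elim, by simp⟩

theorem Splits.nonneg {N : ℕ} {l : ℕ+} {v : ℕ+ →₀ ℝ} {E : Finset ℕ+} {t : ℝ}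
    (h : D.Splits N l v E t) : 0 ≤ t := by
  obtain ⟨κ, _, ι, _, n, g, -, hg, -, -, -, -, -, rfl⟩ := h
  exact Finset.sum_nonneg fun j _ => Finset.sum_nonneg fun i _ =>
    absPairing_nonneg v (hg j i).nonneg

theorem Splits.exists_mem {N : ℕ} {l : ℕ+} {v : ℕ+ →₀ ℝ} {E : Finset ℕ+} {t : ℝ}
    (h : D.Splits N l v E t) (ht : t ≠ 0) : ∃ p ∈ E, p ∈ v.support := by
  obtain ⟨κ, _, ι, _, n, g, -, hg, hE, -, -, -, -, rfl⟩ := h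
  by_contra! hcon
  refine ht (Finset.sum_eq_zero fun j _ => Finset.sum_eq_zero fun i _ => ?_)
  exact absPairing_eq_zero (Finset.disjoint_left.2 fun p hp => hcon p (hE j i hp))

theorem splits_sum {N : ℕ} {l : ℕ+} {v : ℕ+ →₀ ℝ} {E : Finset ℕ+} {α : Type} [Fintype α]
    {E' : α → Finset ℕ+} {t : α → ℝ} (h : ∀ a, D.Splits N l v (E' a) (t a))
    (hE : ∀ a, E' a ⊆ E) (hd : Pairwise fun a b => Disjoint (E' a) (E' b)) :
    D.Splits N l v E (∑ a, t a) := by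
  choose κ h1 ι h2 n g hN hg hgE hsep hmin hl hdis ht using h
  refine ⟨Σ a, κ a, inferInstance, fun j => ι j.1 j.2, fun j => h2 j.1 j.2, fun j => n j.1 j.2,
    fun j => g j.1 j.2, fun j => hN j.1 j.2, fun j => hg j.1 j.2,
    fun j i => (hgE j.1 j.2 i).trans (hE j.1), fun j => hsep j.1 j.2, fun j => hmin j.1 j.2,
    fun j => hl j.1 j.2, ?_, ?_⟩
  · rintro ⟨a, j⟩ ⟨a', j'⟩ i i' hjj
    by_cases ha : a = a'
    · subst ha
      exact hdis a j j' i i' fun h => hjj (by rw [h])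
    · exact Finset.disjoint_of_subset_left (hgE a j i)
        (Finset.disjoint_of_subset_right (hgE a' j' i') (hd ha))
  · rw [Fintype.sum_sigma]
    exact Finset.sum_congr rfl fun a _ => ht a

/-- The vectors `v_k` are supported in successive intervals `[l_k, l_{k+1} / 2)`. -/
structure IsBlocked (v : ℕ → ℕ+ →₀ ℝ) (l : ℕ → ℕ+) : Prop where
  mono : StrictMono l
  le : ∀ k, ∀ p ∈ (v k).support, l k ≤ p
  lt : ∀ k, ∀ p ∈ (v k).support, 2 * p + 1 ≤ l (k + 1)

variable {v : ℕ → ℕ+ →₀ ℝ} {l : ℕ → ℕ+}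

theorem IsBlocked.double_lt (h : IsBlocked v l) {j k : ℕ} (hjk : j < k) {p : ℕ+}
    (hp : p ∈ (v j).support) : 2 * p + 1 ≤ l k :=
  (h.lt j p hp).trans (h.mono.monotone hjk)

theorem IsBlocked.lt_left (h : IsBlocked v l) {j k : ℕ} (hjk : j < k) {p : ℕ+}
    (hp : p ∈ (v j).support) : p < l k := by
  have h1 := h.double_lt hjk hp
  rw [← PNat.coe_le_coe] at h1
  rw [← PNat.coe_lt_coe]
  push_cast at h1
  simp at h1
  omega

theorem IsBlocked.lt_of_lt (h : IsBlocked v l) {j k : ℕ} (hjk : j < k) {p q : ℕ+}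
    (hp : p ∈ (v j).support) (hq : q ∈ (v k).support) : p < q :=
  (h.lt_left hjk hp).trans_le (h.le k q hq)

theorem IsBlocked.le_of_le (h : IsBlocked v l) {j k : ℕ} {p q : ℕ+}
    (hp : p ∈ (v j).support) (hq : q ∈ (v k).support) (hpq : p ≤ q) : j ≤ k := by
  by_contra! hlt
  exact absurd (h.lt_of_lt hlt hq hp) (not_lt.2 hpq)

theorem IsBlocked.eq (h : IsBlocked v l) {j k : ℕ} {p : ℕ+}
    (hp : p ∈ (v j).support) (hq : p ∈ (v k).support) : j = k :=
  le_antisymm (h.le_of_le hp hq le_rfl) (h.le_of_le hq hp le_rfl)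

/-- The index of the block containing `p`. -/
def blockIndex (v : ℕ → ℕ+ →₀ ℝ) (p : ℕ+) : ℕ :=
  open Classical in if h : ∃ k, p ∈ (v k).support then h.choose else 0

theorem mem_blockIndex {p : ℕ+} (h : ∃ k, p ∈ (v k).support) :
    p ∈ (v (blockIndex v p)).support := by
  rw [blockIndex, dif_pos h]; exact h.choose_spec

/-- Weak comparison of the indices is enough in the unmodified case, because distinctness makes it
strict. -/
theorem sep_of_index (hl : StrictMono l) (s : AdaptType) {A B : Finset ℕ+} {P Q : ℕ → Prop}
    (hA : ∀ p ∈ A, ∃ k, P k ∧ p = l k) (hB : ∀ p ∈ B, ∃ k, Q k ∧ p = l k)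
    (hne : ∀ k k', P k → Q k' → k ≠ k')
    (hU : s = AdaptType.U → (∀ k k', P k → Q k' → k ≤ k') ∨ (∀ k k', P k → Q k' → k' ≤ k)) :
    s.Sep A B := by
  cases s with
  | M =>
    refine Finset.disjoint_left.2 fun p hp hq => ?_
    obtain ⟨k, hk, rfl⟩ := hA p hp
    obtain ⟨k', hk', hkk⟩ := hB _ hq
    exact hne k k' hk hk' (hl.injective hkk)
  | U =>
    refine (hU rfl).imp (fun h a ha b hb => ?_) (fun h a ha b hb => ?_)
    · obtain ⟨k, hk, rfl⟩ := hA a ha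
      obtain ⟨k', hk', rfl⟩ := hB b hb
      exact hl ((h k k' hk hk').lt_of_ne (hne k k' hk hk'))
    · obtain ⟨k, hk, rfl⟩ := hA a ha
      obtain ⟨k', hk', rfl⟩ := hB b hb
      exact hl ((h k k' hk hk').lt_of_ne (hne k k' hk hk').symm)

/-- The constraint on norming functionals: nodes starting before `l_k` have order at most `N_k`. -/
def OrderBound (l : ℕ → ℕ+) (N : ℕ → ℕ) (n p : ℕ+) : Prop := ∀ k, p < l k → (n : ℕ) ≤ N k

/-- The tree of `f` is copied to a tree acting on the $e_{l_k}$. At a node $\theta_n \sum g_i$, a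
later block in which some child starts becomes a leaf $e^*_{l_k}$ of the new node, and its split is
the whole family $(g_i)$. Any other block is passed to a single child, the one among those started
before it whose copy is largest at $l_k$, and its splits are collected over these children. The
block in which `f` starts cannot be transferred, since no part of `f` precedes it, and is kept as a
separate term. The coefficients `c` are universally quantified because the induction modifies them.
-/
theorem exists_transfer (hB : IsBlocked v l) (N : ℕ → ℕ) {f : ℕ+ →₀ ℝ}
    (hf : D.IsNorming (OrderBound l N) f) : (∀ p ∈ f.support, ∃ k, p ∈ (v k).support) →
    ∀ (R : Finset ℕ) (c : ℕ → ℝ), (∀ k, 0 ≤ c k) →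
    ∃ g, D.IsNorming (fun _ _ => True) g ∧ ∃ t : ℕ → ℝ,
      (∀ k, D.Splits (N k) (l k) (v k) f.support (t k)) ∧
      ∑ k ∈ R, c k * absPairing (v k) f ≤
        (∑ k ∈ R, if blockIndex v (minElt f.support) < k then c k * (t k * g (l k)) else 0) +
        c (blockIndex v (minElt f.support)) *
          absPairing (v (blockIndex v (minElt f.support))) f := by
  classical
  induction hf with
  | single p =>
    intro hS R c hc
    have hsupp : (Finsupp.single p (1 : ℝ)).support = {p} := Finsupp.support_single _ (by norm_num)
    have hmin : minElt (Finsupp.single p (1 : ℝ)).support = p := by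
      simpa using minElt_mem (A := (Finsupp.single p (1 : ℝ)).support) (by simp)
    refine ⟨Finsupp.single 1 1, .single 1, 0, fun k => splits_zero _ _ _ _, ?_⟩
    rw [hmin]
    have hp := mem_blockIndex (hS p (by simp))
    set k₀ := blockIndex v p
    have hz : ∀ k, k ≠ k₀ → absPairing (v k) (Finsupp.single p 1) = 0 := fun k hk =>
      absPairing_eq_zero (by
        rw [hsupp, Finset.disjoint_singleton_left]
        exact fun h => hk (hB.eq h hp))
    have h0 : 0 ≤ c k₀ * absPairing (v k₀) (Finsupp.single p 1) :=
      mul_nonneg (hc _) (absPairing_nonneg _ (IsNorming.single (D := D)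
        (ok := fun _ _ => True) p).nonneg)
    simp only [Pi.zero_apply, zero_mul, mul_zero, ite_self, Finset.sum_const_zero, zero_add]
    by_cases hR : k₀ ∈ R
    · rw [Finset.sum_eq_single_of_mem k₀ hR fun k _ hk => by rw [hz k hk, mul_zero]]
    · rw [Finset.sum_eq_zero fun k hk => by rw [hz k (fun h => hR (h ▸ hk)), mul_zero]]
      exact h0
  | @node ι _ _ n g hg hok hsep hmin ih =>
    intro hS R c hc
    set f := D.θ n • ∑ i, g i with hf
    have hfN : D.IsNorming (OrderBound l N) f := .node n g hg hok hsep hmin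
    have hsub : ∀ i, (g i).support ⊆ f.support := fun i p hp =>
      (mem_support_node hsep).2 ⟨i, hp⟩
    have hSi : ∀ i, ∀ p ∈ (g i).support, ∃ k, p ∈ (v k).support := fun i p hp =>
      hS p (hsub i hp)
    set q : ι → ℕ+ := fun i => minElt (g i).support with hq
    have hqg : ∀ i, q i ∈ (g i).support := fun i => minElt_mem (hg i).support_nonempty
    set K : ι → ℕ := fun i => blockIndex v (q i) with hK
    have hqK : ∀ i, q i ∈ (v (K i)).support := fun i => mem_blockIndex (hSi i _ (hqg i))
    have hq0 : minElt f.support ∈ f.support := minElt_mem hfN.support_nonempty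
    set k₀ := blockIndex v (minElt f.support) with hk₀
    have hq0v : minElt f.support ∈ (v k₀).support := mem_blockIndex (hS _ hq0)
    have hk₀K : ∀ i, k₀ ≤ K i := fun i => hB.le_of_le hq0v (hqK i) (minElt_le (hsub i (hqg i)))
    obtain ⟨i₀, hi₀⟩ : ∃ i, K i = k₀ := by
      obtain ⟨i, hi⟩ := (mem_support_node hsep).1 hq0
      refine ⟨i, ?_⟩
      have : q i = minElt f.support :=
        le_antisymm (minElt_le hi) (minElt_le (hsub i (hqg i)))
      rw [hK, hk₀]; simp only [this]
    have hinj : Function.Injective q := minElt_injective (fun i => (hg i).support_nonempty) hsep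
    -- Blocks in which a child starts are treated at this node; deleting their coefficients makes
    -- the leftover term of every induction hypothesis vanish.
    set c' : ℕ → ℝ := fun k => if ∃ i, K i = k then 0 else c k with hc'
    have hc'0 : ∀ k, 0 ≤ c' k := fun k => by
      simp only [hc']; split_ifs
      exacts [le_rfl, hc k]
    have IH := fun i => ih i (hSi i) R c' hc'0
    choose G hG τ hτ hle using IH
    have hτ0 : ∀ i k, 0 ≤ τ i k := fun i k => (hτ i k).nonneg
    -- the choice of a child for each block that is not split at this node
    have hsel : ∀ k, ∃ a : ι, (∃ i, K i < k ∧ τ i k ≠ 0) → (K a < k ∧ τ a k ≠ 0) ∧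
        ∀ i, K i < k ∧ τ i k ≠ 0 → G i (l k) ≤ G a (l k) := by
      intro k
      by_cases hex : ∃ i, K i < k ∧ τ i k ≠ 0
      · obtain ⟨i, hi⟩ := hex
        obtain ⟨a, ha, hmax⟩ := Finset.exists_max_image
          (Finset.univ.filter fun i => K i < k ∧ τ i k ≠ 0) (fun i => G i (l k))
          ⟨i, by simpa using hi⟩
        exact ⟨a, fun _ => ⟨(Finset.mem_filter.1 ha).2, fun i hi =>
          hmax i (Finset.mem_filter.2 ⟨Finset.mem_univ _, hi⟩)⟩⟩
      · exact ⟨i₀, fun h => absurd h hex⟩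
    choose a ha using hsel
    -- Each block goes to at most one child, so the copies of the children stay disjoint.
    let A : ι → ℕ → Prop := fun i k => (∃ i', K i' < k ∧ τ i' k ≠ 0) ∧ a k = i ∧ ¬ ∃ j, K j = k
    have hA1 : ∀ {i k}, A i k → K i < k := fun {i k} h => h.2.1 ▸ ((ha k) h.1).1.1
    have hA2 : ∀ {i k}, A i k → ∃ p ∈ (g i).support, p ∈ (v k).support := fun {i k} h =>
      (hτ i k).exists_mem (h.2.1 ▸ ((ha k) h.1).1.2)
    -- the largest start of a child before a given block
    have hφ : ∀ k, ∃ x : ℕ+, k₀ < k → (∃ i, K i < k ∧ q i = x) ∧ ∀ i, K i < k → q i ≤ x := by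
      intro k
      by_cases hk : k₀ < k
      · obtain ⟨i, hi, hmax⟩ := Finset.exists_max_image (Finset.univ.filter fun i => K i < k) q
          ⟨i₀, by simpa [hi₀] using hk⟩
        exact ⟨q i, fun _ => ⟨⟨i, (Finset.mem_filter.1 hi).2, rfl⟩, fun j hj =>
          hmax j (Finset.mem_filter.2 ⟨Finset.mem_univ _, hj⟩)⟩⟩
      · exact ⟨1, fun h => absurd h hk⟩
    choose φ hφ using hφ
    let L : Finset ℕ := R.filter fun k => k₀ < k ∧ ∃ i, K i = k
    have hL : ∀ k : L, k₀ < (k : ℕ) ∧ ∃ i, K i = k := fun k => (Finset.mem_filter.1 k.2).2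
    let X : L ⊕ ι → ℕ → Prop := Sum.elim (fun k m => m = k) A
    let h : L ⊕ ι → ℕ+ →₀ ℝ := Sum.elim (fun k => Finsupp.single (l k) 1)
      fun i => (G i).filter fun p => ∃ k, A i k ∧ p = l k
    have hX : ∀ j, ∀ p ∈ (h j).support, ∃ k, X j k ∧ p = l k := by
      rintro (k | i) p hp
      · exact ⟨k, rfl, by simpa using Finsupp.support_single_subset hp⟩
      · change p ∈ ((G i).filter _).support at hp
        rw [Finsupp.support_filter, Finset.mem_filter] at hp
        exact hp.2
    -- The new node has up to twice as many members. Leaves are charged to odd and copied children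
    -- to even points of the doubled set of minima; these lie below the new minima because $2p+1 \le
    -- l_k$ for every `p` in an earlier block.
    let ψ : L ⊕ ι → ℕ+ := Sum.elim (fun k => 2 * φ k + 1) fun i => 2 * q i
    have key := IsNorming.node_of_injOn (D := D) (ok := fun _ _ => True) n h
      (F := doubling (Finset.univ.image q)) ?_ (fun _ _ => trivial) ?_
      (doubling_mem_schreier n.pos hmin) ψ ?_ ?_
    rotate_left
    · rintro (k | i)
      · exact Or.inr (.single _)
      · exact (hG i).filter (fun _ _ _ _ _ => trivial) _
    · intro j j' hjj
      refine sep_of_index hB.mono _ (hX j) (hX j') ?_ ?_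
      · rintro k k' hk hk' rfl
        rcases j with j | j <;> rcases j' with j' | j'
        · exact hjj (congrArg Sum.inl (Subtype.ext (hk.symm.trans hk')))
        · exact hk'.2.2 (hk ▸ (hL j).2)
        · exact hk.2.2 (hk' ▸ (hL j').2)
        · exact hjj (congrArg Sum.inr (hk.2.1.symm.trans hk'.2.1))
      · intro hσ
        have hU : ∀ i i', i ≠ i' → (∀ x ∈ (g i).support, ∀ y ∈ (g i').support, x < y) ∨
            (∀ x ∈ (g i).support, ∀ y ∈ (g i').support, y < x) := fun i i' hii => by
          have := hsep hii
          rwa [hσ] at this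
        have hLA : ∀ (j : L) (i : ι), (∀ k, A i k → (j : ℕ) ≤ k) ∨ (∀ k, A i k → k ≤ (j : ℕ)) := by
          intro j i
          obtain ⟨i', hi'⟩ := (hL j).2
          by_cases hii : i = i'
          · left
            intro k hk
            rw [← hi', ← hii]; exact (hA1 hk).le
          · rcases hU i i' hii with hlt | hlt
            · right
              intro k hk
              obtain ⟨p, hp, hpk⟩ := hA2 hk
              rw [← hi']
              exact hB.le_of_le hpk (hqK i') (hlt p hp _ (hqg i')).le
            · left
              intro k hk
              obtain ⟨p, hp, hpk⟩ := hA2 hk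
              rw [← hi']
              exact hB.le_of_le (hqK i') hpk (hlt p hp _ (hqg i')).le
        rcases j with j | j <;> rcases j' with j' | j'
        · rcases le_total (j : ℕ) j' with h | h
          · left; rintro k k' hk hk'
            rw [show k = j from hk, show k' = j' from hk']; exact h
          · right; rintro k k' hk hk'
            rw [show k = j from hk, show k' = j' from hk']; exact h
        · rcases hLA j j' with h | h
          · left; rintro k k' hk hk'
            rw [show k = j from hk]; exact h k' hk'
          · right; rintro k k' hk hk'
            rw [show k = j from hk]; exact h k' hk'
        · rcases hLA j' j with h | h
          · right; rintro k k' hk hk'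
            rw [show k' = j' from hk']; exact h k hk
          · left; rintro k k' hk hk'
            rw [show k' = j' from hk']; exact h k hk
        · rcases hU j j' fun h => hjj (by rw [h]) with h | h
          · left; intro k k' hk hk'
            obtain ⟨p, hp, hpk⟩ := hA2 hk
            obtain ⟨p', hp', hpk'⟩ := hA2 hk'
            exact hB.le_of_le hpk hpk' (h p hp p' hp').le
          · right; intro k k' hk hk'
            obtain ⟨p, hp, hpk⟩ := hA2 hk
            obtain ⟨p', hp', hpk'⟩ := hA2 hk'
            exact hB.le_of_le hpk' hpk (h p hp p' hp').le
    -- Distinct leaves get distinct charges: a child starts in the earlier block, hence after `φ j`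
    -- and before the later block.
    · have hφlt : ∀ j j' : L, (j : ℕ) < j' → φ j < φ j' := by
        intro j j' hjj
        obtain ⟨⟨i, hi, hie⟩, -⟩ := hφ j (hL j).1
        obtain ⟨i', hi'⟩ := (hL j).2
        rw [← hie]
        refine lt_of_lt_of_le (hB.lt_of_lt (k := K i') (by rw [hi']; exact hi) (hqK i) (hqK i')) ?_
        exact (hφ j' (hL j').1).2 i' (by rw [hi']; exact hjj)
      rintro (j | j) (j' | j') - - hψ
      · have h1 : φ j = φ j' := by
          have := congrArg PNat.val hψ
          simp only [ψ, Sum.elim_inl, PNat.val_ofNat, PNat.add_coe, PNat.mul_coe] at this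
          exact PNat.eq (by omega)
        congr 1
        refine Subtype.ext ?_
        rcases lt_trichotomy (j : ℕ) j' with h | h | h
        · exact absurd h1 (hφlt j j' h).ne
        · exact h
        · exact absurd h1 (hφlt j' j h).ne'
      · have := congrArg PNat.val hψ
        simp only [ψ, Sum.elim_inl, Sum.elim_inr, PNat.val_ofNat, PNat.add_coe, PNat.mul_coe]
          at this
        omega
      · have := congrArg PNat.val hψ
        simp only [ψ, Sum.elim_inl, Sum.elim_inr, PNat.val_ofNat, PNat.add_coe, PNat.mul_coe]
          at this
        omega
      · have := congrArg PNat.val hψ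
        simp only [ψ, Sum.elim_inr, PNat.val_ofNat, PNat.mul_coe] at this
        exact congrArg Sum.inr (hinj (PNat.eq (by omega)))
    · rintro (j | j) hj
      · obtain ⟨⟨i, hi, hie⟩, -⟩ := hφ j (hL j).1
        refine ⟨mem_doubling.2 ⟨φ j, hie ▸ Finset.mem_image_of_mem q (Finset.mem_univ i),
          Or.inr rfl⟩, ?_⟩
        obtain ⟨k, hk, hkl⟩ := hX (Sum.inl j) _ (minElt_mem (Finsupp.support_nonempty_iff.2 hj))
        rw [hkl, show k = j from hk]
        change 2 * φ j + 1 ≤ _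
        rw [← hie]
        exact hB.double_lt hi (hqK i)
      · refine ⟨mem_doubling.2 ⟨q j, Finset.mem_image_of_mem q (Finset.mem_univ j),
          Or.inl rfl⟩, ?_⟩
        obtain ⟨k, hk, hkl⟩ := hX (Sum.inr j) _ (minElt_mem (Finsupp.support_nonempty_iff.2 hj))
        rw [hkl]
        change 2 * q j ≤ _
        exact (PNat.lt_add_right _ _).le.trans (hB.double_lt (hA1 hk) (hqK j))
    obtain ⟨g', hg', hgg'⟩ : ∃ g', D.IsNorming (fun _ _ => True) g' ∧
        ∀ p, (D.θ n • ∑ j, h j) p ≤ g' p := by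
      rcases key with h0 | h0
      · refine ⟨_, .single 1, fun p => ?_⟩
        rw [h0]; exact (IsNorming.single (D := D) (ok := fun _ _ => True) 1).nonneg p
      · exact ⟨_, h0, fun p => le_rfl⟩
    have hh0 : ∀ j p, 0 ≤ h j p := by
      rintro (j | j) p
      · exact (IsNorming.single (D := D) (ok := fun _ _ => True) (l j)).nonneg p
      · change 0 ≤ (G j).filter _ p
        rw [Finsupp.filter_apply]; split_ifs
        exacts [(hG j).nonneg p, le_rfl]
    have hlow : ∀ j p, D.θ n * h j p ≤ g' p := fun j p => by
      refine le_trans ?_ (hgg' p)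
      rw [Finsupp.smul_apply, Finsupp.finsetSum_apply, smul_eq_mul]
      exact mul_le_mul_of_nonneg_left (Finset.single_le_sum (f := fun j => h j p)
        (fun j _ => hh0 j p) (Finset.mem_univ j)) (D.θ_pos n).le
    let t : ℕ → ℝ := fun k => if ∃ i, K i = k then
        (if k₀ < k then ∑ i, absPairing (v k) (g i) else 0)
      else ∑ i, if K i < k then τ i k else 0
    have hpf : ∀ k, absPairing (v k) f = D.θ n * ∑ i, absPairing (v k) (g i) := fun k => by
      rw [hf, map_smul, map_sum, smul_eq_mul]
    refine ⟨g', hg', t, ?_, ?_⟩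
    · intro k
      simp only [t]
      split_ifs with h1 h2
      · refine ⟨Unit, inferInstance, fun _ => ι, fun _ => inferInstance, fun _ => n,
          fun _ => g, fun _ => ?_, fun _ i => (hg i).weaken fun _ _ _ => trivial,
          fun _ i => hsub i, fun _ => hsep, fun _ => hmin, fun _ => ⟨i₀, ?_⟩, ?_, by simp⟩
        -- The order constraint enters here: the child `i₀` starts in block `k₀`, before `l k`,
        -- which forces `n ≤ N k`.
        · exact hok i₀ k (hB.lt_left (by rw [hi₀]; exact h2) (hqK i₀))
        · exact hB.lt_left (j := K i₀) (by rw [hi₀]; exact h2) (hqK i₀)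
        · exact fun j j' _ _ h => absurd rfl h
      · exact splits_zero _ _ _ _
      · refine splits_sum (E' := fun i => (g i).support) (fun i => ?_) hsub
          fun i j hij => (hsep hij).disjoint
        split_ifs
        · exact hτ i k
        · exact splits_zero _ _ _ _
    · have hterm : ∀ k ∈ R, c k * absPairing (v k) f ≤
          (if k = k₀ then c k₀ * absPairing (v k₀) f else 0) +
          ((if k₀ < k ∧ ∃ i, K i = k then c k * (t k * g' (l k)) else 0) +
            D.θ n * ∑ i, c' k * absPairing (v k) (g i)) := by
        intro k hkR
        have hnn : 0 ≤ ∑ i, c' k * absPairing (v k) (g i) := Finset.sum_nonneg fun i _ =>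
          mul_nonneg (hc'0 k) (absPairing_nonneg _ (hg i).nonneg)
        have hnn' := mul_nonneg (D.θ_pos n).le hnn
        by_cases hk : k = k₀
        · subst hk
          simp only [if_true, lt_irrefl, false_and, if_false, zero_add]
          linarith
        rw [if_neg hk, zero_add]
        by_cases hk1 : ∃ i, K i = k
        · have hk2 : k₀ < k := by
            obtain ⟨i, hi⟩ := hk1
            exact lt_of_le_of_ne (hi ▸ hk₀K i) (Ne.symm hk)
          rw [if_pos ⟨hk2, hk1⟩]
          have ht : t k = ∑ i, absPairing (v k) (g i) := by
            simp only [t, if_pos hk1, if_pos hk2]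
          have hkL : k ∈ L := Finset.mem_filter.2 ⟨hkR, hk2, hk1⟩
          have hθ : D.θ n ≤ g' (l k) := by
            have := hlow (Sum.inl ⟨k, hkL⟩) (l k)
            simpa [h] using this
          have ht0 : 0 ≤ t k := ht ▸ Finset.sum_nonneg fun i _ =>
            absPairing_nonneg _ (hg i).nonneg
          have : c k * absPairing (v k) f ≤ c k * (t k * g' (l k)) := by
            rw [hpf, ← ht, mul_comm (D.θ n)]
            exact mul_le_mul_of_nonneg_left (mul_le_mul_of_nonneg_left hθ ht0) (hc k)
          linarith
        · rw [if_neg (fun h => hk1 h.2), zero_add, hpf, ← Finset.mul_sum]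
          simp only [hc', if_neg hk1]
          exact le_of_eq (by ring)
      refine (Finset.sum_le_sum hterm).trans ?_
      rw [Finset.sum_add_distrib, add_comm]
      refine add_le_add ?_ ?_
      · rw [Finset.sum_add_distrib, ← Finset.mul_sum, Finset.sum_comm]
        have hi1 : ∀ i, ∑ k ∈ R, c' k * absPairing (v k) (g i) ≤
            ∑ k ∈ R, if K i < k then c' k * (τ i k * G i (l k)) else 0 := by
          intro i
          refine (hle i).trans_eq ?_
          have : c' (K i) = 0 := if_pos ⟨i, rfl⟩
          change _ + c' (K i) * _ = _
          rw [this, zero_mul, add_zero]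
        have hi2 : D.θ n * ∑ i, ∑ k ∈ R, c' k * absPairing (v k) (g i) ≤
            ∑ k ∈ R, D.θ n * ∑ i, if K i < k then c' k * (τ i k * G i (l k)) else 0 := by
          rw [← Finset.mul_sum]
          exact mul_le_mul_of_nonneg_left ((Finset.sum_le_sum fun i _ => hi1 i).trans_eq
            Finset.sum_comm) (D.θ_pos n).le
        refine (add_le_add_right hi2 _).trans ?_
        rw [← Finset.sum_add_distrib]
        refine Finset.sum_le_sum fun k hkR => ?_
        by_cases hk1 : ∃ i, K i = k
        · have hz : c' k = 0 := if_pos hk1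
          simp only [hz, zero_mul, ite_self, Finset.sum_const_zero, mul_zero, add_zero]
          by_cases hk2 : k₀ < k
          · rw [if_pos ⟨hk2, hk1⟩, if_pos hk2]
          · rw [if_neg fun h => hk2 h.1, if_neg hk2]
        · rw [if_neg fun h => hk1 h.2, zero_add]
          have hz : c' k = c k := if_neg hk1
          by_cases hk2 : k₀ < k
          · rw [if_pos hk2, hz]
            have ht : t k = ∑ i, if K i < k then τ i k else 0 := if_neg hk1
            by_cases hex : ∃ i, K i < k ∧ τ i k ≠ 0
            · have hterm : ∀ i, (if K i < k then c k * (τ i k * G i (l k)) else 0) ≤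
                  c k * ((if K i < k then τ i k else 0) * G (a k) (l k)) := by
                intro i
                split_ifs with h1
                · refine mul_le_mul_of_nonneg_left ?_ (hc k)
                  by_cases h2 : τ i k = 0
                  · rw [h2, zero_mul, zero_mul]
                  · exact mul_le_mul_of_nonneg_left (((ha k) hex).2 i ⟨h1, h2⟩) (hτ0 i k)
                · simp
              have hG' : D.θ n * G (a k) (l k) ≤ g' (l k) := by
                refine le_trans (le_of_eq ?_) (hlow (Sum.inr (a k)) (l k))
                change _ = D.θ n * (G (a k)).filter _ (l k)
                rw [Finsupp.filter_apply_pos]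
                exact ⟨k, ⟨hex, rfl, hk1⟩, rfl⟩
              have ht0 : 0 ≤ t k := ht ▸ Finset.sum_nonneg fun i _ => by
                split_ifs
                exacts [hτ0 i k, le_rfl]
              calc D.θ n * ∑ i, (if K i < k then c k * (τ i k * G i (l k)) else 0)
                  ≤ D.θ n * ∑ i, c k * ((if K i < k then τ i k else 0) * G (a k) (l k)) :=
                    mul_le_mul_of_nonneg_left (Finset.sum_le_sum fun i _ => hterm i)
                      (D.θ_pos n).le
                _ = c k * (t k * (D.θ n * G (a k) (l k))) := by
                    rw [← Finset.mul_sum, ← Finset.sum_mul, ← ht]; ring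
                _ ≤ c k * (t k * g' (l k)) := mul_le_mul_of_nonneg_left
                    (mul_le_mul_of_nonneg_left hG' ht0) (hc k)
            · have hz' : ∀ i, (if K i < k then c k * (τ i k * G i (l k)) else 0) = 0 := by
                intro i
                split_ifs with h1
                · rw [show τ i k = 0 from by_contra fun h2 => hex ⟨i, h1, h2⟩]; simp
                · rfl
              rw [Finset.sum_eq_zero fun i _ => hz' i, mul_zero]
              refine mul_nonneg (hc k) (mul_nonneg ?_ (hg'.nonneg _))
              rw [ht]
              exact Finset.sum_nonneg fun i _ => by
                split_ifs
                exacts [hτ0 i k, le_rfl]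
          · rw [if_neg hk2, Finset.sum_eq_zero fun i _ => if_neg fun h =>
              hk2 ((hk₀K i).trans_lt h), mul_zero]
      · rw [Finset.sum_ite_eq' R k₀]
        split_ifs
        · exact le_rfl
        · exact mul_nonneg (hc _) (absPairing_nonneg _ hfN.nonneg)

end TsirelsonData

/-! ### Pruning of functionals and the upper estimate -/

namespace TsirelsonData

variable {D : TsirelsonData} {v : ℕ → ℕ+ →₀ ℝ} {l : ℕ → ℕ+}

/-- Coordinates at which the node constraint is violated may be dropped at a small cost. -/
theorem exists_prune {ok : ℕ+ → ℕ+ → Prop}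
    (hmono : ∀ n p q, p ≤ q → ok n p → ok n q) {δ : ℕ+ → ℝ} (hδ0 : ∀ p, 0 ≤ δ p)
    (hδ : ∀ n p, ¬ ok n p → D.θ n ≤ δ p) {f : ℕ+ →₀ ℝ}
    (hf : D.IsNorming (fun _ _ => True) f) :
    ∃ f', (f' = 0 ∨ D.IsNorming ok f') ∧ (∀ p, f' p ≤ f p) ∧ ∀ p, f p ≤ f' p + δ p := by
  classical
  induction hf with
  | single p =>
    exact ⟨_, Or.inr (.single p), fun _ => le_rfl, fun q => le_add_of_nonneg_right (hδ0 q)⟩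
  | @node ι _ _ n g hg _ hsep hmin ih =>
    choose f' hf' hle hge using ih
    have h0 : ∀ i p, 0 ≤ f' i p := fun i p => by
      rcases hf' i with h | h
      · rw [h]; exact le_rfl
      · exact h.nonneg p
    have hsub' : ∀ i, (f' i).support ⊆ (g i).support := fun i p hp => by
      rw [Finsupp.mem_support_iff] at hp ⊢
      exact ((lt_of_le_of_ne (h0 i p) hp.symm).trans_le (hle i p)).ne'
    -- Once all violating coordinates are gone the minima of the children satisfy the constraint. At
    -- a deleted coordinate `p` the node is at most `θ n`, hence at most `δ p`.
    let h : ι → ℕ+ →₀ ℝ := fun i => (f' i).filter (ok n)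
    have hsub : ∀ i, (h i).support ⊆ (g i).support := fun i => by
      refine Finset.Subset.trans ?_ (hsub' i)
      simp only [h, Finsupp.support_filter]; exact Finset.filter_subset _ _
    have hh0 : ∀ i p, 0 ≤ h i p := fun i p => by
      simp only [h, Finsupp.filter_apply]; split_ifs
      exacts [h0 i p, le_rfl]
    have hhle : ∀ i p, h i p ≤ g i p := fun i p => by
      simp only [h, Finsupp.filter_apply]; split_ifs
      exacts [hle i p, (hg i).nonneg p]
    have hh : ∀ p, ok n p → ∀ i, h i p = f' i p := fun p hp i =>
      Finsupp.filter_apply_pos _ _ hp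
    have hsum0 : ∀ p, 0 ≤ (D.θ n • ∑ i, h i) p := fun p => by
      rw [Finsupp.smul_apply, Finsupp.finsetSum_apply]
      exact mul_nonneg (D.θ_pos n).le (Finset.sum_nonneg fun i _ => hh0 i p)
    refine ⟨D.θ n • ∑ i, h i, ?_, fun p => ?_, fun p => ?_⟩
    · have hfil : ∀ i, h i = 0 ∨ D.IsNorming ok (h i) := fun i => by
        rcases hf' i with h' | h'
        · left; simp only [h, h', Finsupp.filter_zero]
        · exact h'.filter hmono _
      refine IsNorming.node_of_injOn n h hfil (fun i hi => ?_)
        (fun i j hij => (hsep hij).mono (hsub i) (hsub j)) hmin (fun i => minElt (g i).support)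
        (fun i j _ _ hij => minElt_injective (fun i => (hg i).support_nonempty) hsep hij)
        fun i hi => ⟨Finset.mem_image_of_mem _ (Finset.mem_univ i),
          minElt_anti (hsub i) (Finsupp.support_nonempty_iff.2 hi)⟩
      have := minElt_mem (Finsupp.support_nonempty_iff.2 hi)
      simp only [h, Finsupp.support_filter] at this
      exact (Finset.mem_filter.1 this).2
    · rw [Finsupp.smul_apply, Finsupp.finsetSum_apply, Finsupp.smul_apply,
        Finsupp.finsetSum_apply]
      exact mul_le_mul_of_nonneg_left (Finset.sum_le_sum fun i _ => hhle i p) (D.θ_pos n).le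
    · by_cases hp : p ∈ (D.θ n • ∑ i, g i).support
      · by_cases hok : ok n p
        · obtain ⟨i, hi⟩ := (mem_support_node hsep).1 hp
          have h1 : D.θ n * f' i p ≤ (D.θ n • ∑ i, h i) p := by
            rw [Finsupp.smul_apply, Finsupp.finsetSum_apply, smul_eq_mul, ← hh p hok]
            exact mul_le_mul_of_nonneg_left (Finset.single_le_sum (f := fun j => h j p)
              (fun j _ => hh0 j p) (Finset.mem_univ i)) (D.θ_pos n).le
          rw [node_apply hsep hi]
          have h2 := mul_le_mul_of_nonneg_left (hge i p) (D.θ_pos n).le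
          have h3 := mul_le_of_le_one_left (hδ0 p) (D.θ_lt_one n).le
          linarith
        · have := IsNorming.node_le hg hsep p
          have := hδ n p hok
          linarith [hsum0 p]
      · rw [Finsupp.notMem_support_iff.1 hp]
        exact add_nonneg (hsum0 p) (hδ0 p)

theorem OrderBound.mono {N : ℕ → ℕ} (n p q : ℕ+) (hpq : p ≤ q) (h : OrderBound l N n p) :
    OrderBound l N n q := fun k hk => h k (hpq.trans_lt hk)

theorem absPairing_eq_sum_support (x f : ℕ+ →₀ ℝ) :
    absPairing x f = ∑ p ∈ x.support, f p * |x p| := by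
  classical
  rw [absPairing_eq_sum x f (Finset.subset_union_left (s₂ := x.support))]
  refine (Finset.sum_subset Finset.subset_union_right fun p _ hp => ?_).symm
  rw [Finsupp.notMem_support_iff.1 hp]; simp

theorem sum_smul_single_apply (hl : StrictMono l) (R : Finset ℕ) (b : ℕ → ℝ) {k : ℕ}
    (hk : k ∈ R) : (∑ j ∈ R, b j • Finsupp.single (l j) (1 : ℝ)) (l k) = b k := by
  rw [Finsupp.finsetSum_apply, Finset.sum_eq_single_of_mem k hk]
  · simp
  · intro j _ hj
    simp [hl.injective.eq_iff, hj]

theorem support_sum_smul_single (R : Finset ℕ) (b : ℕ → ℝ) :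
    (∑ j ∈ R, b j • Finsupp.single (l j) (1 : ℝ)).support ⊆ R.image l := by
  classical
  refine Finsupp.support_finsetSum.trans fun p hp => ?_
  obtain ⟨k, hk, hp⟩ := Finset.mem_biUnion.1 hp
  have := Finsupp.support_single_subset (Finsupp.support_smul hp)
  rw [Finset.mem_singleton.1 this]
  exact Finset.mem_image_of_mem l hk

theorem absPairing_sum_smul_single (hl : StrictMono l) (R : Finset ℕ) (b : ℕ → ℝ)
    (g : ℕ+ →₀ ℝ) : absPairing (∑ j ∈ R, b j • Finsupp.single (l j) (1 : ℝ)) g =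
      ∑ k ∈ R, |b k| * g (l k) := by
  classical
  rw [absPairing_eq_sum_support, Finset.sum_subset (support_sum_smul_single R b),
    Finset.sum_image hl.injective.injOn]
  · refine Finset.sum_congr rfl fun k hk => ?_
    rw [sum_smul_single_apply hl R b hk, mul_comm]
  · intro p _ hp
    rw [Finsupp.notMem_support_iff.1 hp]; simp

theorem abs_le_tnorm_sum_smul_single (hl : StrictMono l) (R : Finset ℕ) (b : ℕ → ℝ) {k : ℕ}
    (hk : k ∈ R) : |b k| ≤ D.tnorm (∑ j ∈ R, b j • Finsupp.single (l j) (1 : ℝ)) := by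
  have := abs_apply_le_tnorm (D := D) (∑ j ∈ R, b j • Finsupp.single (l j) (1 : ℝ)) (l k)
  rwa [sum_smul_single_apply hl R b hk] at this

theorem sum_pow_succ_half_le (R : Finset ℕ) : ∑ k ∈ R, (1 / 2 : ℝ) ^ (k + 1) ≤ 1 := by
  have h := sum_le_hasSum R (fun _ _ => by positivity) (hasSum_geometric_two' (1 : ℝ))
  refine le_trans (le_of_eq (Finset.sum_congr rfl fun k _ => ?_)) h
  rw [pow_succ, div_pow, one_pow]; ring

/-- Upper estimate of a block sequence by a sequence of unit vectors. -/
theorem tnorm_sum_le (hB : IsBlocked v l) (N : ℕ → ℕ) {C : ℝ} (hv : ∀ k, D.tnorm (v k) ≤ 1)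
    (hN : ∀ (n : ℕ+) (j k : ℕ), j < k → N k < n →
      D.θ n * (v j).support.card ≤ (1 / 2 : ℝ) ^ (j + 1))
    (hC : ∀ k E t, D.Splits (N k) (l k) (v k) E t → t ≤ C) (R : Finset ℕ) (b : ℕ → ℝ) :
    D.tnorm (∑ k ∈ R, b k • v k) ≤
      (C + 2) * D.tnorm (∑ k ∈ R, b k • Finsupp.single (l k) (1 : ℝ)) := by
  classical
  have hC0 : 0 ≤ C := hC 0 ∅ 0 (splits_zero _ _ _ _)
  set y : ℕ+ →₀ ℝ := ∑ k ∈ R, b k • Finsupp.single (l k) (1 : ℝ) with hy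
  set β := D.tnorm y with hβ
  have hβ0 : 0 ≤ β := D.tnorm_nonneg y
  have hbβ : ∀ k ∈ R, |b k| ≤ β := fun k hk => abs_le_tnorm_sum_smul_single hB.mono R b hk
  refine tnorm_le_of_forall_isNorming (by positivity) fun f hf hfs => ?_
  have hS : ∀ p ∈ f.support, ∃ k, p ∈ (v k).support := by
    intro p hp
    have := Finsupp.support_finsetSum (hfs hp)
    obtain ⟨k, -, hk⟩ := Finset.mem_biUnion.1 this
    exact ⟨k, Finsupp.support_smul hk⟩
  -- The permitted loss $2^{-(k+1)}$ on block `k` is spread evenly over its support; outside the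
  -- blocks the value 1 is harmless. In the constant `C + 2`, one unit pays for this loss and the
  -- other for the block in which the functional starts.
  let δ : ℕ+ → ℝ := fun p => if ∃ k, p ∈ (v k).support then
    (1 / 2 : ℝ) ^ (blockIndex v p + 1) / (v (blockIndex v p)).support.card else 1
  have hδv : ∀ k, ∀ p ∈ (v k).support, δ p = (1 / 2 : ℝ) ^ (k + 1) / (v k).support.card := by
    intro k p hp
    have h1 : ∃ k, p ∈ (v k).support := ⟨k, hp⟩
    simp only [δ, if_pos h1]
    rw [hB.eq (mem_blockIndex h1) hp]
  have hδ0 : ∀ p, 0 ≤ δ p := fun p => by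
    simp only [δ]; split_ifs <;> positivity
  have hδ : ∀ n p, ¬ OrderBound l N n p → D.θ n ≤ δ p := by
    intro n p hn
    simp only [OrderBound, not_forall, not_le] at hn
    obtain ⟨k, hpk, hk⟩ := hn
    by_cases hp : ∃ j, p ∈ (v j).support
    · obtain ⟨j, hj⟩ := hp
      have hjk : j < k := by
        by_contra! hkj
        exact absurd (hpk.trans_le (hB.mono.monotone hkj)) (not_lt.2 (hB.le j p hj))
      rw [hδv j p hj, le_div_iff₀ (by exact_mod_cast Finset.card_pos.2 ⟨p, hj⟩)]
      exact hN n j k hjk hk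
    · simp only [δ, if_neg hp]
      exact (D.θ_lt_one n).le
  obtain ⟨f', hf', hle, hge⟩ := exists_prune OrderBound.mono hδ0 hδ hf
  have hpair : ∀ k, absPairing (v k) f ≤ absPairing (v k) f' + (1 / 2 : ℝ) ^ (k + 1) := by
    intro k
    rw [absPairing_eq_sum_support, absPairing_eq_sum_support]
    have h1 : ∀ p ∈ (v k).support, f p * |v k p| ≤
        f' p * |v k p| + (1 / 2 : ℝ) ^ (k + 1) / (v k).support.card := by
      intro p hp
      have h2 : |v k p| ≤ 1 := (abs_apply_le_tnorm (v k) p).trans (hv k)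
      have h3 := mul_le_mul_of_nonneg_right (hge p) (abs_nonneg (v k p))
      have h4 := mul_le_of_le_one_right (hδ0 p) h2
      rw [hδv k p hp] at h4 h3
      rw [add_mul] at h3
      linarith
    refine (Finset.sum_le_sum h1).trans ?_
    rw [Finset.sum_add_distrib, Finset.sum_const, nsmul_eq_mul]
    refine add_le_add_right ?_ _
    rcases Nat.eq_zero_or_pos (v k).support.card with h | h
    · rw [h]; simp only [Nat.cast_zero, zero_mul]; positivity
    · rw [mul_div_cancel₀]; exact_mod_cast h.ne'
  have hmain : ∑ k ∈ R, |b k| * absPairing (v k) f' ≤ (C + 1) * β := by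
    rcases hf' with h0 | hf'
    · simp only [h0, map_zero, mul_zero, Finset.sum_const_zero]; positivity
    · have hsub : f'.support ⊆ f.support := fun p hp => by
        rw [Finsupp.mem_support_iff] at hp ⊢
        exact ((lt_of_le_of_ne (hf'.nonneg p) hp.symm).trans_le (hle p)).ne'
      -- The coefficients are set to zero off `R` because the block in which `f'` starts need not
      -- belong to `R`.
      obtain ⟨g, hg, t, ht, hle⟩ := exists_transfer hB N hf' (fun p hp => hS p (hsub hp)) R
        (fun k => if k ∈ R then |b k| else 0) (fun k => by
          split_ifs
          exacts [abs_nonneg _, le_rfl])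
      have e1 : ∑ k ∈ R, |b k| * absPairing (v k) f' =
          ∑ k ∈ R, (if k ∈ R then |b k| else 0) * absPairing (v k) f' :=
        Finset.sum_congr rfl fun k hk => by rw [if_pos hk]
      rw [e1]
      refine hle.trans ?_
      rw [add_mul, one_mul]
      refine add_le_add ?_ ?_
      · have h1 : ∀ k ∈ R, (if blockIndex v (minElt f'.support) < k then
            (if k ∈ R then |b k| else 0) * (t k * g (l k)) else 0) ≤ C * (|b k| * g (l k)) := by
          intro k hk
          have h2 : t k * g (l k) ≤ C * g (l k) :=
            mul_le_mul_of_nonneg_right (hC k _ _ (ht k)) (hg.nonneg _)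
          have h3 := mul_le_mul_of_nonneg_left h2 (abs_nonneg (b k))
          have h4 : 0 ≤ C * (|b k| * g (l k)) :=
            mul_nonneg hC0 (mul_nonneg (abs_nonneg _) (hg.nonneg _))
          rw [if_pos hk]
          split_ifs
          · linarith
          · exact h4
        refine (Finset.sum_le_sum h1).trans ?_
        rw [← Finset.mul_sum, ← absPairing_sum_smul_single hB.mono]
        exact mul_le_mul_of_nonneg_left (hg.pairing_le y) hC0
      · split_ifs with h
        · refine (mul_le_of_le_one_right (abs_nonneg _) ?_).trans (hbβ _ h)
          exact (hf'.pairing_le _).trans (hv _)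
        · rw [zero_mul]; exact hβ0
  have hsum : absPairing (∑ k ∈ R, b k • v k) f ≤ ∑ k ∈ R, |b k| * absPairing (v k) f := by
    refine (absPairing_sum_le R _ hf.nonneg).trans_eq ?_
    exact Finset.sum_congr rfl fun k _ => absPairing_smul _ _ _
  have herr : ∑ k ∈ R, |b k| * (1 / 2 : ℝ) ^ (k + 1) ≤ β := by
    calc ∑ k ∈ R, |b k| * (1 / 2 : ℝ) ^ (k + 1) ≤ ∑ k ∈ R, β * (1 / 2 : ℝ) ^ (k + 1) :=
          Finset.sum_le_sum fun k hk => mul_le_mul_of_nonneg_right (hbβ k hk) (by positivity)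
      _ ≤ β := by
          rw [← Finset.mul_sum]
          exact mul_le_of_le_one_right hβ0 (sum_pow_succ_half_le R)
  calc absPairing (∑ k ∈ R, b k • v k) f ≤ ∑ k ∈ R, |b k| * absPairing (v k) f := hsum
    _ ≤ ∑ k ∈ R, (|b k| * absPairing (v k) f' + |b k| * (1 / 2 : ℝ) ^ (k + 1)) :=
        Finset.sum_le_sum fun k _ => by
          rw [← mul_add]; exact mul_le_mul_of_nonneg_left (hpair k) (abs_nonneg _)
    _ ≤ (C + 2) * β := by
        rw [Finset.sum_add_distrib]; linarith

/-! ### Lower estimates for block sequences -/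

theorem sum_smul_apply (hB : IsBlocked v l) (b : ℕ → ℝ) (R : Finset ℕ) {k : ℕ} {p : ℕ+}
    (hp : p ∈ (v k).support) :
    (∑ j ∈ R, b j • v j) p = if k ∈ R then b k * v k p else 0 := by
  have hz : ∀ j, j ≠ k → v j p = 0 := fun j hj =>
    Finsupp.notMem_support_iff.1 fun h => hj (hB.eq h hp)
  rw [Finsupp.finsetSum_apply]
  split_ifs with hk
  · rw [Finset.sum_eq_single_of_mem k hk fun j _ hj => by simp [hz j hj]]
    simp
  · exact Finset.sum_eq_zero fun j hj => by simp [hz j (fun h => hk (h ▸ hj))]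

theorem sum_smul_apply_eq_zero (b : ℕ → ℝ) (R : Finset ℕ) {p : ℕ+}
    (hp : ∀ k ∈ R, p ∉ (v k).support) : (∑ j ∈ R, b j • v j) p = 0 := by
  rw [Finsupp.finsetSum_apply]
  exact Finset.sum_eq_zero fun j hj => by simp [Finsupp.notMem_support_iff.1 (hp j hj)]

theorem tnorm_sum_mono (hB : IsBlocked v l) (b : ℕ → ℝ) {R R' : Finset ℕ} (h : R ⊆ R') :
    D.tnorm (∑ j ∈ R, b j • v j) ≤ D.tnorm (∑ j ∈ R', b j • v j) := by
  refine tnorm_mono fun p => ?_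
  by_cases hp : ∃ k ∈ R, p ∈ (v k).support
  · obtain ⟨k, hk, hp⟩ := hp
    rw [sum_smul_apply hB b R hp, sum_smul_apply hB b R' hp, if_pos hk, if_pos (h hk)]
  · push Not at hp
    rw [sum_smul_apply_eq_zero b R hp, abs_zero]; exact abs_nonneg _

/-- In the tree of `f` each leaf at `l k` is replaced by the support of `v k`. Since `l k` precedes
that support, minima move right and admissibility is kept; order and disjointness of the sets pass
from the `l k` to the blocks. -/
theorem IsNorming.mul_absPairing_le (hB : IsBlocked v l) {ε : ℝ} (hε : 0 < ε)
    (hv : ∀ k, ε ≤ D.tnorm (v k)) (R : Finset ℕ) (b : ℕ → ℝ) {f : ℕ+ →₀ ℝ}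
    (hf : D.IsNorming (fun _ _ => True) f) : (∀ p ∈ f.support, ∃ k ∈ R, p = l k) →
    ε * absPairing (∑ k ∈ R, b k • Finsupp.single (l k) (1 : ℝ)) f ≤
      D.tnorm (∑ k ∈ R with l k ∈ f.support, b k • v k) := by
  classical
  induction hf with
  | single p =>
    intro hS
    obtain ⟨k, hk, rfl⟩ := hS p (by simp)
    have h1 : (R.filter fun j => l j ∈ (Finsupp.single (l k) (1 : ℝ)).support) = {k} := by
      ext j
      simp only [Finset.mem_filter, Finsupp.support_single _ (one_ne_zero (α := ℝ)),
        Finset.mem_singleton, hB.mono.injective.eq_iff]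
      exact ⟨fun h => h.2, fun h => ⟨h ▸ hk, h⟩⟩
    rw [h1, Finset.sum_singleton, D.tnorm_smul, absPairing_single,
      sum_smul_single_apply hB.mono R b hk, mul_comm]
    exact mul_le_mul_of_nonneg_left (hv k) (abs_nonneg _)
  | @node ι _ _ n g hg _ hsep hmin ih =>
    intro hS
    have hsub : ∀ i, ∀ p ∈ (g i).support, p ∈ (D.θ n • ∑ i, g i).support := fun i p hp =>
      (mem_support_node hsep).2 ⟨i, hp⟩
    have hSi : ∀ i, ∀ p ∈ (g i).support, ∃ k ∈ R, p = l k := fun i p hp => hS p (hsub i p hp)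
    let E : ι → Finset ℕ+ := fun i =>
      (R.filter fun k => l k ∈ (g i).support).biUnion fun k => (v k).support
    have hE : ∀ {i p}, p ∈ E i ↔ ∃ k ∈ R, l k ∈ (g i).support ∧ p ∈ (v k).support := by
      intro i p
      simp only [E, Finset.mem_biUnion, Finset.mem_filter, and_assoc]
    have hne : ∀ i, (E i).Nonempty := by
      intro i
      obtain ⟨p, hp⟩ := (hg i).support_nonempty
      obtain ⟨k, hk, rfl⟩ := hSi i p hp
      have h0 : v k ≠ 0 := by
        intro h0
        have h1 := hv k
        have h2 := D.tnorm_smul 0 (v k)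
        rw [h0, smul_zero, abs_zero, zero_mul] at h2
        rw [h0, h2] at h1
        linarith
      obtain ⟨p, hp'⟩ := Finsupp.support_nonempty_iff.2 h0
      exact ⟨p, hE.2 ⟨k, hk, hp, hp'⟩⟩
    have hlow : ∀ i, minElt (g i).support ≤ minElt (E i) := by
      intro i
      obtain ⟨k, hk, hkg, hp⟩ := hE.1 (minElt_mem (hne i))
      exact (minElt_le hkg).trans (hB.le k _ hp)
    have hsepE : Pairwise fun i j => (D.σ n).Sep (E i) (E j) := by
      intro i j hij
      have h := hsep hij
      generalize D.σ n = s at h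
      cases s with
      | M =>
        refine Finset.disjoint_left.2 fun p hp hp' => ?_
        obtain ⟨k, hk, hkg, hp⟩ := hE.1 hp
        obtain ⟨k', hk', hkg', hp'⟩ := hE.1 hp'
        rw [hB.eq hp hp'] at hkg
        exact Finset.disjoint_left.1 h hkg hkg'
      | U =>
        refine h.imp (fun h p hp p' hp' => ?_) (fun h p hp p' hp' => ?_)
        all_goals
          obtain ⟨k, hk, hkg, hp⟩ := hE.1 hp
          obtain ⟨k', hk', hkg', hp'⟩ := hE.1 hp'
          have hkk := hB.mono.lt_iff_lt.1 (h _ hkg _ hkg')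
        · exact hB.lt_of_lt hkk hp hp'
        · exact hB.lt_of_lt hkk hp' hp
    have hminE : (Finset.univ.image fun i => minElt (E i)) ∈ schreier n :=
      schreier_image_of_injOn _ (fun i => minElt (g i).support) hmin
        (minElt_injective (fun i => (hg i).support_nonempty) hsep).injOn
        fun i hi => ⟨Finset.mem_image_of_mem _ hi, hlow i⟩
    refine le_trans ?_ (theta_mul_sum_le_tnorm n E hne hsepE hminE _)
    rw [map_smul, map_sum, smul_eq_mul, mul_left_comm, Finset.mul_sum]
    refine mul_le_mul_of_nonneg_left (Finset.sum_le_sum fun i _ => ?_) (D.θ_pos n).le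
    refine (ih i (hSi i)).trans (tnorm_mono fun p => ?_)
    by_cases hp : p ∈ E i
    · rw [restrictTo_apply_of_mem _ hp]
      obtain ⟨k, hk, hkg, hp⟩ := hE.1 hp
      rw [sum_smul_apply hB b _ hp, sum_smul_apply hB b _ hp,
        if_pos (Finset.mem_filter.2 ⟨hk, hkg⟩), if_pos (Finset.mem_filter.2 ⟨hk, hsub i _ hkg⟩)]
    · rw [sum_smul_apply_eq_zero, abs_zero]
      · exact abs_nonneg _
      · intro k hk hpk
        rw [Finset.mem_filter] at hk
        exact hp (hE.2 ⟨k, hk.1, hk.2, hpk⟩)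

/-- Lower estimate of a block sequence by a sequence of unit vectors. -/
theorem mul_tnorm_le_tnorm_sum (hB : IsBlocked v l) {ε : ℝ} (hε : 0 < ε)
    (hv : ∀ k, ε ≤ D.tnorm (v k)) (R : Finset ℕ) (b : ℕ → ℝ) :
    ε * D.tnorm (∑ k ∈ R, b k • Finsupp.single (l k) (1 : ℝ)) ≤
      D.tnorm (∑ k ∈ R, b k • v k) := by
  rw [mul_comm, ← le_div_iff₀ hε]
  refine tnorm_le_of_forall_isNorming (div_nonneg (D.tnorm_nonneg _) hε.le) fun f hf hfs => ?_
  rw [le_div_iff₀ hε, mul_comm]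
  refine (hf.mul_absPairing_le hB hε hv R b fun p hp => ?_).trans
    (tnorm_sum_mono hB b (Finset.filter_subset _ _))
  obtain ⟨k, hk, rfl⟩ := Finset.mem_image.1 (support_sum_smul_single R b (hfs hp))
  exact ⟨k, hk, rfl⟩

/-! ### Averages with small weights on Schreier sets -/

/-- A finite weighted family of vectors with hulls `[lo, hi]`. -/
structure WeightedFamily where
  ι : Type
  [fin : Fintype ι]
  a : ι → ℝ
  x : ι → ℕ+ →₀ ℝ
  lo : ι → ℕ+
  hi : ι → ℕ+

attribute [instance] WeightedFamily.fin

namespace WeightedFamily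

/-- The weighted sum. -/
def vec (F : WeightedFamily) : ℕ+ →₀ ℝ := ∑ i, F.a i • F.x i

/-- The total weight. -/
def mass (F : WeightedFamily) : ℝ := ∑ i, F.a i

/-- The total weight of the members whose hulls meet `G`. -/
def hit (F : WeightedFamily) (G : Finset ℕ+) : ℝ :=
  open Classical in ∑ i, if ∃ q ∈ G, F.lo i ≤ q ∧ q ≤ F.hi i then F.a i else 0

end WeightedFamily

variable (D) in
/-- The weights are nonnegative, the vectors lie in the unit ball and are supported in their hulls,
which lie beyond `M`. -/
structure IsProper (F : WeightedFamily) (M : ℕ+) : Prop where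
  nonneg : ∀ i, 0 ≤ F.a i
  norm_le : ∀ i, D.tnorm (F.x i) ≤ 1
  hull : ∀ i, ∀ p ∈ (F.x i).support, F.lo i ≤ p ∧ p ≤ F.hi i
  lo_gt : ∀ i, M < F.lo i

theorem tnorm_zero : D.tnorm 0 = 0 := by
  have := D.tnorm_smul 0 0
  simpa using this

theorem tnorm_sum_le_sum {ι : Type*} (s : Finset ι) (x : ι → ℕ+ →₀ ℝ) :
    D.tnorm (∑ i ∈ s, x i) ≤ ∑ i ∈ s, D.tnorm (x i) :=
  Finset.le_sum_of_subadditive D.tnorm tnorm_zero.le D.tnorm_add_le _ _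

theorem IsProper.tnorm_vec_le {F : WeightedFamily} {M : ℕ+} (hF : D.IsProper F M) :
    D.tnorm F.vec ≤ F.mass := by
  refine (tnorm_sum_le_sum _ _).trans (Finset.sum_le_sum fun i _ => ?_)
  rw [D.tnorm_smul, abs_of_nonneg (hF.nonneg i)]
  exact mul_le_of_le_one_right (hF.nonneg i) (hF.norm_le i)

theorem IsProper.lt_of_mem {F : WeightedFamily} {M : ℕ+} (hF : D.IsProper F M) {p : ℕ+}
    (hp : p ∈ F.vec.support) : M < p := by
  classical
  obtain ⟨i, -, hi⟩ := Finset.mem_biUnion.1 (Finsupp.support_finsetSum hp)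
  exact (hF.lo_gt i).trans_le (hF.hull i p (Finsupp.support_smul hi)).1

/-- For each member the groups are divided according to whether one of their minima lies in the
member's hull. Groups without such a minimum contribute boundedly to each member. A group with one
contributes at most `Θ`, but only to members of total weight `ε`, and there are at most `l` groups.
-/
theorem exists_splits_le : ∃ C : ℝ, 0 ≤ C ∧ ∀ {F : WeightedFamily} {M l : ℕ+} {N : ℕ} {Θ ε : ℝ},
    D.IsProper F M → (∀ n : ℕ+, (n : ℕ) ≤ N → 1 ≤ D.θ n * Θ) → 0 ≤ Θ → 0 ≤ ε →
    (∀ n ≤ N, ∀ G ∈ schreier n, F.hit G ≤ ε) →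
    ∀ E t, D.Splits N l F.vec E t → t ≤ C * F.mass + (l : ℕ) * (Θ * ε) := by
  classical
  obtain ⟨p, hp⟩ := D.exists_modified_sum_le
  refine ⟨(D.θ p)⁻¹, (inv_pos.2 (D.θ_pos p)).le, ?_⟩
  rintro F M l N Θ ε hF hΘ hΘ0 hε hhit E t ⟨κ, _, ι, _, n, g, hN, hg, -, hsep, hmin, hl, hdis, rfl⟩
  have hq : ∀ j i, minElt (g j i).support ∈ (g j i).support := fun j i =>
    minElt_mem (hg j i).support_nonempty
  let H : κ → F.ι → Prop := fun j m =>
    ∃ q ∈ Finset.univ.image fun i => minElt (g j i).support, F.lo m ≤ q ∧ q ≤ F.hi m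
  have hnn : ∀ m j i, 0 ≤ absPairing (F.x m) (g j i) := fun m j i =>
    absPairing_nonneg _ (hg j i).nonneg
  -- Every group contains a functional starting before `l`, and by disjointness these starting
  -- points differ.
  have hcard : (Fintype.card κ : ℝ) ≤ (l : ℕ) := by
    choose i hi using hl
    have : (Finset.univ : Finset κ).card ≤ (Finset.range (l : ℕ)).card := by
      refine Finset.card_le_card_of_injOn (fun j => (minElt (g j (i j)).support : ℕ))
        (fun j _ => by simpa using hi j) fun j _ j' _ hjj => ?_
      by_contra hne
      refine Finset.disjoint_left.1 (hdis j j' (i j) (i j') hne) (hq j (i j)) ?_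
      rw [PNat.coe_inj.1 hjj]
      exact hq j' (i j')
    rw [Finset.card_range] at this
    exact_mod_cast this
  have hbad : ∀ m j, ∑ i, absPairing (F.x m) (g j i) ≤ Θ := by
    intro m j
    have : Nonempty (ι j) := ⟨(hl j).choose⟩
    have h1 := (IsNorming.node (ok := fun _ _ => True) (n j) (g j) (hg j) (fun _ => trivial)
      (hsep j) (hmin j)).pairing_le (F.x m)
    rw [map_smul, map_sum, smul_eq_mul] at h1
    have h2 := (h1.trans (hF.norm_le m)).trans (hΘ (n j) (hN j))
    exact le_of_mul_le_mul_left h2 (D.θ_pos _)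
  -- With no minimum in the hull, a functional acting on the member starts before its left end.
  -- There are at most `F.lo m` such disjoint functionals, and the modified index sums them across
  -- all groups at once.
  have hgood : ∀ m, ∑ j with ¬ H j m, ∑ i, absPairing (F.x m) (g j i) ≤ (D.θ p)⁻¹ := by
    intro m
    let s : Finset (Σ j, ι j) := Finset.univ.filter fun a =>
      ¬ H a.1 m ∧ absPairing (F.x m) (g a.1 a.2) ≠ 0
    have hlt : ∀ a ∈ s, minElt (g a.1 a.2).support < F.lo m := by
      intro a ha
      obtain ⟨-, h1, h2⟩ := Finset.mem_filter.1 ha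
      by_contra! hge
      refine h2 (absPairing_eq_zero (Finset.disjoint_left.2 fun x hx hx' => h1 ?_))
      exact ⟨_, Finset.mem_image_of_mem _ (Finset.mem_univ a.2), hge,
        (minElt_le hx).trans (hF.hull m x hx').2⟩
    have hdisj : ∀ a ∈ s, ∀ b ∈ s, a ≠ b →
        Disjoint (g a.1 a.2).support (g b.1 b.2).support := by
      rintro ⟨j, i⟩ - ⟨j', i'⟩ - hab
      by_cases hjj : j = j'
      · subst hjj
        exact (hsep j fun h => hab (congrArg (Sigma.mk j) h)).disjoint
      · exact hdis j j' i i' hjj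
    have hscard : s.card ≤ (F.lo m : ℕ) := by
      have : s.card ≤ (Finset.range (F.lo m : ℕ)).card := by
        refine Finset.card_le_card_of_injOn (fun a => (minElt (g a.1 a.2).support : ℕ))
          (fun a ha => by simpa using hlt a ha) fun a ha b hb hab => ?_
        by_contra hne
        refine Finset.disjoint_left.1 (hdisj a ha b hb hne) (hq a.1 a.2) ?_
        rw [PNat.coe_inj.1 hab]
        exact hq b.1 b.2
      rwa [Finset.card_range] at this
    have key := (hp s (fun a => g a.1 a.2) (F.x m) (fun a _ => hg a.1 a.2) hdisj
      fun q hq => hscard.trans (PNat.coe_le_coe _ _ |>.2 (hF.hull m q hq).1)).trans (hF.norm_le m)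
    have hsum : ∑ j with ¬ H j m, ∑ i, absPairing (F.x m) (g j i) =
        ∑ a ∈ s, absPairing (F.x m) (g a.1 a.2) := by
      rw [Finset.sum_filter, Finset.sum_filter, Fintype.sum_sigma]
      refine Finset.sum_congr rfl fun j _ => ?_
      by_cases h : H j m
      · rw [if_neg (not_not.2 h)]
        exact (Finset.sum_eq_zero fun i _ => if_neg fun h' => h'.1 h).symm
      · rw [if_pos h]
        refine Finset.sum_congr rfl fun i _ => ?_
        by_cases h0 : absPairing (F.x m) (g j i) = 0
        · rw [if_neg fun h' => h'.2 h0, h0]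
        · rw [if_pos ⟨h, h0⟩]
    rw [hsum, ← one_div, le_div_iff₀ (D.θ_pos p), mul_comm]
    exact key
  have hm : ∀ m, ∑ j, ∑ i, absPairing (F.x m) (g j i) ≤
      (D.θ p)⁻¹ + ∑ j, if H j m then Θ else 0 := by
    intro m
    rw [← Finset.sum_filter_not_add_sum_filter Finset.univ fun j => H j m, ← Finset.sum_filter]
    exact add_le_add (hgood m) (Finset.sum_le_sum fun j _ => hbad m j)
  calc ∑ j, ∑ i, absPairing F.vec (g j i)
      ≤ ∑ j, ∑ i, ∑ m, F.a m * absPairing (F.x m) (g j i) := by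
        refine Finset.sum_le_sum fun j _ => Finset.sum_le_sum fun i _ => ?_
        refine (absPairing_sum_le _ _ (hg j i).nonneg).trans_eq ?_
        exact Finset.sum_congr rfl fun m _ => by
          rw [absPairing_smul, abs_of_nonneg (hF.nonneg m)]
    _ = ∑ m, F.a m * ∑ j, ∑ i, absPairing (F.x m) (g j i) := by
        simp_rw [Finset.mul_sum]
        exact ((Finset.sum_congr rfl fun j _ => Finset.sum_comm).trans Finset.sum_comm)
    _ ≤ ∑ m, F.a m * ((D.θ p)⁻¹ + ∑ j, if H j m then Θ else 0) :=
        Finset.sum_le_sum fun m _ => mul_le_mul_of_nonneg_left (hm m) (hF.nonneg m)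
    _ = (D.θ p)⁻¹ * F.mass + Θ * ∑ j, F.hit (Finset.univ.image fun i =>
          minElt (g j i).support) := by
        simp_rw [mul_add, Finset.sum_add_distrib, ← Finset.sum_mul]
        rw [mul_comm, WeightedFamily.mass]
        congr 1
        simp_rw [Finset.mul_sum]
        rw [Finset.sum_comm]
        refine Finset.sum_congr rfl fun j _ => ?_
        rw [WeightedFamily.hit, Finset.mul_sum]
        refine Finset.sum_congr rfl fun m _ => ?_
        by_cases h : H j m
        · rw [if_pos h, if_pos h, mul_comm]
        · rw [if_neg h, if_neg h, mul_zero, mul_zero]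
    _ ≤ (D.θ p)⁻¹ * F.mass + Θ * ∑ _j : κ, ε := by
        gcongr with j
        exact hhit _ (hN j) _ (hmin j)
    _ ≤ (D.θ p)⁻¹ * F.mass + (l : ℕ) * (Θ * ε) := by
        rw [Finset.sum_const, Finset.card_univ, nsmul_eq_mul]
        have := mul_le_mul_of_nonneg_right hcard (mul_nonneg hΘ0 hε)
        linarith

end TsirelsonData

/-! ### Linear combinations of the members of a list -/

section Combinations

variable {B : Type*} [AddCommMonoid B] [Module ℝ B]

/-- `y` is a linear combination of the members of the list with coefficients of total mass `c`. -/
inductive IsCombination : List B → ℝ → B → Prop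
  | nil : IsCombination [] 0 0
  | cons (b : ℝ) (x : B) {t : List B} {c : ℝ} {y : B} (h : IsCombination t c y) :
      IsCombination (x :: t) (|b| + c) (b • x + y)

theorem IsCombination.append {s t : List B} {c d : ℝ} {x y : B} (hs : IsCombination s c x)
    (ht : IsCombination t d y) : IsCombination (s ++ t) (c + d) (x + y) := by
  induction hs with
  | nil => simpa using ht
  | cons b x h ih => simpa only [List.cons_append, add_assoc] using ih.cons b x

theorem IsCombination.smul (a : ℝ) {s : List B} {c : ℝ} {x : B} (hs : IsCombination s c x) :
    IsCombination s (|a| * c) (a • x) := by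
  induction hs with
  | nil => simpa using IsCombination.nil
  | cons b x h ih =>
    have := ih.cons (a * b) x
    rwa [abs_mul, ← mul_add, mul_smul, ← smul_add] at this

theorem isCombination_zero : ∀ s : List B, IsCombination s 0 0
  | [] => .nil
  | x :: s => by simpa using (isCombination_zero s).cons 0 x

theorem isCombination_sum : ∀ (s : List B) (a : Fin s.length → ℝ),
    IsCombination s (∑ i, |a i|) (∑ i, a i • s.get i)
  | [], a => by simpa using IsCombination.nil
  | x :: s, a => by
    have h := (isCombination_sum s fun i => a i.succ).cons (a 0) x
    rw [show (∑ i, |a i|) = |a 0| + ∑ i : Fin s.length, |a i.succ| from Fin.sum_univ_succ _,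
      show (∑ i, a i • (x :: s).get i) = a 0 • x + ∑ i : Fin s.length, a i.succ • s.get i from
        Fin.sum_univ_succ _]
    exact h

theorem IsCombination.exists_fin {s : List B} {c : ℝ} {x : B} (hs : IsCombination s c x) :
    ∃ a : Fin s.length → ℝ, ∑ i, |a i| = c ∧ ∑ i, a i • s.get i = x := by
  induction hs with
  | nil => exact ⟨fun i => i.elim0, by simp, by simp⟩
  | @cons b x t c y h ih =>
    obtain ⟨a, ha, hx⟩ := ih
    refine ⟨(Fin.cons b a : Fin (t.length + 1) → ℝ), ?_, ?_⟩
    · rw [← ha]; exact (Fin.sum_univ_succ _).trans (by simp)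
    · rw [← hx]; exact (Fin.sum_univ_succ _).trans (by simp)

theorem IsCombination.exists_of_map {B' : Type*} [AddCommMonoid B'] [Module ℝ B'] (f : B →ₗ[ℝ] B')
    {s : List B} {c : ℝ} {y : B'} (h : IsCombination (s.map f) c y) :
    ∃ x, IsCombination s c x ∧ f x = y := by
  induction s generalizing c y with
  | nil => cases h; exact ⟨0, .nil, map_zero f⟩
  | cons x s ih =>
    cases h with
    | cons b _ h =>
      obtain ⟨z, hz, rfl⟩ := ih h
      exact ⟨b • x + z, hz.cons b x, by rw [map_add, map_smul]⟩

theorem IsCombination.map {B' : Type*} [AddCommMonoid B'] [Module ℝ B'] (f : B →ₗ[ℝ] B')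
    {s : List B} {c : ℝ} {y : B} (h : IsCombination s c y) : IsCombination (s.map f) c (f y) := by
  induction h with
  | nil => rw [map_zero]; exact .nil
  | cons b x h ih => rw [map_add, map_smul]; exact ih.cons b _

theorem IsCombination.nonneg {s : List B} {c : ℝ} {y : B} (h : IsCombination s c y) : 0 ≤ c := by
  induction h with
  | nil => exact le_rfl
  | cons b x h ih => positivity

end Combinations

/-! ### Derived trees -/

section DerivedTrees

universe u

variable {B : Type u} {T : Set (List B)}

theorem iterDerivedTree_zero : iterDerivedTree T 0 = T := Ordinal.limitRecOn_zero _ _ _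

theorem iterDerivedTree_add_one (α : Ordinal.{u}) :
    iterDerivedTree T (α + 1) = derivedTree (iterDerivedTree T α) :=
  Ordinal.limitRecOn_add_one _ _ _ _

theorem iterDerivedTree_limit {α : Ordinal.{u}} (h : Order.IsSuccLimit α) :
    iterDerivedTree T α = ⋂ (β) (_ : β < α), iterDerivedTree T β :=
  Ordinal.limitRecOn_limit _ _ _ _ h

/-- The second half is the rank recursion used everywhere below in place of the successor and limit
cases; it is proved together with monotonicity because each needs the other. -/
theorem mem_iterDerivedTree_aux (α : Ordinal.{u}) :
    (∀ β ≤ α, iterDerivedTree T α ⊆ iterDerivedTree T β) ∧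
    ∀ s, s ∈ iterDerivedTree T α ↔ s ∈ T ∧ ∀ β < α, ∃ x, s ++ [x] ∈ iterDerivedTree T β := by
  induction α using Ordinal.limitRecOn with
  | zero =>
    refine ⟨fun β hβ => ?_, fun s => ?_⟩
    · rw [le_zero_iff.1 hβ]
    · rw [iterDerivedTree_zero]; simp
  | add_one α ih =>
    have hsub : iterDerivedTree T (α + 1) ⊆ iterDerivedTree T α := by
      rw [iterDerivedTree_add_one]; exact fun s hs => hs.1
    refine ⟨fun β hβ => ?_, fun s => ⟨fun hs => ⟨?_, fun β hβ => ?_⟩, fun hs => ?_⟩⟩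
    · rcases hβ.eq_or_lt with rfl | h
      · exact subset_rfl
      · exact hsub.trans (ih.1 β (Order.lt_add_one_iff.1 h))
    · exact ((ih.2 s).1 (hsub hs)).1
    · rw [iterDerivedTree_add_one] at hs
      obtain ⟨-, x, hx⟩ := hs
      exact ⟨x, ih.1 β (Order.lt_add_one_iff.1 hβ) hx⟩
    · rw [iterDerivedTree_add_one]
      refine ⟨(ih.2 s).2 ⟨hs.1, fun β hβ => hs.2 β (hβ.trans (Order.lt_add_one_iff.2 le_rfl))⟩, ?_⟩
      exact hs.2 α (Order.lt_add_one_iff.2 le_rfl)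
  | limit α hα ih =>
    refine ⟨fun β hβ => ?_, fun s => ?_⟩
    · rcases hβ.eq_or_lt with rfl | h
      · exact subset_rfl
      · rw [iterDerivedTree_limit hα]
        exact Set.biInter_subset_of_mem (t := fun β => iterDerivedTree T β) h
    · rw [iterDerivedTree_limit hα]
      simp only [Set.mem_iInter]
      constructor
      · intro h
        refine ⟨?_, fun β hβ => ?_⟩
        · have := h 0 hα.bot_lt
          rwa [iterDerivedTree_zero] at this
        · have hβ1 : β + 1 < α := hα.succ_lt hβ
          exact ((ih _ hβ1).2 s |>.1 (h _ hβ1)).2 β (Order.lt_add_one_iff.2 le_rfl)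
      · exact fun h β hβ => ((ih β hβ).2 s).2 ⟨h.1, fun γ hγ => h.2 γ (hγ.trans hβ)⟩

theorem iterDerivedTree_anti {α β : Ordinal.{u}} (h : β ≤ α) :
    iterDerivedTree T α ⊆ iterDerivedTree T β := (mem_iterDerivedTree_aux α).1 β h

theorem mem_iterDerivedTree {α : Ordinal.{u}} {s : List B} :
    s ∈ iterDerivedTree T α ↔ s ∈ T ∧ ∀ β < α, ∃ x, s ++ [x] ∈ iterDerivedTree T β :=
  (mem_iterDerivedTree_aux α).2 s

theorem iterDerivedTree_subset (α : Ordinal.{u}) : iterDerivedTree T α ⊆ T := fun _ hs =>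
  (mem_iterDerivedTree.1 hs).1

/-- Ranks add up when a tree is climbed in stages. -/
theorem iterDerivedTree_iterDerivedTree_subset (α β : Ordinal.{u}) :
    iterDerivedTree (iterDerivedTree T β) α ⊆ iterDerivedTree T (β + α) := by
  induction α using WellFoundedLT.induction with
  | ind α ih =>
    intro s hs
    obtain ⟨h1, h2⟩ := mem_iterDerivedTree.1 hs
    refine mem_iterDerivedTree.2 ⟨iterDerivedTree_subset _ h1, fun γ hγ => ?_⟩
    rcases lt_or_ge γ β with hlt | hge
    · exact (mem_iterDerivedTree.1 h1).2 γ hlt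
    · obtain ⟨δ, rfl⟩ := exists_add_of_le hge
      have hδ : δ < α := lt_of_add_lt_add_left hγ
      obtain ⟨x, hx⟩ := h2 δ hδ
      exact ⟨x, ih δ hδ hx⟩

theorem IsSeqTree.mem_of_append (hT : IsSeqTree T) {s : List B} (hs : s ≠ []) :
    ∀ {t : List B}, s ++ t ∈ T → s ∈ T := by
  intro t
  induction t using List.reverseRecOn with
  | nil => simp
  | append_singleton t x ih =>
    intro h
    rw [← List.append_assoc] at h
    exact ih (hT.2 _ _ (by simp [hs]) h)

/-- A node surviving all derivations has an extension that survives them all, and iterating gives an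
infinite branch. -/
theorem IsSeqTree.exists_notMem_iterDerivedTree (hT : IsSeqTree T) (hw : IsWellFoundedTree T)
    (s : List B) : ∃ α : Ordinal.{u}, s ∉ iterDerivedTree T α := by
  by_contra! hs
  have hstep : ∀ s : {s : List B // ∀ α : Ordinal.{u}, s ∈ iterDerivedTree T α},
      ∃ x, ∀ α : Ordinal.{u}, s.1 ++ [x] ∈ iterDerivedTree T α := by
    rintro ⟨s, hs⟩
    by_contra! hcon
    choose α hα using hcon
    -- If every extension `x` dropped out at some stage `α x`, the node could not survive past the
    -- supremum of these stages.
    obtain ⟨x, hx⟩ := (mem_iterDerivedTree.1 (hs ((⨆ x, α x) + 1))).2 _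
      (Order.lt_add_one_iff.2 le_rfl)
    exact hα x (iterDerivedTree_anti (Ordinal.le_iSup α x) hx)
  choose next hnext using hstep
  obtain ⟨S, hS0, hS⟩ : ∃ S : ℕ → {s : List B // ∀ α : Ordinal.{u}, s ∈ iterDerivedTree T α},
      (S 0).1 = s ∧ ∀ n, (S (n + 1)).1 = (S n).1 ++ [next (S n)] :=
    ⟨fun n => Nat.rec ⟨s, hs⟩ (fun _ s => ⟨s.1 ++ [next s], hnext s⟩) n, rfl, fun _ => rfl⟩
  have hlen : ∀ n, (S n).1.length = s.length + n := by
    intro n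
    induction n with
    | zero => rw [hS0]; rfl
    | succ n ih => rw [hS]; simp [ih]; omega
  have hpre : ∀ {m n}, m ≤ n → (S m).1 <+: (S n).1 := by
    intro m n hmn
    induction hmn with
    | refl => exact List.prefix_rfl
    | step _ ih => exact ih.trans ⟨_, (hS _).symm⟩
  have hST : ∀ n, (S n).1 ∈ T := fun n => iterDerivedTree_subset _ ((S n).2 0)
  refine hw ⟨fun i => (S (i + 1)).1[i]'(by rw [hlen]; omega), fun m => ?_⟩
  have : (List.range (m + 1)).map (fun i => (S (i + 1)).1[i]'(by rw [hlen]; omega)) =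
      (S (m + 1)).1.take (m + 1) := by
    refine List.ext_getElem (by simp [hlen]) fun i h1 h2 => ?_
    simp only [List.getElem_map, List.getElem_range, List.getElem_take]
    simp only [List.length_map, List.length_range] at h1
    exact (hpre (show i + 1 ≤ m + 1 by omega)).getElem _
  rw [this]
  refine hT.mem_of_append (t := (S (m + 1)).1.drop (m + 1)) ?_ ?_
  · intro h0
    have := congrArg List.length h0
    simp [hlen] at this
  · rw [List.take_append_drop]; exact hST _

theorem IsSeqTree.lt_treeOrder (hT : IsSeqTree T) (hw : IsWellFoundedTree T) {α : Ordinal.{u}}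
    {s : List B} (hs : s ∈ iterDerivedTree T α) : α < treeOrder T := by
  choose a ha using hT.exists_notMem_iterDerivedTree hw
  -- Nonemptiness matters: otherwise the infimum defining `treeOrder` would be the default value
  -- zero.
  have hne : {α : Ordinal.{u} | iterDerivedTree T α = ∅}.Nonempty := by
    refine ⟨⨆ s, a s, Set.eq_empty_of_forall_notMem fun s hs => ?_⟩
    exact ha s (iterDerivedTree_anti (Ordinal.le_iSup a s) hs)
  by_contra! hle
  have h1 : iterDerivedTree T (treeOrder T) = ∅ := csInf_mem hne
  have h2 := iterDerivedTree_anti hle hs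
  rw [h1] at h2
  exact h2

variable [NormedAddCommGroup B] [NormedSpace ℝ B]

theorem lt_bourgainIndex {K : ℝ} (hK : 1 ≤ K) (hT : IsEllOneTree K T) (hw : IsWellFoundedTree T)
    {α : Ordinal.{u}} {s : List B} (hs : s ∈ iterDerivedTree T α) : α < bourgainIndex B := by
  refine (hT.1.lt_treeOrder hw hs).trans_le ?_
  refine le_trans ?_ (Ordinal.le_iSup (fun K : {K : ℝ // 1 ≤ K} => bourgainIndexWith B K.1) ⟨K, hK⟩)
  exact Ordinal.le_iSup
    (fun T : {T : Set (List B) // IsEllOneTree K T ∧ IsWellFoundedTree T} => treeOrder T.1)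
    ⟨T, hT, hw⟩

theorem exists_tree_of_lt_bourgainIndex {α : Ordinal.{u}} (h : α < bourgainIndex B) :
    ∃ K : ℝ, 1 ≤ K ∧ ∃ T : Set (List B), IsEllOneTree K T ∧ ∃ s, s ∈ iterDerivedTree T α := by
  obtain ⟨⟨K, hK⟩, h₁⟩ := Ordinal.lt_iSup_iff.1 h
  obtain ⟨⟨T, hT, _⟩, h₂⟩ := Ordinal.lt_iSup_iff.1 h₁
  refine ⟨K, hK, T, hT, ?_⟩
  by_contra! hcon
  have h1 : treeOrder T ≤ α := csInf_le' (Set.eq_empty_of_forall_notMem hcon)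
  exact absurd h1 (not_le.2 h₂)

theorem IsEllOneTree.le_norm {K : ℝ} (hT : IsEllOneTree K T) {s : List B} (hs : s ∈ T) {c : ℝ}
    {x : B} (hx : IsCombination s c x) : K⁻¹ * c ≤ ‖x‖ := by
  obtain ⟨a, rfl, rfl⟩ := hx.exists_fin
  exact (hT.2 s hs).2 a

end DerivedTrees

theorem IsCombination.norm_le {B : Type*} [NormedAddCommGroup B] [NormedSpace ℝ B] {s : List B}
    {c : ℝ} {y : B} (h : IsCombination s c y) (hs : ∀ x ∈ s, ‖x‖ = 1) : ‖y‖ ≤ c := by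
  induction h with
  | nil => simp
  | cons b x h ih =>
    refine (norm_add_le _ _).trans (add_le_add ?_ (ih fun z hz => hs z (by simp [hz])))
    rw [norm_smul, hs x (by simp), mul_one, Real.norm_eq_abs]

theorem exists_append_mem_iterDerivedTree {B : Type*} {T : Set (List B)} {γ : Ordinal} :
    ∀ (n : ℕ) {s : List B}, s ∈ iterDerivedTree T (γ + n) →
      ∃ t : List B, t.length = n ∧ s ++ t ∈ iterDerivedTree T γ
  | 0, s, hs => ⟨[], rfl, by simpa using hs⟩
  | n + 1, s, hs => by
    obtain ⟨x, hx⟩ := (mem_iterDerivedTree.1 hs).2 (γ + n) (by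
      rw [Nat.cast_add_one, ← add_assoc]; exact Order.lt_add_one_iff.2 le_rfl)
    obtain ⟨t, ht, hst⟩ := exists_append_mem_iterDerivedTree n hx
    exact ⟨x :: t, by simp [ht], by simpa using hst⟩

/-! ### Operations on weighted families -/

namespace TsirelsonData

namespace WeightedFamily

/-- The union of two weighted families. -/
def add (F F' : WeightedFamily) : WeightedFamily where
  ι := F.ι ⊕ F'.ι
  a := Sum.elim F.a F'.a
  x := Sum.elim F.x F'.x
  lo := Sum.elim F.lo F'.lo
  hi := Sum.elim F.hi F'.hi

/-- Multiplication of the weights by a constant. -/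
def scale (c : ℝ) (F : WeightedFamily) : WeightedFamily where
  ι := F.ι
  a := fun i => c * F.a i
  x := F.x
  lo := F.lo
  hi := F.hi

/-- The empty weighted family. -/
def empty : WeightedFamily := ⟨Empty, Empty.elim, Empty.elim, Empty.elim, Empty.elim⟩

/-- A weighted family with one member of weight one. -/
def single (x : ℕ+ →₀ ℝ) (lo hi : ℕ+) : WeightedFamily :=
  ⟨Unit, fun _ => 1, fun _ => x, fun _ => lo, fun _ => hi⟩

variable (F F' : WeightedFamily) (G : Finset ℕ+)

theorem vec_add : (F.add F').vec = F.vec + F'.vec := Fintype.sum_sum_type _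

theorem mass_add : (F.add F').mass = F.mass + F'.mass := Fintype.sum_sum_type _

theorem hit_add : (F.add F').hit G = F.hit G + F'.hit G := Fintype.sum_sum_type _

theorem vec_scale (c : ℝ) : (F.scale c).vec = c • F.vec := by
  rw [vec, vec, Finset.smul_sum]
  exact Finset.sum_congr rfl fun i _ => mul_smul _ _ _

theorem mass_scale (c : ℝ) : (F.scale c).mass = c * F.mass :=
  (Finset.mul_sum _ _ _).symm

theorem hit_scale (c : ℝ) : (F.scale c).hit G = c * F.hit G := by
  classical
  rw [hit, hit, Finset.mul_sum]
  refine Finset.sum_congr rfl fun i _ => ?_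
  rw [mul_ite, mul_zero]
  rfl

variable {F F' G}

theorem hit_union_le (hF : ∀ i, 0 ≤ F.a i) (A B : Finset ℕ+) :
    F.hit (A ∪ B) ≤ F.hit A + F.hit B := by
  classical
  simp only [hit, ← Finset.sum_add_distrib]
  refine Finset.sum_le_sum fun i _ => ?_
  have h0 := hF i
  by_cases h : ∃ q ∈ A ∪ B, F.lo i ≤ q ∧ q ≤ F.hi i
  · rw [if_pos h]
    obtain ⟨q, hq, hqi⟩ := h
    rcases Finset.mem_union.1 hq with hq | hq
    · rw [if_pos (c := ∃ q ∈ A, F.lo i ≤ q ∧ q ≤ F.hi i) ⟨q, hq, hqi⟩]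
      split_ifs <;> linarith
    · rw [if_pos (c := ∃ q ∈ B, F.lo i ≤ q ∧ q ≤ F.hi i) ⟨q, hq, hqi⟩]
      split_ifs <;> linarith
  · rw [if_neg h]
    split_ifs <;> linarith

theorem hit_le_mass (hF : ∀ i, 0 ≤ F.a i) : F.hit G ≤ F.mass := by
  classical
  refine Finset.sum_le_sum fun i _ => ?_
  split_ifs
  exacts [le_rfl, hF i]

theorem hit_eq_zero (h : ∀ i, ∀ q ∈ G, ¬ (F.lo i ≤ q ∧ q ≤ F.hi i)) : F.hit G = 0 := by
  classical
  refine Finset.sum_eq_zero fun i _ => if_neg ?_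
  rintro ⟨q, hq, hqi⟩
  exact h i q hq hqi

theorem hit_le_of_isSuccUnion (hF : ∀ i, 0 ≤ F.a i) {𝒢 : Set (Finset ℕ+)} {ε : ℝ}
    (h : ∀ G ∈ 𝒢, F.hit G ≤ ε) : ∀ {c : ℕ} {A : Finset ℕ+}, IsSuccUnion 𝒢 c A → F.hit A ≤ c * ε
  | 0, A, hA => by
    rw [show A = ∅ from hA, hit_eq_zero (by simp)]; simp
  | c + 1, A, ⟨B, A', hB, hA', _, hA⟩ => by
    rw [hA]
    have h1 := hit_le_of_isSuccUnion hF h hA'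
    have h2 := h B hB
    have h3 := hit_union_le hF B A'
    push_cast
    linarith

end WeightedFamily

variable {D : TsirelsonData}

variable (D) in
/-- The inclusion of `c₀₀` in the space. -/
def emb : (ℕ+ →₀ ℝ) →ₗ[ℝ] D.Space :=
  (UniformSpace.Completion.toComplₗᵢ (𝕜 := ℝ) (E := D.C00)).toLinearMap

theorem norm_emb (x : ℕ+ →₀ ℝ) : ‖D.emb x‖ = D.tnorm x :=
  UniformSpace.Completion.norm_coe (E := D.C00) x

theorem IsProper.add {F F' : WeightedFamily} {M : ℕ+} (hF : D.IsProper F M)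
    (hF' : D.IsProper F' M) : D.IsProper (F.add F') M where
  nonneg := Sum.rec hF.nonneg hF'.nonneg
  norm_le := Sum.rec hF.norm_le hF'.norm_le
  hull := Sum.rec hF.hull hF'.hull
  lo_gt := Sum.rec hF.lo_gt hF'.lo_gt

theorem IsProper.scale {F : WeightedFamily} {M : ℕ+} (hF : D.IsProper F M) {c : ℝ} (hc : 0 ≤ c) :
    D.IsProper (F.scale c) M :=
  ⟨fun i => mul_nonneg hc (hF.nonneg i), hF.norm_le, hF.hull, hF.lo_gt⟩

theorem IsProper.mono {F : WeightedFamily} {M M' : ℕ+} (hF : D.IsProper F M) (h : M' ≤ M) :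
    D.IsProper F M' :=
  ⟨hF.nonneg, hF.norm_le, hF.hull, fun i => h.trans_lt (hF.lo_gt i)⟩

theorem isProper_empty (M : ℕ+) : D.IsProper WeightedFamily.empty M :=
  ⟨fun i => i.elim, fun i => i.elim, fun i => i.elim, fun i => i.elim⟩

/-! ### Averages along the branches of a tree -/

section Averages

variable {B : Type} [NormedAddCommGroup B] [NormedSpace ℝ B] {J : B →ₗᵢ[ℝ] D.Space}
  {W : Submodule ℝ (ℕ+ →₀ ℝ)} {T : Set (List B)}

/-- Rank $\omega$ allows an extension by `M + 1` vectors; some nontrivial combination of their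
finitely supported approximations vanishes on the first `M` coordinates. -/
theorem exists_far_combination (hW : ∀ (y : B) (δ : ℝ), 0 < δ → ∃ w ∈ W, ‖J y - D.emb w‖ < δ)
    {γ : Ordinal} {s : List B} (hs : s ∈ iterDerivedTree T (γ + Ordinal.omega0)) (M : ℕ+)
    {δ : ℝ} (hδ : 0 < δ) : ∃ t, s ++ t ∈ iterDerivedTree T γ ∧ ∃ y, IsCombination t 1 y ∧
      ∃ u ∈ W, (∀ p ∈ u.support, M < p) ∧ ‖J y - D.emb u‖ ≤ δ := by
  classical
  have hs' := iterDerivedTree_anti (β := γ + ((M : ℕ) + 1 : ℕ))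
    (add_le_add_right (Ordinal.natCast_lt_omega0 _).le _) hs
  obtain ⟨t, ht, hst⟩ := exists_append_mem_iterDerivedTree _ hs'
  refine ⟨t, hst, ?_⟩
  choose w hwW hw using fun y => hW y δ hδ
  let φ : (Fin t.length → ℝ) →ₗ[ℝ] (Fin (M : ℕ) → ℝ) :=
    { toFun := fun b k => ∑ i, b i * w (t.get i) (Nat.succPNat k)
      map_add' := fun b b' => by
        ext k; simp [add_mul, Finset.sum_add_distrib]
      map_smul' := fun c b => by
        ext k; simp [Finset.mul_sum, mul_assoc] }
  obtain ⟨b, hb, hb0⟩ := (Submodule.ne_bot_iff _).1 (LinearMap.ker_ne_bot_of_finrank_lt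
    (f := φ) (by simp [ht]))
  have hφ : ∀ p : ℕ+, p ≤ M → ∑ i, b i * w (t.get i) p = 0 := by
    intro p hp
    have hp' : (p : ℕ) ≤ M := hp
    have h1 := congrFun (LinearMap.mem_ker.1 hb) ⟨p.natPred, by
      rw [PNat.natPred]; have := p.pos; omega⟩
    simpa [φ] using h1
  have hpos : 0 < ∑ i, |b i| := by
    obtain ⟨i, hi⟩ := Function.ne_iff.1 hb0
    exact Finset.sum_pos' (fun i _ => abs_nonneg _) ⟨i, Finset.mem_univ _, abs_pos.2 hi⟩
  set a : Fin t.length → ℝ := fun i => b i / ∑ j, |b j| with ha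
  have hasum : ∑ i, |a i| = 1 := by
    simp only [ha, abs_div, abs_of_pos hpos, ← Finset.sum_div]
    exact div_self hpos.ne'
  refine ⟨∑ i, a i • t.get i, hasum ▸ isCombination_sum t a, ∑ i, a i • w (t.get i),
    W.sum_mem fun i _ => W.smul_mem _ (hwW _), fun p hp => ?_, ?_⟩
  · by_contra! hle
    refine Finsupp.mem_support_iff.1 hp ?_
    rw [Finsupp.finsetSum_apply]
    simp only [Finsupp.smul_apply, smul_eq_mul, ha, div_mul_eq_mul_div]
    rw [← Finset.sum_div, hφ p hle, zero_div]
  · rw [map_sum, map_sum, ← Finset.sum_sub_distrib]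
    refine (norm_sum_le _ _).trans ?_
    have : ∀ i ∈ Finset.univ, ‖J (a i • t.get i) - D.emb (a i • w (t.get i))‖ ≤ |a i| * δ := by
      intro i _
      rw [map_smul, map_smul, ← smul_sub, norm_smul, Real.norm_eq_abs]
      exact mul_le_mul_of_nonneg_left (hw _).le (abs_nonneg _)
    refine (Finset.sum_le_sum this).trans ?_
    rw [← Finset.sum_mul, hasum, one_mul]

variable (J W T) in
/-- Nodes of rank `γ + ρ` have extensions of rank `γ` along which there are averages with small
weights on the members of `𝒢`. -/
def HasAverages (𝒢 : Set (Finset ℕ+)) (ρ : Ordinal) : Prop :=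
  ∀ (γ : Ordinal) (s : List B) (M : ℕ+) (ε δ : ℝ), 0 < ε → 0 < δ →
    s ∈ iterDerivedTree T (γ + ρ) → ∃ t, s ++ t ∈ iterDerivedTree T γ ∧
      ∃ y, IsCombination t 1 y ∧ ∃ F : WeightedFamily, D.IsProper F M ∧ F.mass = 1 ∧
        F.vec ∈ W ∧ ‖J y - D.emb F.vec‖ ≤ δ ∧ ∀ G ∈ 𝒢, F.hit G ≤ ε

theorem hasAverages_empty (hW : ∀ (y : B) (δ : ℝ), 0 < δ → ∃ w ∈ W, ‖J y - D.emb w‖ < δ)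
    (hT : ∀ s ∈ T, ∀ x ∈ s, ‖x‖ = 1) : HasAverages J W T {∅} Ordinal.omega0 := by
  classical
  intro γ s M ε δ hε hδ hs
  obtain ⟨t, hst, y, hy, u, huW, hu, hyu⟩ := exists_far_combination hW hs M (half_pos hδ)
  have hy1 : ‖y‖ ≤ 1 := hy.norm_le fun x hx =>
    hT _ (iterDerivedTree_subset _ hst) x (List.mem_append_right _ hx)
  have hu1 : D.tnorm u ≤ 1 + δ / 2 := by
    rw [← norm_emb]
    have := norm_sub_norm_le (D.emb u) (J y)
    rw [norm_sub_rev, J.norm_map] at this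
    linarith
  have hd : (0 : ℝ) < 1 + δ / 2 := by positivity
  -- The approximation `u` may slightly exceed norm one; the rescaling returns it to the unit ball
  -- at a cost of at most `δ / 2`.
  set x : ℕ+ →₀ ℝ := (1 + δ / 2)⁻¹ • u with hx
  have hsupp : x.support ⊆ u.support := Finsupp.support_smul
  obtain ⟨H, hH⟩ : ∃ H : ℕ+, ∀ p ∈ x.support, p ≤ H :=
    ⟨x.support.sup id, fun p hp => Finset.le_sup (f := id) hp⟩
  have hvec : (WeightedFamily.single x (M + 1) H).vec = x :=
    (Fintype.sum_unique (ι := Unit) _).trans (one_smul _ _)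
  refine ⟨t, hst, y, hy, WeightedFamily.single x (M + 1) H, ⟨fun _ => zero_le_one, fun _ => ?_,
    fun _ p hp => ⟨?_, hH p hp⟩, fun _ => PNat.lt_add_right _ _⟩, ?_, ?_, ?_, ?_⟩
  · change D.tnorm x ≤ 1
    rw [hx, D.tnorm_smul, abs_of_pos (inv_pos.2 hd), inv_mul_le_iff₀ hd, mul_one]
    exact hu1
  · exact PNat.add_one_le_iff.2 (hu p (hsupp hp))
  · exact Fintype.sum_unique (ι := Unit) _
  · rw [hvec]; exact W.smul_mem _ huW
  · rw [hvec]
    have h1 : ‖D.emb u - D.emb x‖ ≤ δ / 2 := by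
      have h2 : D.emb u - D.emb x = (1 - (1 + δ / 2)⁻¹) • D.emb u := by
        rw [hx, map_smul, sub_smul, one_smul]
      have h3 : 1 - (1 + δ / 2)⁻¹ = (δ / 2) * (1 + δ / 2)⁻¹ := by
        field_simp; ring
      rw [h2, h3, norm_smul, norm_emb, Real.norm_eq_abs, abs_of_pos (by positivity), mul_assoc]
      refine mul_le_of_le_one_right (by positivity) ?_
      rw [inv_mul_le_iff₀ hd, mul_one]; exact hu1
    have := norm_sub_le_norm_sub_add_norm_sub (J y) (D.emb u) (D.emb x)
    linarith
  · intro G hG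
    rw [Set.mem_singleton_iff.1 hG, WeightedFamily.hit_eq_zero (by simp)]
    exact hε.le

/-- Sums of `n` successive averages. A set of `𝒢'` may hit the first average it meets fully, but
what remains of it after that point is a bounded union of members of `𝒢`, and the later averages
were chosen with weights small relative to that bound. -/
theorem HasAverages.chain {𝒢 𝒢' : Set (Finset ℕ+)} {ρ : Ordinal}
    (h𝒢 : ∀ G ∈ 𝒢', ∀ g ∈ G, ∃ c ≤ (g : ℕ), IsSuccUnion 𝒢 c (G.filter (g < ·)))
    (h : HasAverages J W T 𝒢 ρ) : ∀ (n : ℕ) (γ : Ordinal) (s : List B) (M : ℕ+) (ε δ : ℝ),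
    0 < ε → 0 < δ → s ∈ iterDerivedTree T (γ + ρ * n) → ∃ t, s ++ t ∈ iterDerivedTree T γ ∧
      ∃ y, IsCombination t n y ∧ ∃ F : WeightedFamily, D.IsProper F M ∧ F.mass = n ∧
        F.vec ∈ W ∧ ‖J y - D.emb F.vec‖ ≤ δ ∧ (∀ G ∈ 𝒢, F.hit G ≤ ε) ∧
        ∀ G ∈ 𝒢', F.hit G ≤ 1 + ε := by
  classical
  intro n
  induction n with
  | zero =>
    intro γ s M ε δ hε hδ hs
    have hz : ∀ G, WeightedFamily.empty.hit G = 0 := fun G =>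
      WeightedFamily.hit_eq_zero fun i => i.elim
    have hv : WeightedFamily.empty.vec = 0 := Fintype.sum_empty (ι := Empty) _
    refine ⟨[], by simpa using hs, 0, by simpa using IsCombination.nil, WeightedFamily.empty,
      isProper_empty M, ?_, ?_, ?_, fun G _ => ?_, fun G _ => ?_⟩
    · exact (Fintype.sum_empty (ι := Empty) _).trans Nat.cast_zero.symm
    · rw [hv]; exact W.zero_mem
    · rw [hv]; simpa using hδ.le
    · rw [hz]; exact hε.le
    · rw [hz]; positivity
  | succ n ih =>
    intro γ s M ε δ hε hδ hs
    rw [Nat.cast_add_one, mul_add_one, ← add_assoc] at hs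
    obtain ⟨t₁, hst₁, y₁, hy₁, F₁, hF₁, hm₁, hv₁, hd₁, hh₁⟩ :=
      h _ s M (ε / 2) (δ / 2) (half_pos hε) (half_pos hδ) hs
    -- A set meeting the hulls of `F₁` at `g ≤ H` leaves at most `H` pieces for the later averages;
    -- hence their tolerance is divided by `H`.
    obtain ⟨H, hMH, hH⟩ : ∃ H : ℕ+, M ≤ H ∧ ∀ i, F₁.hi i ≤ H :=
      ⟨M ⊔ Finset.univ.sup F₁.hi, le_sup_left,
        fun i => (Finset.le_sup (Finset.mem_univ i)).trans le_sup_right⟩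
    have hH1 : (1 : ℝ) ≤ (H : ℕ) := by exact_mod_cast H.pos
    have hε₂ : 0 < ε / 2 / (H : ℕ) := by positivity
    have hε₂le : ε / 2 / (H : ℕ) ≤ ε / 2 := div_le_self (half_pos hε).le hH1
    obtain ⟨t₂, hst₂, y₂, hy₂, F₂, hF₂, hm₂, hv₂, hd₂, hh₂, hh₂'⟩ :=
      ih γ (s ++ t₁) H (ε / 2 / (H : ℕ)) (δ / 2) hε₂ (half_pos hδ) hst₁
    refine ⟨t₁ ++ t₂, by rwa [← List.append_assoc], y₁ + y₂, ?_, F₁.add F₂,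
      hF₁.add (hF₂.mono hMH), ?_, ?_, ?_, fun G hG => ?_, fun G hG => ?_⟩
    · rw [Nat.cast_add_one, add_comm]; exact hy₁.append hy₂
    · rw [WeightedFamily.mass_add, hm₁, hm₂, Nat.cast_add_one, add_comm]
    · rw [WeightedFamily.vec_add]; exact W.add_mem hv₁ hv₂
    · rw [WeightedFamily.vec_add, map_add, map_add, add_sub_add_comm]
      exact (norm_add_le _ _).trans (by linarith)
    · rw [WeightedFamily.hit_add]
      have := hh₁ G hG
      have := hh₂ G hG
      linarith
    · rw [WeightedFamily.hit_add]
      by_cases hex : ∃ i, ∃ g ∈ G, F₁.lo i ≤ g ∧ g ≤ F₁.hi i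
      · obtain ⟨i, g, hg, -, hgi⟩ := hex
        have hgH : g ≤ H := hgi.trans (hH i)
        obtain ⟨c, hc, hcu⟩ := h𝒢 G hG g hg
        have h1 := WeightedFamily.hit_le_of_isSuccUnion hF₂.nonneg hh₂ hcu
        have h2 : F₂.hit G = F₂.hit (G.filter (g < ·)) := by
          unfold WeightedFamily.hit
          refine Finset.sum_congr rfl fun j _ => ?_
          congr 1
          refine propext ⟨?_, ?_⟩
          · rintro ⟨q, hq, hqj⟩
            exact ⟨q, Finset.mem_filter.2 ⟨hq, hgH.trans_lt ((hF₂.lo_gt j).trans_le hqj.1)⟩, hqj⟩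
          · rintro ⟨q, hq, hqj⟩
            exact ⟨q, (Finset.mem_filter.1 hq).1, hqj⟩
        have h3 : (c : ℝ) ≤ (H : ℕ) := by exact_mod_cast hc.trans (PNat.coe_le_coe _ _ |>.2 hgH)
        have h4 : (c : ℝ) * (ε / 2 / (H : ℕ)) ≤ ε / 2 := by
          refine (mul_le_mul_of_nonneg_right h3 hε₂.le).trans_eq ?_
          rw [mul_div_cancel₀]; positivity
        have h5 := WeightedFamily.hit_le_mass (G := G) hF₁.nonneg
        rw [hm₁] at h5
        linarith
      · have h1 : F₁.hit G = 0 := WeightedFamily.hit_eq_zero fun i q hq hqi =>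
          hex ⟨i, q, hq, hqi⟩
        have := hh₂' G hG
        linarith

/-- The mean of `n` chained averages has weight at most `2 / n` on each set of `𝒢'`, and rank `ρ *
ω` allows `n` to be arbitrarily large. -/
theorem HasAverages.mul_omega0 {𝒢 𝒢' : Set (Finset ℕ+)} {ρ : Ordinal}
    (h𝒢 : ∀ G ∈ 𝒢', ∀ g ∈ G, ∃ c ≤ (g : ℕ), IsSuccUnion 𝒢 c (G.filter (g < ·)))
    (h : HasAverages J W T 𝒢 ρ) : HasAverages J W T 𝒢' (ρ * Ordinal.omega0) := by
  intro γ s M ε δ hε hδ hs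
  obtain ⟨n, hn⟩ := exists_nat_ge (2 / ε)
  have hn0 : (0 : ℝ) < n := lt_of_lt_of_le (by positivity) hn
  have hn1 : (1 : ℝ) ≤ n := by exact_mod_cast Nat.one_le_iff_ne_zero.2 (by
    rintro rfl; simp at hn0)
  have hs' := iterDerivedTree_anti (β := γ + ρ * n)
    (add_le_add_right (mul_le_mul_right (Ordinal.natCast_lt_omega0 _).le _) _) hs
  obtain ⟨t, hst, y, hy, F, hF, hm, hv, hd, -, hh⟩ := h.chain h𝒢 n γ s M 1 δ one_pos hδ hs'
  refine ⟨t, hst, (n : ℝ)⁻¹ • y, ?_, F.scale (n : ℝ)⁻¹, hF.scale (by positivity), ?_, ?_, ?_,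
    fun G hG => ?_⟩
  · have := hy.smul (n : ℝ)⁻¹
    rwa [abs_of_pos (inv_pos.2 hn0), inv_mul_cancel₀ hn0.ne'] at this
  · rw [WeightedFamily.mass_scale, hm, inv_mul_cancel₀ hn0.ne']
  · rw [WeightedFamily.vec_scale]; exact W.smul_mem _ hv
  · rw [WeightedFamily.vec_scale, map_smul, map_smul, ← smul_sub, norm_smul, Real.norm_eq_abs,
      abs_of_pos (inv_pos.2 hn0)]
    exact (mul_le_of_le_one_left (norm_nonneg _) (inv_le_one_of_one_le₀ hn1)).trans hd
  · rw [WeightedFamily.hit_scale, inv_mul_le_iff₀ hn0]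
    have := hh G hG
    rw [div_le_iff₀ hε] at hn
    linarith

/-- One factor $\omega$ yields a vector far out, a second one handles singletons, and each of the
`N` others raises the Schreier order by one. -/
theorem hasAverages_schreier (hW : ∀ (y : B) (δ : ℝ), 0 < δ → ∃ w ∈ W, ‖J y - D.emb w‖ < δ)
    (hT : ∀ s ∈ T, ∀ x ∈ s, ‖x‖ = 1) :
    ∀ N : ℕ, HasAverages J W T (schreier N) (Ordinal.omega0 ^ (N + 2))
  | 0 => by
    rw [zero_add, pow_two]
    refine (hasAverages_empty hW hT).mul_omega0 fun G hG g hg => ⟨0, Nat.zero_le _, ?_⟩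
    refine Finset.filter_eq_empty_iff.2 fun q hq hgq => ?_
    exact hgq.ne (Finset.card_le_one.1 hG g hg q hq)
  | N + 1 => by
    rw [show N + 1 + 2 = N + 2 + 1 from rfl, pow_succ]
    refine (hasAverages_schreier hW hT N).mul_omega0 fun G hG g hg => ?_
    obtain ⟨c, hc, hle⟩ := mem_schreier_succ.1 hG
    exact ⟨c, hle g hg, hc.subset (Finset.filter_subset _ _)⟩

/-- Averages in the span of a sequence of vectors whose closed span contains a tree of large
order. -/
theorem exists_average (hW : ∀ (y : B) (δ : ℝ), 0 < δ → ∃ w ∈ W, ‖J y - D.emb w‖ < δ) {K : ℝ}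
    (hT : IsEllOneTree K T) {s : List B}
    (hs : s ∈ iterDerivedTree T (Ordinal.omega0 ^ Ordinal.omega0)) (M : ℕ+) (N : ℕ) {ε δ : ℝ}
    (hε : 0 < ε) (hδ : 0 < δ) : ∃ F : WeightedFamily, D.IsProper F M ∧ F.mass = 1 ∧ F.vec ∈ W ∧
      (∀ n ≤ N, ∀ G ∈ schreier n, F.hit G ≤ ε) ∧ K⁻¹ - δ ≤ D.tnorm F.vec := by
  have hs' : s ∈ iterDerivedTree T (0 + Ordinal.omega0 ^ (N + 2)) := by
    refine iterDerivedTree_anti ?_ hs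
    rw [zero_add, ← Ordinal.opow_natCast]
    exact Ordinal.opow_le_opow_right Ordinal.omega0_pos (Ordinal.natCast_lt_omega0 _).le
  obtain ⟨t, hst, y, hy, F, hF, hm, hv, hd, hh⟩ :=
    hasAverages_schreier hW (fun s hs => (hT.2 s hs).1) N 0 s M ε δ hε hδ hs'
  refine ⟨F, hF, hm, hv, fun n hn G hG => hh G (schreier_mono hn hG), ?_⟩
  have h1 := hT.le_norm (iterDerivedTree_subset _ hst) ((isCombination_zero s).append hy)
  rw [zero_add, zero_add, mul_one, ← J.norm_map] at h1
  rw [← norm_emb]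
  have := norm_sub_norm_le (J y) (D.emb F.vec)
  linarith

end Averages

end TsirelsonData

/-! ### Equivalent sequences and quasi-minimality -/

theorem not_finiteDimensional_of_injective {G : Type*} [AddCommGroup G] [Module ℝ G]
    (Θ : (ℕ →₀ ℝ) →ₗ[ℝ] G) (hΘ : Function.Injective Θ) : ¬ FiniteDimensional ℝ G := by
  intro hG
  have := FiniteDimensional.of_injective Θ hΘ
  exact (Set.infinite_univ (α := ℕ)) (Set.finite_univ_iff.2
    (Module.Finite.finite_basis (Finsupp.basisSingleOne (R := ℝ) (ι := ℕ))))

/-- Equivalent sequences have isomorphic closed spans: the identity of the finitely supported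
sequences extends to the closures of the two ranges. -/
theorem not_totallyIncomparable {E F : Type*} [NormedAddCommGroup E] [NormedSpace ℝ E]
    [CompleteSpace E] [NormedAddCommGroup F] [NormedSpace ℝ F] [CompleteSpace F]
    (Φ : (ℕ →₀ ℝ) →ₗ[ℝ] E) (Ψ : (ℕ →₀ ℝ) →ₗ[ℝ] F) (hΦ : Function.Injective Φ) {A : ℝ}
    (h₁ : ∀ x, ‖Ψ x‖ ≤ A * ‖Φ x‖) (h₂ : ∀ x, ‖Φ x‖ ≤ A * ‖Ψ x‖) : ¬ TotallyIncomparable E F := by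
  have hΨ : Function.Injective Ψ := by
    refine (injective_iff_map_eq_zero Ψ).2 fun x hx => (injective_iff_map_eq_zero Φ).1 hΦ x ?_
    have := h₂ x
    rw [hx, norm_zero, mul_zero] at this
    exact norm_le_zero_iff.1 this
  refine not_not.2 ⟨Φ.range.topologicalClosure, Ψ.range.topologicalClosure,
    Submodule.isClosed_topologicalClosure _, Submodule.isClosed_topologicalClosure _, ?_, ?_, ?_⟩
  all_goals
    let e₁ : (ℕ →₀ ℝ) →ₗ[ℝ] Φ.range.topologicalClosure :=
      Φ.codRestrict _ fun x => Submodule.le_topologicalClosure _ ⟨x, rfl⟩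
    let e₂ : (ℕ →₀ ℝ) →ₗ[ℝ] Ψ.range.topologicalClosure :=
      Ψ.codRestrict _ fun x => Submodule.le_topologicalClosure _ ⟨x, rfl⟩
  · exact not_finiteDimensional_of_injective e₁ fun x y hxy => hΦ (congrArg Subtype.val hxy)
  · exact not_finiteDimensional_of_injective e₂ fun x y hxy => hΨ (congrArg Subtype.val hxy)
  · have hd₁ : DenseRange e₁ := by
      rw [DenseRange, Subtype.dense_iff]
      intro x hx
      refine closure_mono ?_ hx
      rintro _ ⟨y, rfl⟩
      exact ⟨e₁ y, ⟨y, rfl⟩, rfl⟩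
    have hd₂ : DenseRange e₂ := by
      rw [DenseRange, Subtype.dense_iff]
      intro x hx
      refine closure_mono ?_ hx
      rintro _ ⟨y, rfl⟩
      exact ⟨e₂ y, ⟨y, rfl⟩, rfl⟩
    have := (Submodule.isClosed_topologicalClosure Φ.range).completeSpace_coe
    have := (Submodule.isClosed_topologicalClosure Ψ.range).completeSpace_coe
    exact ⟨(LinearEquiv.refl ℝ (ℕ →₀ ℝ)).extend e₁ e₂ hd₁ ⟨A, h₁⟩ hd₂ ⟨A, h₂⟩⟩

namespace TsirelsonData

variable {D : TsirelsonData}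

variable (D) in
theorem exists_forall_theta_mul_le (M : ℕ+) :
    ∃ N : ℕ, ∀ n : ℕ+, N < n → D.θ n * (M : ℕ) ≤ (1 / 2 : ℝ) ^ (M : ℕ) := by
  have hM : (0 : ℝ) < (M : ℕ) := by exact_mod_cast M.pos
  obtain ⟨N, hN⟩ := eventually_atTop.1 (D.θ_null.eventually_lt_const
    (show (0 : ℝ) < (1 / 2 : ℝ) ^ (M : ℕ) / (M : ℕ) by positivity))
  refine ⟨N, fun n hn => ?_⟩
  rw [← le_div_iff₀ hM]
  exact (hN n (show (N : ℕ) ≤ n from hn.le)).le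

variable (D) in
theorem exists_one_le_theta_mul (N : ℕ) :
    ∃ Θ : ℝ, 0 ≤ Θ ∧ ∀ n : ℕ+, (n : ℕ) ≤ N → 1 ≤ D.θ n * Θ := by
  have hf : {n : ℕ+ | (n : ℕ) ≤ N}.Finite :=
    (Set.finite_Iic N).preimage PNat.coe_injective.injOn
  obtain ⟨Θ, hΘ⟩ := (hf.image fun n => (D.θ n)⁻¹).bddAbove
  refine ⟨max Θ 0, le_max_right _ _, fun n hn => ?_⟩
  rw [← div_le_iff₀' (D.θ_pos n), one_div]
  exact (hΘ ⟨n, hn, rfl⟩).trans (le_max_left _ _)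

variable (D) in
/-- Vectors of `Y` are close to averages with small weights on Schreier sets, arbitrarily far
out. -/
def IsAveraging (Y : Submodule ℝ D.Space) : Prop :=
  ∃ κ : ℝ, 0 < κ ∧ ∀ (M : ℕ+) (N : ℕ) (ε δ : ℝ), 0 < ε → 0 < δ → ∃ F : WeightedFamily,
    D.IsProper F M ∧ F.mass = 1 ∧ (∀ n ≤ N, ∀ G ∈ schreier n, F.hit G ≤ ε) ∧
    κ ≤ D.tnorm F.vec ∧ ∃ y ∈ Y, ‖y - D.emb F.vec‖ ≤ δ

/-- The vectors are fixed as functions of the parameter before any sequence is chosen, and the unit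
vectors $e_{2M_k+1}$ depend on the parameters alone; this lets two subspaces be compared through one
sequence. -/
theorem IsAveraging.exists_equivalent {Y : Submodule ℝ D.Space} (hY : D.IsAveraging Y) :
    ∃ (v : ℕ+ → ℕ+ →₀ ℝ) (y : ℕ+ → D.Space) (A : ℝ), (∀ M, y M ∈ Y) ∧ 0 < A ∧
      ∀ M : ℕ → ℕ+, StrictMono M → (∀ k, ∀ p ∈ (v (M k)).support, p ≤ M (k + 1)) →
      ∀ (R : Finset ℕ) (b : ℕ → ℝ),
        ‖∑ k ∈ R, b k • y (M k)‖ ≤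
          A * D.tnorm (∑ k ∈ R, b k • Finsupp.single (2 * M k + 1) (1 : ℝ)) ∧
        D.tnorm (∑ k ∈ R, b k • Finsupp.single (2 * M k + 1) (1 : ℝ)) ≤
          A * ‖∑ k ∈ R, b k • y (M k)‖ := by
  classical
  obtain ⟨κ, hκ, hY⟩ := hY
  obtain ⟨C, hC0, hC⟩ := D.exists_splits_le
  choose N hN using D.exists_forall_theta_mul_le
  choose Θ hΘ0 hΘ using D.exists_one_le_theta_mul
  -- With $l = 2M+1$ this makes the error $l\,\Theta\,\varepsilon$ of `exists_splits_le` at most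
  -- one; the summand 1 only avoids division by zero.
  let ε : ℕ+ → ℝ := fun M => (((2 * M + 1 : ℕ+) : ℕ) * (Θ (N M) + 1) : ℝ)⁻¹
  have hε : ∀ M, 0 < ε M := fun M => by
    have h1 : (0 : ℝ) < ((2 * M + 1 : ℕ+) : ℕ) := by exact_mod_cast PNat.pos _
    have h2 := hΘ0 (N M)
    exact inv_pos.2 (mul_pos h1 (by linarith))
  have hεΘ : ∀ M, (((2 * M + 1 : ℕ+) : ℕ) : ℝ) * (Θ (N M) * ε M) ≤ 1 := by
    intro M
    have h1 : (0 : ℝ) < ((2 * M + 1 : ℕ+) : ℕ) := by exact_mod_cast PNat.pos _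
    have h2 := hΘ0 (N M)
    have h3 : (0 : ℝ) < Θ (N M) + 1 := by linarith
    rw [← mul_assoc, ← div_eq_mul_inv, div_le_one (mul_pos h1 h3)]
    exact mul_le_mul_of_nonneg_left (by linarith) h1.le
  have hδ : ∀ M : ℕ+, 0 < κ / 2 * (1 / 2 : ℝ) ^ (M : ℕ) := fun M => by positivity
  choose F hF hm hh hκF y hyY hyF using fun M : ℕ+ => hY (2 * M) (N M) (ε M) _ (hε M) (hδ M)
  refine ⟨fun M => (F M).vec, y, C + 3 + κ / 2 + 2 / κ, hyY, by positivity, ?_⟩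
  intro M hM hsupp R b
  have hMk : ∀ k, k + 1 ≤ (M k : ℕ) := by
    intro k
    induction k with
    | zero => exact (M 0).pos
    | succ k ih =>
      have : (M k : ℕ) < M (k + 1) := hM k.lt_succ_self
      omega
  have hB : IsBlocked (fun k => (F (M k)).vec) fun k => 2 * M k + 1 := by
    refine ⟨fun i j hij => ?_, fun k p hp => ?_, fun k p hp => ?_⟩
    · exact add_lt_add_left (mul_lt_mul_right (hM hij) 2) 1
    · exact PNat.add_one_le_iff.2 ((hF (M k)).lt_of_mem hp)
    · exact add_le_add_left (mul_le_mul_right (hsupp k p hp) 2) 1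
  have hup := tnorm_sum_le (D := D) hB (fun k => N (M k)) (C := C + 1)
    (fun k => (hF (M k)).tnorm_vec_le.trans_eq (hm _)) (fun n j k hjk hn => ?_)
    (fun k E t ht => ?_) R b
  · have hlow := mul_tnorm_le_tnorm_sum (D := D) hB hκ (fun k => hκF (M k)) R b
    set e := D.tnorm (∑ k ∈ R, b k • Finsupp.single (2 * M k + 1) (1 : ℝ)) with he
    have he0 : 0 ≤ e := D.tnorm_nonneg _
    have hpert : ‖∑ k ∈ R, b k • y (M k) - D.emb (∑ k ∈ R, b k • (F (M k)).vec)‖ ≤ κ / 2 * e := by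
      rw [map_sum, ← Finset.sum_sub_distrib]
      refine (norm_sum_le _ _).trans ?_
      have : ∀ k ∈ R, ‖b k • y (M k) - D.emb (b k • (F (M k)).vec)‖ ≤
          κ / 2 * e * (1 / 2 : ℝ) ^ (k + 1) := by
        intro k hk
        rw [map_smul, ← smul_sub, norm_smul, Real.norm_eq_abs]
        have h1 : |b k| ≤ e := abs_le_tnorm_sum_smul_single hB.mono R b hk
        have h2 : ‖y (M k) - D.emb (F (M k)).vec‖ ≤ κ / 2 * (1 / 2 : ℝ) ^ (k + 1) :=
          (hyF (M k)).trans (mul_le_mul_of_nonneg_left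
            (pow_le_pow_of_le_one (by norm_num) (by norm_num) (hMk k)) (by positivity))
        refine (mul_le_mul h1 h2 (norm_nonneg _) he0).trans_eq (by ring)
      refine (Finset.sum_le_sum this).trans ?_
      rw [← Finset.mul_sum]
      exact mul_le_of_le_one_right (by positivity) (sum_pow_succ_half_le R)
    rw [← norm_emb] at hup hlow
    have h1 := norm_sub_norm_le (∑ k ∈ R, b k • y (M k)) (D.emb (∑ k ∈ R, b k • (F (M k)).vec))
    have h2 := norm_sub_norm_le (D.emb (∑ k ∈ R, b k • (F (M k)).vec)) (∑ k ∈ R, b k • y (M k))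
    rw [norm_sub_rev] at h2
    constructor
    · have : 0 ≤ 2 / κ * e := by positivity
      linarith
    · have h3 : κ / 2 * e ≤ ‖∑ k ∈ R, b k • y (M k)‖ := by linarith
      have h4 : e ≤ 2 / κ * ‖∑ k ∈ R, b k • y (M k)‖ := by
        rw [div_mul_eq_mul_div, le_div_iff₀ hκ]
        linarith
      refine h4.trans (mul_le_mul_of_nonneg_right ?_ (norm_nonneg _))
      have : 0 ≤ κ / 2 := by positivity
      linarith
  -- The support of the earlier block `j` has at most `M k` points, and `N (M k)` was chosen so that
  -- orders beyond it satisfy $\theta_n M_k \le 2^{-M_k}$.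
  · have hjk' : (M (j + 1) : ℕ) ≤ M k := hM.monotone hjk
    have hcard : ((F (M j)).vec.support.card : ℝ) ≤ (M k : ℕ) := by
      have : (F (M j)).vec.support.card ≤ (Finset.Icc 1 (M k : ℕ)).card := by
        refine Finset.card_le_card_of_injOn (fun p => (p : ℕ)) (fun p hp => ?_)
          PNat.coe_injective.injOn
        have : (p : ℕ) ≤ M (j + 1) := hsupp j p hp
        simp only [Finset.coe_Icc, Set.mem_Icc]
        exact ⟨p.pos, this.trans hjk'⟩
      rw [Nat.card_Icc, Nat.add_sub_cancel] at this
      exact_mod_cast this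
    refine (mul_le_mul_of_nonneg_left hcard (D.θ_pos n).le).trans ((hN _ n hn).trans ?_)
    refine pow_le_pow_of_le_one (by norm_num) (by norm_num) ?_
    have := hMk k
    omega
  · have := hC (hF (M k)) (hΘ (N (M k))) (hΘ0 _) (hε _).le (hh (M k)) E t ht
    rw [hm, mul_one] at this
    exact this.trans (add_le_add_right (hεΘ (M k)) C)

theorem isQuasiMinimal_of_isAveraging (h : ∀ Y : Submodule ℝ D.Space, IsClosed (Y : Set D.Space) →
    ¬ FiniteDimensional ℝ Y → D.IsAveraging Y) : IsQuasiMinimal D.Space := by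
  classical
  rintro ⟨Y, Z, hYc, hZc, hY, hZ, hYZ⟩
  obtain ⟨v, y, A, hyY, hA, hy⟩ := (h Y hYc hY).exists_equivalent
  obtain ⟨w, z, A', hzZ, hA', hz⟩ := (h Z hZc hZ).exists_equivalent
  -- The parameters grow past the supports of both systems, so one sequence is admissible for `Y`
  -- and for `Z`.
  let g : ℕ+ → ℕ+ := fun M => (M + 1) ⊔ ((v M).support.sup id ⊔ (w M).support.sup id)
  let M : ℕ → ℕ+ := fun k => g^[k] 1
  have hMs : ∀ k, M (k + 1) = g (M k) := fun k => Function.iterate_succ_apply' g k 1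
  have hM : StrictMono M := strictMono_nat_of_lt_succ fun k => by
    rw [hMs]; exact (PNat.lt_add_right _ _).trans_le le_sup_left
  have hv : ∀ k, ∀ p ∈ (v (M k)).support, p ≤ M (k + 1) := fun k p hp => by
    rw [hMs]
    exact (Finset.le_sup (f := id) hp).trans (le_sup_left.trans le_sup_right)
  have hw : ∀ k, ∀ p ∈ (w (M k)).support, p ≤ M (k + 1) := fun k p hp => by
    rw [hMs]
    exact (Finset.le_sup (f := id) hp).trans (le_sup_right.trans le_sup_right)
  have := hYc.completeSpace_coe
  have := hZc.completeSpace_coe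
  let Φ := Finsupp.linearCombination ℝ fun k => (⟨y (M k), hyY _⟩ : Y)
  let Ψ := Finsupp.linearCombination ℝ fun k => (⟨z (M k), hzZ _⟩ : Z)
  have hΦ : ∀ x, ‖Φ x‖ = ‖∑ k ∈ x.support, x k • y (M k)‖ := fun x => by
    rw [Finsupp.linearCombination_apply, Finsupp.sum, Submodule.coe_norm, Submodule.coe_sum]
    rfl
  have hΨ : ∀ x, ‖Ψ x‖ = ‖∑ k ∈ x.support, x k • z (M k)‖ := fun x => by
    rw [Finsupp.linearCombination_apply, Finsupp.sum, Submodule.coe_norm, Submodule.coe_sum]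
    rfl
  refine not_totallyIncomparable Φ Ψ ((injective_iff_map_eq_zero Φ).2 fun x hx => ?_)
    (A := A * A') (fun x => ?_) (fun x => ?_) hYZ
  · by_contra hx0
    obtain ⟨k, hk⟩ := Finsupp.support_nonempty_iff.2 hx0
    have h1 := (hy M hM hv x.support x).2
    rw [← hΦ, hx, norm_zero, mul_zero] at h1
    have h2 := (abs_le_tnorm_sum_smul_single (D := D) (l := fun k => 2 * M k + 1)
      (fun i j hij => add_lt_add_left (mul_lt_mul_right (hM hij) 2) 1) x.support x hk).trans h1
    exact Finsupp.mem_support_iff.1 hk (abs_nonpos_iff.1 h2)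
  · rw [hΦ, hΨ]
    refine (hz M hM hw _ _).1.trans ?_
    rw [mul_comm A, mul_assoc]
    exact mul_le_mul_of_nonneg_left (hy M hM hv _ _).2 hA'.le
  · rw [hΦ, hΨ]
    refine (hy M hM hv _ _).1.trans ?_
    rw [mul_assoc]
    exact mul_le_mul_of_nonneg_left (hz M hM hw _ _).2 hA.le

end TsirelsonData

namespace TsirelsonData

variable {D : TsirelsonData}

/-! ### Block sequences -/

/-- A normalized block sequence in `c₀₀`. -/
structure IsNormalizedBlock (D : TsirelsonData) (u : ℕ → ℕ+ →₀ ℝ) : Prop where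
  tnorm_eq : ∀ k, D.tnorm (u k) = 1
  lt : ∀ i j, i < j → ∀ p ∈ (u i).support, ∀ q ∈ (u j).support, p < q

variable {u : ℕ → ℕ+ →₀ ℝ}

theorem IsNormalizedBlock.eq_of_mem (hu : D.IsNormalizedBlock u) {i j : ℕ} {p : ℕ+}
    (hi : p ∈ (u i).support) (hj : p ∈ (u j).support) : i = j := by
  rcases lt_trichotomy i j with h | h | h
  · exact absurd (hu.lt _ _ h _ hi _ hj) (lt_irrefl _)
  · exact h
  · exact absurd (hu.lt _ _ h _ hj _ hi) (lt_irrefl _)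

theorem IsNormalizedBlock.nonempty (hu : D.IsNormalizedBlock u) (k : ℕ) :
    (u k).support.Nonempty := by
  rw [Finsupp.support_nonempty_iff]
  intro h
  have := hu.tnorm_eq k
  rw [h, tnorm_zero] at this
  exact zero_ne_one this

theorem IsNormalizedBlock.sum_apply (hu : D.IsNormalizedBlock u) {R : Finset ℕ} (c : ℕ → ℝ)
    {k : ℕ} (hk : k ∈ R) {p : ℕ+} (hp : p ∈ (u k).support) :
    (∑ i ∈ R, c i • u i) p = c k * u k p := by
  rw [Finsupp.finsetSum_apply]
  refine (Finset.sum_eq_single k (fun i _ hik => ?_) fun h => absurd hk h).trans rfl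
  rw [Finsupp.smul_apply, Finsupp.notMem_support_iff.1 fun h => hik (hu.eq_of_mem h hp), smul_zero]

theorem IsNormalizedBlock.abs_le_tnorm (hu : D.IsNormalizedBlock u) {R : Finset ℕ} (c : ℕ → ℝ)
    {k : ℕ} (hk : k ∈ R) : |c k| ≤ D.tnorm (∑ i ∈ R, c i • u i) := by
  have h1 : D.tnorm (c k • u k) = |c k| := by rw [D.tnorm_smul, hu.tnorm_eq, mul_one]
  rw [← h1]
  refine tnorm_mono fun p => ?_
  by_cases hp : p ∈ (u k).support
  · rw [hu.sum_apply c hk hp]; rfl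
  · rw [Finsupp.smul_apply, Finsupp.notMem_support_iff.1 hp, smul_zero, abs_zero]
    exact abs_nonneg _

theorem IsNormalizedBlock.support_subset (hu : D.IsNormalizedBlock u) {R : Finset ℕ} (c : ℕ → ℝ)
    {k : ℕ} (hk : k ∈ R) (hc : c k ≠ 0) : (u k).support ⊆ (∑ i ∈ R, c i • u i).support := by
  intro p hp
  rw [Finsupp.mem_support_iff, hu.sum_apply c hk hp]
  exact mul_ne_zero hc (Finsupp.mem_support_iff.1 hp)

variable (D) in
/-- The block subspace spanned by `u`. -/
def blockSpan (u : ℕ → ℕ+ →₀ ℝ) : Submodule ℝ D.Space :=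
  (Submodule.span ℝ (Set.range fun k => D.emb (u k))).topologicalClosure

theorem IsNormalizedBlock.isBlockSubspace (hu : D.IsNormalizedBlock u) :
    D.IsBlockSubspace (D.blockSpan u) :=
  ⟨fun k => D.emb (u k), ⟨u, fun _ => rfl, fun k => (norm_emb _).trans (hu.tnorm_eq k), hu.lt⟩, rfl⟩

theorem IsBlockSubspace.exists_eq {Y : Submodule ℝ D.Space} (hY : D.IsBlockSubspace Y) :
    ∃ u, D.IsNormalizedBlock u ∧ Y = D.blockSpan u := by
  obtain ⟨y, ⟨u, hyu, hy, hu⟩, rfl⟩ := hY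
  refine ⟨u, ⟨fun k => ?_, hu⟩, ?_⟩
  · exact (norm_emb (D := D) (u k)).symm.trans ((congrArg _ (hyu k).symm).trans (hy k))
  have : y = fun k => D.emb (u k) := funext hyu
  rw [this]
  rfl

/-! ### The gliding hump -/

variable (D) in
theorem exists_coordinate (p : ℕ+) : ∃ φ : D.Space →L[ℝ] ℝ, (∀ x, |φ x| ≤ ‖x‖) ∧
    ∀ w : ℕ+ →₀ ℝ, φ (D.emb w) = w p := by
  let f : D.C00 →ₗ[ℝ] ℝ := (Finsupp.lapply p : (ℕ+ →₀ ℝ) →ₗ[ℝ] ℝ)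
  have hf : ∀ x, ‖f x‖ ≤ 1 * ‖x‖ := fun x => by
    rw [one_mul]; exact abs_apply_le_tnorm x p
  let f' : D.C00 →L[ℝ] ℝ := f.mkContinuous 1 hf
  let e : D.C00 →L[ℝ] D.Space := UniformSpace.Completion.toComplL
  have he : DenseRange e := UniformSpace.Completion.denseRange_coe
  have he' : IsUniformInducing e := UniformSpace.Completion.isUniformInducing_coe _
  have hfe : ∀ w : D.C00, f'.extend e (e w) = f w := fun w => f'.extend_eq he he' w
  refine ⟨f'.extend e, fun x => ?_, hfe⟩
  refine he.induction (P := fun x => |f'.extend e x| ≤ ‖x‖) ?_ ?_ x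
  · rintro _ ⟨w, rfl⟩
    rw [hfe]
    refine (hf w).trans_eq ?_
    rw [one_mul]
    exact (UniformSpace.Completion.norm_coe w).symm
  · exact isClosed_le ((f'.extend e).continuous.abs) continuous_norm

variable (D) in
theorem dense_emb (x : D.Space) {δ : ℝ} (hδ : 0 < δ) : ∃ w, ‖x - D.emb w‖ < δ := by
  obtain ⟨w, hw⟩ := UniformSpace.Completion.denseRange_coe.exists_dist_lt x hδ
  exact ⟨w, by rwa [dist_eq_norm] at hw⟩

/-- An infinite-dimensional space contains a nonzero vector annihilated by the first `M` coordinate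
functionals; a finitely supported approximation can be truncated at small cost and normalized. -/
theorem exists_far_close {Y : Submodule ℝ D.Space} (hY : ¬ FiniteDimensional ℝ Y) (M : ℕ+) {η : ℝ}
    (hη : 0 < η) : ∃ y ∈ Y, ∃ w : ℕ+ →₀ ℝ, D.tnorm w = 1 ∧ (∀ p ∈ w.support, M < p) ∧
      ‖y - D.emb w‖ ≤ η := by
  classical
  choose φ hφ hφw using fun p => D.exists_coordinate p
  let I : Finset ℕ+ := Finset.Iic M
  let Θ : Y →ₗ[ℝ] (I → ℝ) := LinearMap.pi fun p => (φ p.1).toLinearMap ∘ₗ Y.subtype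
  obtain ⟨⟨x, hxY⟩, hxΘ, hx0⟩ : ∃ x : Y, Θ x = 0 ∧ x ≠ 0 := by
    by_contra! hcon
    exact hY (FiniteDimensional.of_injective Θ ((injective_iff_map_eq_zero Θ).2 hcon))
  have hxφ : ∀ p ≤ M, φ p x = 0 := fun p hp => congrFun hxΘ ⟨p, Finset.mem_Iic.2 hp⟩
  have hxn : 0 < ‖x‖ := norm_pos_iff.2 fun h => hx0 (Subtype.ext h)
  let c : ℝ := I.card + 1
  have hc : 0 < c := by positivity
  -- Approximation and truncation together cost `c * δ`, that is `‖x‖ / 2 * min 1 η`; the minimum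
  -- with 1 keeps the norm of the truncated vector above `‖x‖ / 2` before normalization.
  let δ : ℝ := ‖x‖ / (2 * c) * min 1 η
  have hδ : 0 < δ := by positivity
  obtain ⟨w, hw⟩ := D.dense_emb x hδ
  have hwp : ∀ p ≤ M, |w p| ≤ δ := by
    intro p hp
    have := (hφ p (x - D.emb w)).trans hw.le
    rwa [map_sub, hxφ p hp, hφw, zero_sub, abs_neg] at this
  let w' : ℕ+ →₀ ℝ := w.filter (M < ·)
  have hww' : D.tnorm (w - w') ≤ I.card * δ := by
    have h1 : w - w' = ∑ p ∈ I, Finsupp.single p (w p) := by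
      ext q
      rw [Finsupp.finsetSum_apply, Finsupp.sub_apply, Finsupp.filter_apply]
      simp only [Finsupp.single_apply, Finset.sum_ite_eq', I, Finset.mem_Iic]
      by_cases h : q ≤ M
      · rw [if_neg (not_lt.2 h), if_pos h, sub_zero]
      · rw [if_pos (not_le.1 h), if_neg h, sub_self]
    rw [h1]
    refine (tnorm_sum_le_sum _ _).trans ?_
    rw [← nsmul_eq_mul]
    refine Finset.sum_le_card_nsmul _ _ _ fun p hp => ?_
    refine (D.tnorm_le_ellOneNorm _).trans (le_trans ?_ (hwp p (Finset.mem_Iic.1 hp)))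
    refine (Finset.sum_le_sum_of_subset_of_nonneg Finsupp.support_single_subset
      fun _ _ _ => abs_nonneg _).trans_eq ?_
    rw [Finset.sum_singleton, Finsupp.single_eq_same]
  have hxw : ‖x - D.emb w'‖ ≤ ‖x‖ / 2 * min 1 η := by
    have h1 : x - D.emb w' = (x - D.emb w) + D.emb (w - w') := by rw [map_sub]; abel
    rw [h1]
    refine (norm_add_le _ _).trans ?_
    rw [norm_emb]
    have h2 : c * δ = ‖x‖ / 2 * min 1 η := by
      simp only [δ]; field_simp
    have h3 : c * δ = I.card * δ + δ := by simp only [c]; ring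
    linarith
  have hw'n : ‖x‖ / 2 ≤ D.tnorm w' := by
    have h1 := norm_sub_norm_le x (D.emb w')
    have h2 : ‖x‖ / 2 * min 1 η ≤ ‖x‖ / 2 :=
      mul_le_of_le_one_right (by positivity) (min_le_left _ _)
    rw [norm_emb] at h1
    linarith
  have hpos : 0 < D.tnorm w' := lt_of_lt_of_le (by positivity) hw'n
  refine ⟨(D.tnorm w')⁻¹ • x, Y.smul_mem _ hxY, (D.tnorm w')⁻¹ • w', ?_, fun p hp => ?_, ?_⟩
  · rw [D.tnorm_smul, abs_of_pos (inv_pos.2 hpos), inv_mul_cancel₀ hpos.ne']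
  · exact (Finset.mem_filter.1 (Finsupp.support_filter (M < ·) w ▸ Finsupp.support_smul hp)).2
  · rw [map_smul, ← smul_sub, norm_smul, Real.norm_eq_abs, abs_of_pos (inv_pos.2 hpos),
      inv_mul_le_iff₀ hpos]
    exact hxw.trans (mul_le_mul hw'n (min_le_right _ _) (by positivity) hpos.le)

theorem exists_isNormalizedBlock_close {Y : Submodule ℝ D.Space} (hY : ¬ FiniteDimensional ℝ Y)
    {η : ℕ → ℝ} (hη : ∀ k, 0 < η k) : ∃ u, D.IsNormalizedBlock u ∧
      ∃ y : ℕ → D.Space, ∀ k, y k ∈ Y ∧ ‖y k - D.emb (u k)‖ ≤ η k := by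
  classical
  choose y hyY w hw hM hyw using fun (k : ℕ) (M : ℕ+) => exists_far_close hY M (hη k)
  let M : ℕ → ℕ+ := fun k => Nat.rec 1 (fun k m => m ⊔ (w k m).support.sup id) k
  have hMs : ∀ k, M (k + 1) = M k ⊔ (w k (M k)).support.sup id := fun k => rfl
  have hMm : Monotone M := monotone_nat_of_le_succ fun k => by rw [hMs]; exact le_sup_left
  refine ⟨fun k => w k (M k), ⟨fun k => hw _ _, fun i j hij p hp q hq => ?_⟩, fun k => y k (M k),
    fun k => ⟨hyY _ _, hyw _ _⟩⟩
  have h1 : p ≤ M (i + 1) := by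
    rw [hMs]; exact (Finset.le_sup (f := id) hp).trans le_sup_right
  exact (h1.trans (hMm hij)).trans_lt (hM _ _ q hq)

theorem mem_blockSpan_close {x : D.Space} (hx : x ∈ D.blockSpan u) {δ : ℝ} (hδ : 0 < δ) :
    ∃ w ∈ Submodule.span ℝ (Set.range u), ‖x - D.emb w‖ < δ := by
  obtain ⟨y, hy, hxy⟩ := Metric.mem_closure_iff.1 hx δ hδ
  have h1 : (Set.range fun k => D.emb (u k)) = D.emb '' Set.range u := Set.range_comp _ _
  rw [SetLike.mem_coe, h1, Submodule.span_image] at hy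
  obtain ⟨w, hw, rfl⟩ := hy
  exact ⟨w, hw, by rwa [dist_eq_norm] at hxy⟩

/-- A block subspace lies close to `Y`, and its large index provides averages in the span of the
blocks. Replacing the blocks by nearby vectors of `Y` costs little, since the coefficients are
bounded by one and only late blocks occur. -/
theorem isAveraging_of_lt_bourgainIndex (h : ∀ Y : Submodule ℝ D.Space, D.IsBlockSubspace Y →
    Ordinal.omega0 ^ Ordinal.omega0 < bourgainIndex Y) {Y : Submodule ℝ D.Space}
    (hY : ¬ FiniteDimensional ℝ Y) : D.IsAveraging Y := by
  classical
  obtain ⟨u, hu, y, hy⟩ := exists_isNormalizedBlock_close hY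
    -- One factor makes the error small when only late blocks are used, the other makes it summable.
    (η := fun k => (1 / 2 : ℝ) ^ (k + 1) * (1 / 2 : ℝ) ^ (k + 1)) fun k => by positivity
  obtain ⟨K, hK, T, hT, s, hs⟩ := exists_tree_of_lt_bourgainIndex (h _ hu.isBlockSubspace)
  have hK0 : 0 < K⁻¹ := inv_pos.2 (one_pos.trans_le hK)
  refine ⟨K⁻¹ / 2, by positivity, fun M N ε δ hε hδ => ?_⟩
  obtain ⟨i₀, hi₀⟩ := exists_pow_lt_of_lt_one hδ (show (1 / 2 : ℝ) < 1 by norm_num)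
  let M' : ℕ+ := M ⊔ (Finset.range i₀).sup fun i => (u i).support.sup id
  obtain ⟨F, hF, hm, hW, hh, hκ⟩ := exists_average (D := D) (J := (D.blockSpan u).subtypeₗᵢ)
    (W := Submodule.span ℝ (Set.range u)) (fun y δ hδ => mem_blockSpan_close y.2 hδ) hT hs M' N hε
    (half_pos hK0)
  refine ⟨F, hF.mono le_sup_left, hm, hh, by linarith, ?_⟩
  obtain ⟨c, hc⟩ := (Finsupp.mem_span_range_iff_exists_finsupp).1 hW
  rw [Finsupp.sum] at hc
  refine ⟨∑ i ∈ c.support, c i • y i, Y.sum_mem fun i _ => Y.smul_mem _ (hy i).1, ?_⟩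
  have hn : D.tnorm (∑ i ∈ c.support, c i • u i) ≤ 1 := by
    rw [hc, ← hm]; exact hF.tnorm_vec_le
  have hci : ∀ i ∈ c.support, ‖c i • y i - D.emb (c i • u i)‖ ≤
      (1 / 2 : ℝ) ^ i₀ * (1 / 2 : ℝ) ^ (i + 1) := by
    intro i hi
    have hi0 : i₀ ≤ i := by
      by_contra! hlt
      obtain ⟨p, hp⟩ := hu.nonempty i
      have h1 := hu.support_subset c hi (Finsupp.mem_support_iff.1 hi) hp
      rw [hc] at h1
      refine (hF.lt_of_mem h1).not_ge ?_
      refine le_trans ?_ (le_sup_right (a := M))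
      exact (Finset.le_sup (f := id) hp).trans
        (Finset.le_sup (f := fun i => (u i).support.sup id) (Finset.mem_range.2 hlt))
    rw [map_smul, ← smul_sub, norm_smul, Real.norm_eq_abs]
    refine (mul_le_of_le_one_left (norm_nonneg _) ((hu.abs_le_tnorm c hi).trans hn)).trans
      ((hy i).2.trans ?_)
    exact mul_le_mul_of_nonneg_right
      (pow_le_pow_of_le_one (by norm_num) (by norm_num) (hi0.trans i.le_succ)) (by positivity)
  rw [← hc, map_sum, ← Finset.sum_sub_distrib]
  refine (norm_sum_le _ _).trans ((Finset.sum_le_sum hci).trans ?_)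
  rw [← Finset.mul_sum]
  exact (mul_le_of_le_one_right (by positivity) (sum_pow_succ_half_le _)).trans hi₀.le

theorem isQuasiMinimal_of_lt_bourgainIndex (h : ∀ Y : Submodule ℝ D.Space, D.IsBlockSubspace Y →
    Ordinal.omega0 ^ Ordinal.omega0 < bourgainIndex Y) : IsQuasiMinimal D.Space :=
  isQuasiMinimal_of_isAveraging fun _ _ hY => isAveraging_of_lt_bourgainIndex h hY

end TsirelsonData

/-! ### Trees of Schreier-admissible lists -/

section SchreierTrees

variable {A : Type} {lo hi : A → ℕ+} {U : Set A}

/-- Successive lists beyond `M` in `U` whose set of left ends belongs to `𝒢`. -/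
structure IsFar (lo hi : A → ℕ+) (U : Set A) (𝒢 : Set (Finset ℕ+)) (M : ℕ+) (t : List A) :
    Prop where
  mem : ∀ x ∈ t, x ∈ U
  gt : ∀ x ∈ t, M < lo x
  pairwise : t.Pairwise fun x y => hi x < lo y
  mins : (t.map lo).toFinset ∈ 𝒢

theorem IsFar.append {𝒢 𝒢' 𝒢'' : Set (Finset ℕ+)} {M M' : ℕ+} {t t' : List A}
    (ht : IsFar lo hi U 𝒢 M t) (ht' : IsFar lo hi U 𝒢' M' t') (hM : M ≤ M')
    (hhi : ∀ x ∈ t, hi x ≤ M') (h𝒢 : (t.map lo).toFinset ∪ (t'.map lo).toFinset ∈ 𝒢'') :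
    IsFar lo hi U 𝒢'' M (t ++ t') where
  mem x hx := (List.mem_append.1 hx).elim (ht.mem x) (ht'.mem x)
  gt x hx := (List.mem_append.1 hx).elim (ht.gt x) fun h => hM.trans_lt (ht'.gt x h)
  pairwise := List.pairwise_append.2 ⟨ht.pairwise, ht'.pairwise, fun x hx y hy =>
    (hhi x hx).trans_lt (ht'.gt y hy)⟩
  mins := by rwa [List.map_append, List.toFinset_append]

theorem isFar_nil {𝒢 : Set (Finset ℕ+)} (M : ℕ+) (h : ∅ ∈ 𝒢) : IsFar lo hi U 𝒢 M [] :=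
  ⟨by simp, by simp, List.Pairwise.nil, by simpa using h⟩

theorem isFar_singleton {M : ℕ+} {x : A} (hx : x ∈ U) (hM : M < lo x) (n : ℕ) :
    IsFar lo hi U (schreier n) M [x] :=
  ⟨by simpa using hx, by simpa using hM, List.pairwise_singleton _ _,
    schreier_mono (Nat.zero_le n) (show _ ≤ 1 by simp)⟩

/-- Induction on `j`: concatenating `c` lists of type $\mathcal S_j$ yields rank $\omega^j c$, and
in $\mathcal S_{j+1}$ the first element, taken far out, allows any prescribed `c`. -/
theorem mem_iterDerivedTree_opow (hlo : ∀ x ∈ U, lo x ≤ hi x) (hU : ∀ M, ∃ x ∈ U, M < lo x) :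
    ∀ (j : ℕ) {T : Set (List A)} {s : List A} {M : ℕ+},
      (∀ t, IsFar lo hi U (schreier j) M t → s ++ t ∈ T) →
      s ∈ iterDerivedTree T (Ordinal.omega0 ^ j)
  | 0, T, s, M, h => by
    rw [pow_zero]
    refine mem_iterDerivedTree.2 ⟨?_, fun β hβ => ?_⟩
    · simpa using h [] (isFar_nil M (empty_mem_schreier 0))
    · obtain ⟨x, hx, hM⟩ := hU M
      rw [Order.lt_one_iff.1 hβ, iterDerivedTree_zero]
      exact ⟨x, h [x] (isFar_singleton hx hM 0)⟩
  | j + 1, T, s, M, h => by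
    classical
    have key : ∀ (c : ℕ) {s : List A} {M : ℕ+},
        (∀ t, IsFar lo hi U {G | IsSuccUnion (schreier j) c G} M t → s ++ t ∈ T) →
        s ∈ iterDerivedTree T (Ordinal.omega0 ^ j * c) := by
      intro c
      induction c with
      | zero =>
        intro s M h
        rw [Nat.cast_zero, mul_zero, iterDerivedTree_zero]
        simpa using h [] (isFar_nil M rfl)
      | succ c ih =>
        intro s M h
        rw [Nat.cast_add_one, mul_add_one]
        refine iterDerivedTree_iterDerivedTree_subset _ _
          (mem_iterDerivedTree_opow hlo hU j (M := M) fun t ht => ?_)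
        have hsup : ∀ x ∈ t, hi x ≤ M ⊔ (t.toFinset.sup hi) := fun x hx =>
          (Finset.le_sup (List.mem_toFinset.2 hx)).trans le_sup_right
        refine ih (M := M ⊔ (t.toFinset.sup hi)) fun t' ht' => ?_
        rw [List.append_assoc]
        refine h _ (ht.append ht' le_sup_left hsup ⟨_, _, ht.mins, ht'.mins, fun b hb a ha => ?_, rfl⟩)
        simp only [List.mem_toFinset, List.mem_map] at ha hb
        obtain ⟨y, hy, rfl⟩ := ha
        obtain ⟨x, hx, rfl⟩ := hb
        exact (hlo x (ht.mem x hx)).trans_lt ((hsup x hx).trans_lt (ht'.gt y hy))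
    refine mem_iterDerivedTree.2 ⟨?_, fun β hβ => ?_⟩
    · simpa using h [] (isFar_nil M (empty_mem_schreier _))
    · rw [pow_succ] at hβ
      obtain ⟨c', hc', hβ⟩ := (Ordinal.lt_mul_iff_of_isSuccLimit Ordinal.isSuccLimit_omega0).1 hβ
      obtain ⟨n, rfl⟩ := Ordinal.lt_omega0.1 hc'
      -- The left end of `x` is large enough for `x` itself to count as one piece in front of `n`
      -- more.
      obtain ⟨x, hx, hM⟩ := hU (M ⊔ n.succPNat)
      refine ⟨x, iterDerivedTree_anti hβ.le (key n (M := M ⊔ hi x) fun t ht => ?_)⟩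
      rw [List.append_assoc]
      have hlt : ∀ y ∈ t, lo x < lo y := fun y hy =>
        (hlo x hx).trans_lt (le_sup_right.trans_lt (ht.gt y hy))
      refine h _ ((isFar_singleton hx (le_sup_left.trans_lt hM) j).append ht le_sup_left
        (by simp) (mem_schreier_succ.2 ⟨n + 1, ⟨_, _, (isFar_singleton (hi := hi) hx
          (le_sup_left.trans_lt hM) j).mins, ht.mins, ?_, rfl⟩, ?_⟩))
      · simpa using hlt
      · have hn : n + 1 ≤ (lo x : ℕ) := by
          have : (n.succPNat : ℕ) < lo x := le_sup_right.trans_lt hM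
          rw [Nat.succPNat_coe] at this
          omega
        intro a ha
        simp only [List.map_cons, List.map_nil, Finset.mem_union, List.mem_toFinset,
          List.mem_singleton, List.mem_map] at ha
        rcases ha with rfl | ⟨y, hy, rfl⟩
        · exact hn
        · exact hn.trans (hlt y hy).le

theorem map_mem_iterDerivedTree {B : Type} (f : A → B) {T : Set (List A)} (α : Ordinal.{0}) :
    ∀ {s : List A}, s ∈ iterDerivedTree T α → s.map f ∈ iterDerivedTree (List.map f '' T) α := by
  induction α using WellFoundedLT.induction with
  | ind α ih =>
    intro s hs
    obtain ⟨h1, h2⟩ := mem_iterDerivedTree.1 hs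
    refine mem_iterDerivedTree.2 ⟨⟨s, h1, rfl⟩, fun β hβ => ?_⟩
    obtain ⟨x, hx⟩ := h2 β hβ
    exact ⟨f x, by simpa using ih β hβ hx⟩

theorem IsSeqTree.image {B : Type} (f : A → B) {T : Set (List A)} (hT : IsSeqTree T) :
    IsSeqTree (List.map f '' T) := by
  refine ⟨?_, ?_⟩
  · rintro ⟨r, hr, hr0⟩
    rw [List.map_eq_nil_iff.1 hr0] at hr
    exact hT.1 hr
  · rintro s x hs ⟨r, hr, hrs⟩
    obtain ⟨r₁, r₂, rfl, rfl, h⟩ := List.map_eq_append_iff.1 hrs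
    obtain ⟨y, rfl, -⟩ := List.map_eq_singleton_iff.1 h
    exact ⟨r₁, hT.2 r₁ y (fun h0 => hs (by rw [h0]; rfl)) hr, rfl⟩

theorem IsWellFoundedTree.image {B : Type} {f : A → B} (hf : Function.Injective f)
    {T : Set (List A)} (hT : IsWellFoundedTree T) : IsWellFoundedTree (List.map f '' T) := by
  rintro ⟨x, hx⟩
  have : ∀ n, ∃ y, f y = x n := by
    intro n
    obtain ⟨r, -, hr⟩ := hx n
    have : x n ∈ r.map f := by
      rw [hr]; exact List.mem_map.2 ⟨n, by simp, rfl⟩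
    obtain ⟨y, -, hy⟩ := List.mem_map.1 this
    exact ⟨y, hy⟩
  choose y hy using this
  refine hT ⟨y, fun m => ?_⟩
  obtain ⟨r, hr, hrx⟩ := hx m
  have h1 : ((List.range (m + 1)).map y).map f = r.map f := by
    rw [hrx, List.map_map]
    exact List.map_congr_left fun n _ => hy n
  rwa [List.map_injective_iff.2 hf h1]

end SchreierTrees

section SchreierTrees

variable {A : Type} {lo hi : A → ℕ+}

theorem IsFar.of_append {U : Set A} {n : ℕ} {M : ℕ+} {t t' : List A}
    (h : IsFar lo hi U (schreier n) M (t ++ t')) : IsFar lo hi U (schreier n) M t where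
  mem x hx := h.mem x (List.mem_append_left _ hx)
  gt x hx := h.gt x (List.mem_append_left _ hx)
  pairwise := (List.pairwise_append.1 h.pairwise).1
  mins := schreier_subset h.mins (by
    rw [List.map_append, List.toFinset_append]; exact Finset.subset_union_left)

theorem IsFar.trichotomy {U : Set A} {𝒢 : Set (Finset ℕ+)} {M : ℕ+} {t : List A}
    (h : IsFar lo hi U 𝒢 M t) {x y : A} (hx : x ∈ t) (hy : y ∈ t) :
    x = y ∨ hi x < lo y ∨ hi y < lo x := by
  obtain ⟨i, hi, rfl⟩ := List.mem_iff_getElem.1 hx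
  obtain ⟨j, hj, rfl⟩ := List.mem_iff_getElem.1 hy
  rcases lt_trichotomy i j with hij | rfl | hij
  · exact Or.inr (Or.inl (List.pairwise_iff_getElem.1 h.pairwise i j hi hj hij))
  · exact Or.inl rfl
  · exact Or.inr (Or.inr (List.pairwise_iff_getElem.1 h.pairwise j i hj hi hij))

theorem IsFar.anti {U : Set A} {𝒢 : Set (Finset ℕ+)} {M M' : ℕ+} {t : List A}
    (h : IsFar lo hi U 𝒢 M t) (hM : M' ≤ M) : IsFar lo hi U 𝒢 M' t :=
  ⟨h.mem, fun x hx => hM.trans_lt (h.gt x hx), h.pairwise, h.mins⟩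

theorem IsFar.map {B : Type} (f : B → A) {U : Set A} {𝒢 : Set (Finset ℕ+)} {M : ℕ+} {t : List B}
    (h : IsFar (lo ∘ f) (hi ∘ f) (f ⁻¹' U) 𝒢 M t) : IsFar lo hi U 𝒢 M (t.map f) where
  mem x hx := by
    obtain ⟨y, hy, rfl⟩ := List.mem_map.1 hx
    exact h.mem y hy
  gt x hx := by
    obtain ⟨y, hy, rfl⟩ := List.mem_map.1 hx
    exact h.gt y hy
  pairwise := List.pairwise_map.2 h.pairwise
  mins := by rw [List.map_map]; exact h.mins

/-- The trees of Schreier-admissible lists of all finite orders combine to a well-founded tree of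
rank greater than `ω ^ ω`. -/
theorem exists_wellFounded_tree {U : ℕ → Set A} (M : ℕ → ℕ+) (hlo : ∀ j, ∀ x ∈ U j, lo x ≤ hi x)
    (hU : ∀ j m, ∃ x ∈ U j, m < lo x) (x₀ : A) : ∃ T : Set (List A), IsSeqTree T ∧
      IsWellFoundedTree T ∧ [x₀] ∈ iterDerivedTree T (Ordinal.omega0 ^ Ordinal.omega0) ∧
      ∀ s ∈ T, ∃ t, s = x₀ :: t ∧ (t = [] ∨ ∃ j, IsFar lo hi (U j) (schreier j) (M j) t) := by
  classical
  -- The order `j` is bounded by the left end of the first vector after the root. All orders occur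
  -- below `x₀`, yet they are bounded along each branch, so an infinite branch would have all its
  -- segments in one Schreier family.
  let T : Set (List A) := {s | ∃ t, s = x₀ :: t ∧ ∀ y t', t = y :: t' →
    ∃ j : ℕ, j ≤ (lo y : ℕ) ∧ IsFar lo hi (U j) (schreier j) (M j) t}
  have hx₀ : [x₀] ∈ T := ⟨[], rfl, by simp⟩
  have hrank : ∀ j : ℕ, [x₀] ∈ iterDerivedTree T (Ordinal.omega0 ^ j) := by
    intro j
    refine mem_iterDerivedTree_opow (hlo j) (hU j) j (M := M j ⊔ j.succPNat) fun t ht =>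
      ⟨t, rfl, ?_⟩
    rintro y t' rfl
    refine ⟨j, ?_, ht.anti le_sup_left⟩
    have : (j.succPNat : ℕ) < lo y := le_sup_right.trans_lt (ht.gt y (by simp))
    rw [Nat.succPNat_coe] at this
    omega
  refine ⟨T, ⟨?_, ?_⟩, ?_, mem_iterDerivedTree.2 ⟨hx₀, fun β hβ => ?_⟩, ?_⟩
  · rintro ⟨t, ht, -⟩
    simp at ht
  · rintro s x hs ⟨t, hst, ht⟩
    obtain ⟨y, r, rfl⟩ := List.exists_cons_of_ne_nil hs
    rw [List.cons_append, List.cons.injEq] at hst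
    obtain ⟨rfl, rfl⟩ := hst
    refine ⟨r, rfl, ?_⟩
    rintro z r' rfl
    obtain ⟨j, hj, hf⟩ := ht z (r' ++ [x]) rfl
    exact ⟨j, hj, hf.of_append⟩
  · rintro ⟨x, hx⟩
    have hm : ∀ m, ∃ j ≤ (lo (x 1) : ℕ), IsFar lo hi (U j) (schreier j) (M j)
        ((List.range (m + 1)).map fun i => x (i + 1)) := by
      intro m
      obtain ⟨t, ht, h⟩ := hx (m + 1)
      rw [List.range_succ_eq_map, List.map_cons, List.cons.injEq, List.map_map] at ht
      obtain ⟨-, rfl⟩ := ht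
      refine h _ ((List.range m).map fun i => x (i + 2)) ?_
      rw [List.range_succ_eq_map, List.map_cons, List.map_map]
      rfl
    obtain ⟨m, hm'⟩ := exists_notMem_schreier (lo (x 1)) (fun i => lo (x (i + 1)))
      (strictMono_nat_of_lt_succ fun n => by
        obtain ⟨j, -, hf⟩ := hm (n + 1)
        have h1 := List.pairwise_map.1 hf.pairwise
        have h2 := List.pairwise_iff_getElem.1 h1 n (n + 1) (by simp) (by simp) n.lt_succ_self
        simp only [List.getElem_range] at h2
        exact (hlo j _ (hf.mem _ (List.mem_map.2 ⟨n, by simp, rfl⟩))).trans_lt h2)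
    obtain ⟨j, hj, hf⟩ := hm m
    refine hm' (schreier_mono hj (schreier_subset hf.mins fun p hp => ?_))
    obtain ⟨i, hi, rfl⟩ := Finset.mem_image.1 hp
    rw [List.map_map, List.mem_toFinset]
    refine List.mem_map.2 ⟨i, ?_, rfl⟩
    have := Finset.mem_range.1 hi
    exact List.mem_range.2 (by omega)
  · obtain ⟨c, hc, hβ⟩ := (Ordinal.lt_opow_of_isSuccLimit Ordinal.omega0_ne_zero
      Ordinal.isSuccLimit_omega0).1 hβ
    obtain ⟨n, rfl⟩ := Ordinal.lt_omega0.1 hc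
    rw [Ordinal.opow_natCast] at hβ
    exact (mem_iterDerivedTree.1 (hrank n)).2 β hβ
  · rintro s ⟨t, rfl, ht⟩
    refine ⟨t, rfl, ?_⟩
    rcases t with - | ⟨y, t'⟩
    · exact Or.inl rfl
    · obtain ⟨j, -, hf⟩ := ht y t' rfl
      exact Or.inr ⟨j, hf⟩

end SchreierTrees

/-! ### Lower bounds for the index of block subspaces -/

namespace TsirelsonData

variable {D : TsirelsonData} {u : ℕ → ℕ+ →₀ ℝ}

/-- The largest element of the support. -/
def maxSupp (x : ℕ+ →₀ ℝ) : ℕ+ := x.support.sup id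

/-- The smallest element of the support. -/
def minSupp (x : ℕ+ →₀ ℝ) : ℕ+ := minElt x.support

theorem le_maxSupp {x : ℕ+ →₀ ℝ} {p : ℕ+} (hp : p ∈ x.support) : p ≤ maxSupp x :=
  Finset.le_sup (f := id) hp

theorem minSupp_le {x : ℕ+ →₀ ℝ} {p : ℕ+} (hp : p ∈ x.support) : minSupp x ≤ p := minElt_le hp

theorem support_nonempty_of_tnorm {x : ℕ+ →₀ ℝ} (h : D.tnorm x = 1) : x.support.Nonempty := by
  rw [Finsupp.support_nonempty_iff]
  rintro rfl
  rw [tnorm_zero] at h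
  exact zero_ne_one h

theorem minSupp_mem {x : ℕ+ →₀ ℝ} (h : D.tnorm x = 1) : minSupp x ∈ x.support :=
  minElt_mem (support_nonempty_of_tnorm h)

/-- `x` is a combination of members of `u` whose minimal supports form a set in `S_n`, with
coefficients of total mass at least `c`. -/
def IsLevel (u : ℕ → ℕ+ →₀ ℝ) (n : ℕ) (c : ℝ) (x : ℕ+ →₀ ℝ) : Prop :=
  ∃ (G : Finset ℕ) (b : ℕ → ℝ), (∀ k ∈ G, b k ≠ 0) ∧ x = ∑ k ∈ G, b k • u k ∧
    (G.image fun k => minSupp (u k)) ∈ schreier n ∧ c ≤ ∑ k ∈ G, |b k|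

theorem isLevel_of_sum {n : ℕ} {c : ℝ} (G : Finset ℕ) (b : ℕ → ℝ)
    (hG : (G.image fun k => minSupp (u k)) ∈ schreier n) (hc : c ≤ ∑ k ∈ G, |b k|) :
    IsLevel u n c (∑ k ∈ G, b k • u k) := by
  classical
  refine ⟨G.filter (b · ≠ 0), b, fun k hk => (Finset.mem_filter.1 hk).2, ?_,
    schreier_subset hG (Finset.image_subset_image (Finset.filter_subset _ _)), ?_⟩
  · refine (Finset.sum_filter_of_ne (p := fun k => b k ≠ 0) fun k _ hk h0 => hk ?_).symm
    rw [h0, zero_smul]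
  · rwa [Finset.sum_filter_of_ne (p := fun k => b k ≠ 0) fun k _ hk h0 => hk (by rw [h0, abs_zero])]

theorem IsLevel.mem_span {n : ℕ} {c : ℝ} {x : ℕ+ →₀ ℝ} (h : IsLevel u n c x) :
    x ∈ Submodule.span ℝ (Set.range u) := by
  obtain ⟨G, b, -, rfl, -⟩ := h
  exact Submodule.sum_mem _ fun k _ => Submodule.smul_mem _ _ (Submodule.subset_span ⟨k, rfl⟩)

theorem IsLevel.smul {n : ℕ} {c : ℝ} {x : ℕ+ →₀ ℝ} (h : IsLevel u n c x) {a : ℝ} (ha : 0 < a) :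
    IsLevel u n (a * c) (a • x) := by
  obtain ⟨G, b, hb, rfl, hG, hc⟩ := h
  refine ⟨G, fun k => a * b k, fun k hk => mul_ne_zero ha.ne' (hb k hk), ?_, hG, ?_⟩
  · simp only [Finset.smul_sum, mul_smul]
  · simp only [abs_mul, abs_of_pos ha, ← Finset.mul_sum]
    exact mul_le_mul_of_nonneg_left hc ha.le

/-- The supports of the blocks involved are successive with minima in $\mathcal S_n$, hence adapted
for either kind of family. -/
theorem IsNormalizedBlock.theta_mul_le (hu : D.IsNormalizedBlock u) {n : ℕ+} {c : ℝ} {x : ℕ+ →₀ ℝ}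
    (h : IsLevel u n c x) : D.θ n * c ≤ D.tnorm x := by
  classical
  obtain ⟨G, b, hb, rfl, hG, hc⟩ := h
  refine (mul_le_mul_of_nonneg_left hc (D.θ_pos n).le).trans ?_
  have hsep : Pairwise fun i j : G => (D.σ n).Sep (u i).support (u j).support := by
    intro i j hij
    rcases lt_or_gt_of_ne fun h => hij (Subtype.ext h) with h | h
    · exact AdaptType.sep_of_lt _ (hu.lt _ _ h)
    · exact AdaptType.sep_of_gt _ fun p hp q hq => hu.lt _ _ h q hq p hp
  refine le_trans (le_of_eq ?_) (theta_mul_sum_le_tnorm n (fun k : G => (u k).support)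
    (fun k => hu.nonempty k) hsep (schreier_subset hG fun p hp => ?_) _)
  · rw [← Finset.sum_coe_sort]
    congr 1
    refine Finset.sum_congr rfl fun k _ => ?_
    have : restrictTo (u k).support (∑ k ∈ G, b k • u k) = b k • u k := by
      ext p
      by_cases hp : p ∈ (u k).support
      · rw [restrictTo_apply_of_mem _ hp, hu.sum_apply b k.2 hp]; rfl
      · rw [restrictTo_apply_of_notMem _ hp, Finsupp.smul_apply, Finsupp.notMem_support_iff.1 hp,
          smul_zero]
    rw [this, D.tnorm_smul, hu.tnorm_eq, mul_one]
  · obtain ⟨k, -, rfl⟩ := Finset.mem_image.1 hp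
    exact Finset.mem_image.2 ⟨k, k.2, rfl⟩

theorem exists_sum_of_isCombination {G : (ℕ+ →₀ ℝ) → Finset ℕ} {b : (ℕ+ →₀ ℝ) → ℕ → ℝ} {c d : ℝ}
    {t : List (ℕ+ →₀ ℝ)} {y : ℕ+ →₀ ℝ} (h : IsCombination t d y)
    (hx : ∀ x ∈ t, x = ∑ k ∈ G x, b x k • u k ∧ c ≤ ∑ k ∈ G x, |b x k|)
    (hdis : t.Pairwise fun x y => Disjoint (G x) (G y)) :
    ∃ β : ℕ → ℝ, y = ∑ k ∈ t.toFinset.biUnion G, β k • u k ∧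
      c * d ≤ ∑ k ∈ t.toFinset.biUnion G, |β k| := by
  classical
  induction h with
  | nil => exact ⟨0, by simp, by simp⟩
  | @cons a x t d y h ih =>
    rw [List.pairwise_cons] at hdis
    obtain ⟨β, hy, hd⟩ := ih (fun z hz => hx z (by simp [hz])) hdis.2
    obtain ⟨hxx, hc⟩ := hx x (by simp)
    have hD : Disjoint (G x) (t.toFinset.biUnion G) :=
      (Finset.disjoint_biUnion_right _ _ _).2 fun z hz => hdis.1 z (List.mem_toFinset.1 hz)
    have hG : (x :: t).toFinset.biUnion G = G x ∪ t.toFinset.biUnion G := by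
      rw [List.toFinset_cons, Finset.biUnion_insert]
    have h1 : ∀ k ∈ G x, (if k ∈ G x then a * b x k else β k) = a * b x k := fun k hk => if_pos hk
    have h2 : ∀ k ∈ t.toFinset.biUnion G, (if k ∈ G x then a * b x k else β k) = β k := fun k hk =>
      if_neg fun hk' => Finset.disjoint_left.1 hD hk' hk
    refine ⟨fun k => if k ∈ G x then a * b x k else β k, ?_, ?_⟩
    · rw [hG, Finset.sum_union hD]
      refine congrArg₂ _ ?_ (hy.trans (Finset.sum_congr rfl fun k hk => ?_))
      · conv_lhs => rw [hxx, Finset.smul_sum]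
        refine Finset.sum_congr rfl fun k hk => ?_
        simp only [h1 k hk, mul_smul]
      · simp only [h2 k hk]
    · have h3 : ∑ k ∈ G x, |if k ∈ G x then a * b x k else β k| = |a| * ∑ k ∈ G x, |b x k| := by
        rw [Finset.mul_sum]
        exact Finset.sum_congr rfl fun k hk => by rw [h1 k hk, abs_mul]
      have h4 : ∑ k ∈ t.toFinset.biUnion G, |if k ∈ G x then a * b x k else β k| =
          ∑ k ∈ t.toFinset.biUnion G, |β k| :=
        Finset.sum_congr rfl fun k hk => by rw [h2 k hk]
      rw [hG, Finset.sum_union hD, h3, h4]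
      have := mul_le_mul_of_nonneg_left hc (abs_nonneg a)
      linarith

theorem IsCombination.exists_mem_support {t : List (ℕ+ →₀ ℝ)} {d : ℝ} {y : ℕ+ →₀ ℝ}
    (h : IsCombination t d y) {p : ℕ+} (hp : p ∈ y.support) : ∃ x ∈ t, p ∈ x.support := by
  classical
  induction h with
  | nil => simp at hp
  | cons b x h ih =>
    rcases Finset.mem_union.1 (Finsupp.support_add hp) with h | h
    · exact ⟨x, by simp, Finsupp.support_smul h⟩
    · obtain ⟨z, hz, hpz⟩ := ih h
      exact ⟨z, by simp [hz], hpz⟩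

/-- Substituting combinations into a combination: orders add by `biUnion_mem_schreier`, and masses
multiply because the successive vectors involve disjoint sets of blocks. -/
theorem IsNormalizedBlock.isLevel_of_isCombination (hu : D.IsNormalizedBlock u) {n j : ℕ} {c d : ℝ}
    {U : Set (ℕ+ →₀ ℝ)} (hU : ∀ x ∈ U, D.tnorm x = 1 ∧ IsLevel u n c x) {M : ℕ+}
    {t : List (ℕ+ →₀ ℝ)} (ht : IsFar minSupp maxSupp U (schreier j) M t) {y : ℕ+ →₀ ℝ}
    (hy : IsCombination t d y) : IsLevel u (n + j) (c * d) y := by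
  classical
  have hex : ∀ x, ∃ (G : Finset ℕ) (b : ℕ → ℝ), x ∈ t → (∀ k ∈ G, b k ≠ 0) ∧
      x = ∑ k ∈ G, b k • u k ∧ (G.image fun k => minSupp (u k)) ∈ schreier n ∧
      c ≤ ∑ k ∈ G, |b k| := by
    intro x
    by_cases hx : x ∈ t
    · obtain ⟨G, b, h⟩ := (hU x (ht.mem x hx)).2
      exact ⟨G, b, fun _ => h⟩
    · exact ⟨∅, 0, fun h => absurd h hx⟩
  choose G b hGb using hex
  have hsub : ∀ x ∈ t, ∀ k ∈ G x, (u k).support ⊆ x.support := by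
    intro x hx k hk
    obtain ⟨hb, hxe, -⟩ := hGb x hx
    have := hu.support_subset (b x) hk (hb k hk)
    rwa [← hxe] at this
  have hlo : ∀ x ∈ t, minSupp x ≤ maxSupp x := fun x hx =>
    le_maxSupp (minSupp_mem (hU x (ht.mem x hx)).1)
  have hmem : ∀ k, minSupp (u k) ∈ (u k).support := fun k => minSupp_mem (hu.tnorm_eq k)
  have hpair : ∀ x ∈ t, ∀ y ∈ t, minSupp x < minSupp y → maxSupp x < minSupp y := by
    intro x hx y hy hxy
    rcases ht.trichotomy hx hy with rfl | h | h
    · exact absurd hxy (lt_irrefl _)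
    · exact h
    · exact absurd ((hlo y hy).trans_lt h) hxy.asymm
  have hinj : ∀ x ∈ t, ∀ y ∈ t, minSupp x = minSupp y → x = y := by
    intro x hx y hy hxy
    rcases ht.trichotomy hx hy with h | h | h
    · exact h
    · exact absurd hxy ((hlo x hx).trans_lt h).ne
    · exact absurd hxy ((hlo y hy).trans_lt h).ne'
  obtain ⟨β, rfl, hd⟩ := exists_sum_of_isCombination (u := u) (c := c) hy
    (fun x hx => ⟨(hGb x hx).2.1, (hGb x hx).2.2.2⟩) (ht.pairwise.imp_of_mem fun hx hy h =>
      Finset.disjoint_left.2 fun k hk hk' => by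
        have h1 := le_maxSupp (hsub _ hx k hk (hmem k))
        have h2 := minSupp_le (hsub _ hy k hk' (hmem k))
        exact absurd (h1.trans_lt h) (not_lt.2 h2))
  refine isLevel_of_sum _ β ?_ hd
  let Φ : ℕ+ → Finset ℕ+ := fun p => (t.toFinset.filter (minSupp · = p)).biUnion fun x =>
    (G x).image fun k => minSupp (u k)
  have hΦ : ∀ x ∈ t, Φ (minSupp x) = (G x).image fun k => minSupp (u k) := by
    intro x hx
    have : t.toFinset.filter (minSupp · = minSupp x) = {x} := by
      ext z
      simp only [Finset.mem_filter, List.mem_toFinset, Finset.mem_singleton]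
      exact ⟨fun h => hinj z h.1 x hx h.2, fun h => by rw [h]; exact ⟨hx, rfl⟩⟩
    simp only [Φ, this, Finset.singleton_biUnion]
  have hΦm : ∀ x ∈ t, ∀ a ∈ Φ (minSupp x), minSupp x ≤ a ∧ a ≤ maxSupp x := by
    intro x hx a ha
    rw [hΦ x hx] at ha
    obtain ⟨k, hk, rfl⟩ := Finset.mem_image.1 ha
    have := hsub x hx k hk (hmem k)
    exact ⟨minSupp_le this, le_maxSupp this⟩
  have hH : ∀ p ∈ (t.map minSupp).toFinset, ∃ x ∈ t, minSupp x = p := fun p hp => by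
    simpa using hp
  refine schreier_subset (biUnion_mem_schreier Φ ht.mins (fun p hp => ?_) (fun p hp a ha => ?_)
    fun p hp q hq hpq a ha b hb => ?_) fun p hp => ?_
  · obtain ⟨x, hx, rfl⟩ := hH p hp
    rw [hΦ x hx]
    exact (hGb x hx).2.2.1
  · obtain ⟨x, hx, rfl⟩ := hH p hp
    exact (hΦm x hx a ha).1
  · obtain ⟨x, hx, rfl⟩ := hH p hp
    obtain ⟨y, hy, rfl⟩ := hH q hq
    exact (hΦm x hx a ha).2.trans_lt ((hpair x hx y hy hpq).trans_le (hΦm y hy b hb).1)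
  · obtain ⟨k, hk, rfl⟩ := Finset.mem_image.1 hp
    obtain ⟨x, hx, hkx⟩ := Finset.mem_biUnion.1 hk
    rw [List.mem_toFinset] at hx
    refine Finset.mem_biUnion.2 ⟨minSupp x, by simpa using ⟨x, hx, rfl⟩, ?_⟩
    rw [hΦ x hx]
    exact Finset.mem_image_of_mem _ hkx

theorem IsNormalizedBlock.exists_lt_minSupp (hu : D.IsNormalizedBlock u) (M : ℕ+) :
    ∃ k, M < minSupp (u k) := by
  have hmono : StrictMono fun k => minSupp (u k) := fun i j hij =>
    hu.lt i j hij _ (minSupp_mem (hu.tnorm_eq i)) _ (minSupp_mem (hu.tnorm_eq j))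
  have hk : ∀ k : ℕ, k + 1 ≤ (minSupp (u k) : ℕ) := by
    intro k
    induction k with
    | zero => exact (minSupp (u 0)).pos
    | succ k ih =>
      have : (minSupp (u k) : ℕ) < minSupp (u (k + 1)) := hmono k.lt_succ_self
      omega
  refine ⟨M, ?_⟩
  rw [← PNat.coe_lt_coe]
  exact hk M

/-- There are vectors, arbitrarily far out, whose `S_j`-admissible sequences are uniformly
equivalent to the `ℓ¹` basis. -/
theorem IsNormalizedBlock.exists_ellOne (hu : D.IsNormalizedBlock u) {K : ℝ} (hK : 0 < K) {j : ℕ}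
    {n m : ℕ+} (hn : (m : ℕ) * j ≤ n) (hθ : 1 < D.θ n * K ^ (m : ℕ)) :
    ∃ (U : Set (ℕ+ →₀ ℝ)) (M : ℕ+),
      (∀ x ∈ U, x ∈ Submodule.span ℝ (Set.range u) ∧ D.tnorm x = 1) ∧
      (∀ M', ∃ x ∈ U, M' < minSupp x) ∧
      ∀ t, IsFar minSupp maxSupp U (schreier j) M t →
        ∀ c y, IsCombination t c y → K⁻¹ * c ≤ D.tnorm y := by
  -- Every candidate set `U` now contains far admissible lists having a combination of norm below
  -- $c/K$. Applied to the set of all unit vectors of level `i * j` and mass at least `K ^ i`, this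
  -- gives after normalization one of level `(i + 1) * j` and mass at least `K ^ (i + 1)`.
  by_contra! hcon
  have key : ∀ (i : ℕ) (M : ℕ+), ∃ x, (D.tnorm x = 1 ∧ IsLevel u (i * j) (K ^ i) x) ∧
      M < minSupp x := by
    intro i
    induction i with
    | zero =>
      intro M
      obtain ⟨k, hk⟩ := hu.exists_lt_minSupp M
      refine ⟨u k, ⟨hu.tnorm_eq k, ⟨{k}, 1, by simp, by simp, ?_, by simp⟩⟩, hk⟩
      exact schreier_mono (Nat.zero_le _) (show _ ≤ 1 by simp)
    | succ i ih =>
      intro M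
      obtain ⟨t, ht, c, y, hy, hlt⟩ := hcon {x | D.tnorm x = 1 ∧ IsLevel u (i * j) (K ^ i) x} M
        (fun x hx => ⟨hx.2.mem_span, hx.1⟩) ih
      have hlev := hu.isLevel_of_isCombination (fun x hx => hx) ht hy
      have hc : 0 < c := by
        refine lt_of_le_of_ne hy.nonneg fun h => ?_
        rw [← h, mul_zero] at hlt
        exact absurd hlt (not_lt.2 (D.tnorm_nonneg y))
      have hy0 : 0 < D.tnorm y := by
        obtain ⟨G, b, hb, rfl, -, hG⟩ := hlev
        have : 0 < ∑ k ∈ G, |b k| := lt_of_lt_of_le (by positivity) hG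
        obtain ⟨k, hk, hk0⟩ := Finset.exists_ne_zero_of_sum_ne_zero this.ne'
        exact (lt_of_le_of_ne (abs_nonneg _) hk0.symm).trans_le (hu.abs_le_tnorm b hk)
      have hnorm : D.tnorm ((D.tnorm y)⁻¹ • y) = 1 := by
        rw [D.tnorm_smul, abs_of_pos (inv_pos.2 hy0), inv_mul_cancel₀ hy0.ne']
      refine ⟨(D.tnorm y)⁻¹ • y, ⟨hnorm, ?_⟩, ?_⟩
      · obtain ⟨G, b, hb, hx, hG, hle⟩ := hlev.smul (inv_pos.2 hy0)
        refine ⟨G, b, hb, hx, by rwa [add_one_mul], le_trans ?_ hle⟩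
        rw [inv_mul_eq_div, le_div_iff₀ hy0, pow_succ, mul_assoc]
        refine mul_le_mul_of_nonneg_left ?_ (by positivity)
        rw [inv_mul_eq_div, lt_div_iff₀ hK] at hlt
        linarith
      · obtain ⟨x, hx, hp⟩ := IsCombination.exists_mem_support hy
          (Finsupp.support_smul (minSupp_mem hnorm))
        exact (ht.gt x hx).trans_le (minSupp_le hp)
  -- After `m` rounds the order `m * j` is at most `n`, and the weight `θ n` forces norm above one
  -- on a unit vector.
  obtain ⟨x, ⟨hx, G, b, hb, hxe, hG, hc⟩, -⟩ := key m 1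
  have := hu.theta_mul_le (n := n) ⟨G, b, hb, hxe, schreier_mono hn hG, hc⟩
  rw [hx] at this
  exact absurd hθ (not_lt.2 this)

/-- The tree is built from finitely supported vectors, where supports make sense, and then carried
to the Banach space by `f`; injectivity preserves well-foundedness. -/
theorem IsNormalizedBlock.lt_bourgainIndex_of_isometry (hu : D.IsNormalizedBlock u) {K : ℝ}
    (hK : 1 ≤ K) (hθ : ∀ j : ℕ, ∃ n m : ℕ+, (m : ℕ) * j ≤ n ∧ 1 < D.θ n * K ^ (m : ℕ))
    {B : Type} [NormedAddCommGroup B] [NormedSpace ℝ B]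
    (f : Submodule.span ℝ (Set.range u) →ₗ[ℝ] B) (hinj : Function.Injective f)
    (hf : ∀ x, ‖f x‖ = D.tnorm x) :
    Ordinal.omega0 ^ Ordinal.omega0 < bourgainIndex B := by
  classical
  have hK0 : 0 < K := one_pos.trans_le hK
  have hex := fun j : ℕ => (hθ j).elim fun n h => h.elim fun m h => hu.exists_ellOne hK0 h.1 h.2
  choose U M hU hfar hell using hex
  let x₀ : Submodule.span ℝ (Set.range u) := ⟨u 0, Submodule.subset_span ⟨0, rfl⟩⟩
  obtain ⟨T, hT, hw, hr, hTs⟩ := exists_wellFounded_tree (A := Submodule.span ℝ (Set.range u))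
    (lo := minSupp ∘ Subtype.val) (hi := maxSupp ∘ Subtype.val)
    (U := fun j => Subtype.val ⁻¹' U j) (fun j => M j ⊔ maxSupp (u 0))
    (fun j x hx => le_maxSupp (minSupp_mem (hU j _ hx).2))
    (fun j m => by
      obtain ⟨x, hx, hm⟩ := hfar j m
      exact ⟨⟨x, (hU j x hx).1⟩, hx, hm⟩) x₀
  -- The factor 2 pays for the common root `u 0`: all other vectors lie beyond its support, so by
  -- unconditionality the root part and the rest are each dominated by the whole combination.
  refine _root_.lt_bourgainIndex (K := 2 * K) (by linarith) (T := List.map f '' T)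
    ⟨hT.image f, ?_⟩ (hw.image hinj) (map_mem_iterDerivedTree f _ hr)
  rintro _ ⟨r, hrT, rfl⟩
  obtain ⟨t, rfl, ht⟩ := hTs r hrT
  have ht1 : ∀ x ∈ t, D.tnorm x = 1 ∧ maxSupp (u 0) < minSupp x.1 := by
    rcases ht with rfl | ⟨j, hj⟩
    · simp
    · exact fun x hx => ⟨(hU j _ (hj.mem x hx)).2, le_sup_right.trans_lt (hj.gt x hx)⟩
  refine ⟨fun x hx => ?_, fun a => ?_⟩
  · obtain ⟨z, hz, rfl⟩ := List.mem_map.1 hx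
    rw [hf]
    rcases List.mem_cons.1 hz with rfl | hz
    · exact hu.tnorm_eq 0
    · exact (ht1 z hz).1
  · obtain ⟨z, hz, hfz⟩ := (isCombination_sum _ a).exists_of_map f
    rw [← hfz, hf]
    generalize ∑ i, |a i| = d at hz
    cases hz with
    | @cons b _ _ c z' h =>
    have h' : IsCombination (t.map Subtype.val) c z'.1 := h.map (Submodule.subtype _)
    have hz' : ∀ p ∈ (z' : ℕ+ →₀ ℝ).support, maxSupp (u 0) < p := by
      intro p hp
      obtain ⟨x, hx, hpx⟩ := IsCombination.exists_mem_support h' hp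
      obtain ⟨x', hx', rfl⟩ := List.mem_map.1 hx
      exact (ht1 x' hx').2.trans_le (minSupp_le hpx)
    have h1 : K⁻¹ * c ≤ D.tnorm z' := by
      rcases ht with rfl | ⟨j, hj⟩
      · cases h
        simpa using D.tnorm_nonneg _
      · exact hell j _ (hj.map Subtype.val |>.anti le_sup_left) c _ h'
    have hdisj : ∀ p, u 0 p = 0 ∨ (z' : ℕ+ →₀ ℝ) p = 0 := by
      intro p
      by_contra! hp
      exact absurd (le_maxSupp (Finsupp.mem_support_iff.2 hp.1))
        (not_le.2 (hz' p (Finsupp.mem_support_iff.2 hp.2)))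
    have happ : ∀ p, (b • x₀ + z').1 p = b * u 0 p + (z' : ℕ+ →₀ ℝ) p :=
      fun p => rfl
    have h2 : D.tnorm z' ≤ D.tnorm (b • x₀ + z').1 := tnorm_mono fun p => by
      rw [happ]
      rcases hdisj p with h | h
      · simp [h]
      · rw [h, abs_zero]; exact abs_nonneg _
    have h3 : |b| ≤ D.tnorm (b • x₀ + z').1 := by
      have : D.tnorm (b • u 0) = |b| := by rw [D.tnorm_smul, hu.tnorm_eq, mul_one]
      rw [← this]
      refine tnorm_mono fun p => ?_
      rw [happ]
      rcases hdisj p with h | h <;> simp [h]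
    have h4 : K⁻¹ * |b| ≤ |b| := mul_le_of_le_one_left (abs_nonneg _) (inv_le_one_of_one_le₀ hK)
    rw [mul_inv]
    linarith

theorem IsNormalizedBlock.lt_bourgainIndex (hu : D.IsNormalizedBlock u) {K : ℝ} (hK : 1 ≤ K)
    (hθ : ∀ j : ℕ, ∃ n m : ℕ+, (m : ℕ) * j ≤ n ∧ 1 < D.θ n * K ^ (m : ℕ)) :
    Ordinal.omega0 ^ Ordinal.omega0 < bourgainIndex (D.blockSpan u) := by
  refine hu.lt_bourgainIndex_of_isometry hK hθ ((D.emb ∘ₗ Submodule.subtype _).codRestrict _ ?_)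
    (fun x y h => Subtype.ext (UniformSpace.Completion.coe_injective D.C00 (congrArg Subtype.val h)))
    fun x => norm_emb (D := D) x.1
  rintro ⟨x, hx⟩
  refine Submodule.le_topologicalClosure _ ?_
  have := Submodule.mem_map_of_mem (f := D.emb) hx
  rw [Submodule.map_span, ← Set.range_comp] at this
  exact this

/-! ### Conditions on the weights -/

theorem lt_bourgainIndex_of_not_bddAbove (h : ∃ ε : ℝ, 0 < ε ∧
    ¬ BddAbove {r : ℝ | ∃ n m : ℕ+, D.θ n ≥ ε ^ (m : ℕ) ∧ r = (n : ℝ) / (m : ℝ)})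
    (Y : Submodule ℝ D.Space) (hY : D.IsBlockSubspace Y) :
    Ordinal.omega0 ^ Ordinal.omega0 < bourgainIndex Y := by
  obtain ⟨u, hu, rfl⟩ := hY.exists_eq
  obtain ⟨ε, hε, hb⟩ := h
  have hε' : 0 < 2 / ε := by positivity
  -- Any `K ≥ 1` with `ε * K > 1` would do; here `ε * K = 2 + ε`.
  refine hu.lt_bourgainIndex (K := 2 / ε + 1) (by linarith) fun j => ?_
  obtain ⟨_, ⟨n, m, hθ, rfl⟩, hj⟩ := not_bddAbove_iff.1 hb j
  refine ⟨n, m, ?_, ?_⟩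
  · rw [lt_div_iff₀ (by exact_mod_cast m.pos)] at hj
    have : j * (m : ℕ) < n := by exact_mod_cast hj
    rw [mul_comm]; exact this.le
  · calc (1 : ℝ) < (2 + ε) ^ (m : ℕ) := one_lt_pow₀ (by linarith) m.ne_zero
      _ = ε ^ (m : ℕ) * (2 / ε + 1) ^ (m : ℕ) := by
        rw [← mul_pow]; congr 1; field_simp
      _ ≤ D.θ n * (2 / ε + 1) ^ (m : ℕ) := mul_le_mul_of_nonneg_right hθ (by positivity)

theorem not_bddAbove_of_isLUB (h : IsLUB (Set.range fun n : ℕ+ => D.θ n ^ (1 / (n : ℝ))) 1) :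
    ¬ BddAbove {r : ℝ | ∃ n m : ℕ+, D.θ n ≥ (1 / 2 : ℝ) ^ (m : ℕ) ∧ r = (n : ℝ) / (m : ℝ)} := by
  -- Every $\theta_n^{1/n}$ is below one, so the supremum is approached at arbitrarily large
  -- indices; the induction excludes one index at a time.
  have hfar : ∀ (N : ℕ) (q : ℝ), q < 1 → ∃ n : ℕ+, N < n ∧ q < D.θ n ^ (1 / (n : ℝ)) := by
    intro N
    induction N with
    | zero =>
      intro q hq
      obtain ⟨_, ⟨n, rfl⟩, hn, -⟩ := h.exists_between hq
      exact ⟨n, n.pos, hn⟩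
    | succ N ih =>
      intro q hq
      have hlt : D.θ N.succPNat ^ (1 / (N.succPNat : ℝ)) < 1 :=
        Real.rpow_lt_one (D.θ_pos _).le (D.θ_lt_one _) (by positivity)
      obtain ⟨n, hn, hqn⟩ := ih _ (max_lt hq hlt)
      refine ⟨n, lt_of_le_of_ne hn fun hne => ?_, (le_max_left _ _).trans_lt hqn⟩
      have : N.succPNat = n := PNat.eq hne
      rw [this] at hqn
      exact absurd hqn (not_lt.2 (le_max_right _ _))
  rw [not_bddAbove_iff]
  intro r
  obtain ⟨R, hR⟩ := exists_nat_gt (max r 1)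
  have hR1 : (1 : ℝ) < R := (le_max_right _ _).trans_lt hR
  have hR0 : (0 : ℝ) < R := one_pos.trans hR1
  -- Then $\theta_n \ge 2^{-n/(2R)}$, so $m = \lceil n/(2R) \rceil$ works, and $n > 2R$ absorbs the
  -- rounding: $Rm < n/2 + R < n$.
  obtain ⟨n, hn, hq⟩ := hfar (2 * R) ((1 / 2 : ℝ) ^ (1 / (2 * R : ℝ)))
    (Real.rpow_lt_one (by norm_num) (by norm_num) (by positivity))
  have hn' : (2 * R : ℝ) < n := by exact_mod_cast hn
  have hn0 : (0 : ℝ) < n := by exact_mod_cast n.pos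
  have hm : 0 < ⌈(n : ℝ) / (2 * R)⌉₊ := Nat.ceil_pos.2 (by positivity)
  refine ⟨_, ⟨n, ⟨⌈(n : ℝ) / (2 * R)⌉₊, hm⟩, ?_, rfl⟩, ?_⟩
  · have h1 : D.θ n = (D.θ n ^ (1 / (n : ℝ))) ^ (n : ℝ) := by
      rw [← Real.rpow_mul (D.θ_pos n).le, one_div, inv_mul_cancel₀ hn0.ne', Real.rpow_one]
    have h2 : ((1 / 2 : ℝ) ^ (1 / (2 * R : ℝ))) ^ (n : ℝ) ≤ D.θ n := by
      conv_rhs => rw [h1]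
      exact Real.rpow_le_rpow (by positivity) hq.le hn0.le
    refine le_trans ?_ h2
    rw [← Real.rpow_mul (by norm_num), ← Real.rpow_natCast]
    refine Real.rpow_le_rpow_of_exponent_ge (by norm_num) (by norm_num) ?_
    rw [one_div, inv_mul_eq_div]
    exact Nat.le_ceil _
  · refine (le_max_left r 1).trans_lt (hR.trans ?_)
    change (R : ℝ) < (n : ℝ) / ((⌈(n : ℝ) / (2 * R)⌉₊ : ℕ) : ℝ)
    rw [lt_div_iff₀ (by exact_mod_cast hm)]
    have h3 : ((⌈(n : ℝ) / (2 * R)⌉₊ : ℕ) : ℝ) < (n : ℝ) / (2 * R) + 1 :=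
      Nat.ceil_lt_add_one (by positivity)
    have h4 : (R : ℝ) * ((n : ℝ) / (2 * R) + 1) = n / 2 + R := by field_simp
    have h5 := mul_lt_mul_of_pos_left h3 hR0
    linarith

end TsirelsonData

end

theorem mainTheorem8 (D : TsirelsonData) :
    -- large index of all block subspaces implies quasi-minimality
    ((∀ Y : Submodule ℝ D.Space, D.IsBlockSubspace Y →
        Ordinal.omega0 ^ Ordinal.omega0 < bourgainIndex Y) →
      IsQuasiMinimal D.Space) ∧
    -- the first sufficient condition
    ((∃ ε : ℝ, 0 < ε ∧
        ¬ BddAbove {r : ℝ | ∃ n m : ℕ+, D.θ n ≥ ε ^ (m : ℕ) ∧ r = (n : ℝ) / (m : ℝ)}) →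
      (∀ Y : Submodule ℝ D.Space, D.IsBlockSubspace Y →
        Ordinal.omega0 ^ Ordinal.omega0 < bourgainIndex Y) ∧
      IsQuasiMinimal D.Space) ∧
    -- the second sufficient condition, a particular case of the first
    (IsLUB (Set.range fun n : ℕ+ => D.θ n ^ (1 / (n : ℝ))) 1 →
      (∃ ε : ℝ, 0 < ε ∧
        ¬ BddAbove {r : ℝ | ∃ n m : ℕ+, D.θ n ≥ ε ^ (m : ℕ) ∧ r = (n : ℝ) / (m : ℝ)}) ∧
      (∀ Y : Submodule ℝ D.Space, D.IsBlockSubspace Y →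
        Ordinal.omega0 ^ Ordinal.omega0 < bourgainIndex Y) ∧
      IsQuasiMinimal D.Space) := by
  refine ⟨TsirelsonData.isQuasiMinimal_of_lt_bourgainIndex, fun h => ?_, fun h => ?_⟩
  · have hI := TsirelsonData.lt_bourgainIndex_of_not_bddAbove h
    exact ⟨hI, TsirelsonData.isQuasiMinimal_of_lt_bourgainIndex hI⟩
  · have hε := TsirelsonData.not_bddAbove_of_isLUB h
    have hI := TsirelsonData.lt_bourgainIndex_of_not_bddAbove ⟨1 / 2, by norm_num, hε⟩
    exact ⟨⟨1 / 2, by norm_num, hε⟩, hI, TsirelsonData.isQuasiMinimal_of_lt_bourgainIndex hI⟩
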